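/- **Theorem.** Let $\mathcal{E}$ be a category with pullbacks. Write $\mathbf{Cat}(\mathcal{E})$ for the $2$-category of categories, functors and natural transformations internal to $\mathcal{E}$, $\mathbf{Cat}(\mathcal{E})_1$ for its underlying category, and $\mathbf{Gph}(\mathcal{E})$ for the category of internal graphs $G_1\rightrightarrows G_0$ in $\mathcal{E}$. The following are equivalent. (a) $\mathcal{E}$ is extensive, $\mathcal{E}$ has coequalisers and they are stable under pullback, and the forgetful functor $\mathcal{U}:\mathbf{Cat}(\mathcal{E})_1\to\mathbf{Gph}(\mathcal{E})$ has a left adjoint. (b) The $2$-category $\mathbf{Cat}(\mathcal{E})$ is extensive, has finite $2$-colimits, has pullbacks, and coequalisers in $\mathbf{Cat}(\mathcal{E})$ of parallel pairs of internal functors that agree on objects are stable under pullback along discrete Conduché fibrations. Here: * Limits, colimits and extensivity in $\mathbf{Cat}(\mathcal{E})$ are in the strict two-dimensional ($\mathbf{Cat}$-enriched) sense. Finite $2$-colimits are the colimits weighted by $2$-functors $W:\mathcal{J}^{\mathrm{op}}\to\mathbf{Cat}$ with $\mathcal{J}$ a finite $2$-category and every $W(j)$ a finite category. * A category, or $2$-category,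 is extensive if it has finite coproducts and pullbacks along coproduct coprojections and, for every commutative diagram consisting of two squares over the coprojections $X\to X+Y\leftarrow Y$ with top row $A\to Z\leftarrow B$, the top row is a coproduct diagram if and only if both squares are pullbacks. No terminal object is assumed. * Coequalisers in $\mathcal{E}$ are stable under pullback if for every coequaliser diagram $X\rightrightarrows Y\to C$ and all morphisms $C\to B$ and $i:A\to B$, the diagram $i^*X\rightrightarrows i^*Y\to i^*C$ is again a coequaliser diagram in $\mathcal{E}$. * Internal functors $F,G:\mathbb{A}\to\mathbb{B}$ agree on objects if $F_0=G_0$. An internal functor $P:\mathbb{X}\to\mathbb{Y}$ is a discrete Conduché fibration if the square formed by $P_2:X_2\to Y_2$, $P_1:X_1\to Y_1$ and the composition morphisms $m:X_2\to X_1$, $m:Y_2\to Y_1$ is a pullback, where $X_2=X_1\times_{X_0}X_1$ and $Y_2=Y_1\times_{Y_0}Y_1$ are the objects of composable pairs. * The last condition in (b) says: if $F,G:\mathbb{A}\rightrightarrows\mathbb{B}$ agree on objects and have coequaliser $Q:\mathbb{B}\to\mathbb{C}$, then for every internal functor $\mathbb{C}\to\mathbb{Y}$ and every discrete Conduché fibration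 $P:\mathbb{X}\to\mathbb{Y}$ the diagram $P^*\mathbb{A}\rightrightarrows P^*\mathbb{B}\to P^*\mathbb{C}$ is again a coequaliser diagram in $\mathbf{Cat}(\mathcal{E})$. -/

import Mathlib

open CategoryTheory CategoryTheory.Limits Bicategory Opposite

universe w v u

attribute [-instance] CategoryTheory.catToReflQuiver

/-! ## Two-dimensional limits and colimits in a strict 2-category

A 2-category is a `Bicategory` satisfying `Bicategory.Strict`. All universal properties below are the
`Cat`-enriched ones: they determine 1-cells and 2-cells uniquely. The `eqToHom`s only mediate
between the two sides of equalities of 1-cells. -/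

namespace TwoCat

section Basic

variable {K : Type u} [Bicategory.{w, v} K] [Bicategory.Strict K]

/-- Two-dimensional initial object: every hom-category out of `I` is the terminal category. -/
def IsInitial₂ (I : K) : Prop :=
  ∀ Z : K, (∃! _u : I ⟶ Z, True) ∧ ∀ u v : I ⟶ Z, ∃! _γ : u ⟶ v, True

/-- Two-dimensional binary coproduct. -/
structure IsCoproduct₂ {X Y P : K} (inl : X ⟶ P) (inr : Y ⟶ P) : Prop where
  existsUnique_desc : ∀ {Z : K} (f : X ⟶ Z) (g : Y ⟶ Z),
    ∃! h : P ⟶ Z, inl ≫ h = f ∧ inr ≫ h = g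
  existsUnique_desc₂ : ∀ {Z : K} (h k : P ⟶ Z) (α : inl ≫ h ⟶ inl ≫ k) (β : inr ≫ h ⟶ inr ≫ k),
    ∃! γ : h ⟶ k, inl ◁ γ = α ∧ inr ◁ γ = β

/-- The commutative square
```
  P --fst--> X
  |          |
 snd         f
  v          v
  Y ---g---> Z
```
is a two-dimensional pullback. -/
structure IsPullback₂ {P X Y Z : K} (fst : P ⟶ X) (snd : P ⟶ Y) (f : X ⟶ Z) (g : Y ⟶ Z) :
    Prop where
  w : fst ≫ f = snd ≫ g
  existsUnique_lift : ∀ {T : K} (a : T ⟶ X) (b : T ⟶ Y), a ≫ f = b ≫ g →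
    ∃! l : T ⟶ P, l ≫ fst = a ∧ l ≫ snd = b
  existsUnique_lift₂ : ∀ {T : K} (l m : T ⟶ P) (α : l ≫ fst ⟶ m ≫ fst) (β : l ≫ snd ⟶ m ≫ snd),
    α ▷ f = eqToHom (by simp only [Bicategory.Strict.assoc, w]) ≫ β ▷ g ≫
      eqToHom (by simp only [Bicategory.Strict.assoc, w]) →
    ∃! γ : l ⟶ m, γ ▷ fst = α ∧ γ ▷ snd = β

/-- `q` is a two-dimensional coequaliser of the parallel pair `f`, `g`. -/
structure IsCoequalizer₂ {A B C : K} (f g : A ⟶ B) (q : B ⟶ C) : Prop where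
  w : f ≫ q = g ≫ q
  existsUnique_desc : ∀ {Z : K} (r : B ⟶ Z), f ≫ r = g ≫ r → ∃! t : C ⟶ Z, q ≫ t = r
  existsUnique_desc₂ : ∀ {Z : K} (s t : C ⟶ Z) (α : q ≫ s ⟶ q ≫ t),
    f ◁ α = eqToHom (by simp only [← Bicategory.Strict.assoc, w]) ≫ g ◁ α ≫
      eqToHom (by simp only [← Bicategory.Strict.assoc, w]) →
    ∃! γ : s ⟶ t, q ◁ γ = α

variable (K)

/-- The 2-category `K` has pullbacks. -/
def HasPullbacks₂ : Prop :=
  ∀ {X Y Z : K} (f : X ⟶ Z) (g : Y ⟶ Z),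
    ∃ (P : K) (fst : P ⟶ X) (snd : P ⟶ Y), IsPullback₂ fst snd f g

/-- The 2-category `K` is extensive: it has finite coproducts and pullbacks along coproduct
coprojections, and in a commutative diagram
```
  A --a--> Z <--b-- B
  |        |        |
  s        z        t
  v        v        v
  X -inl-> P <-inr- Y
```
whose bottom row is a coproduct, the top row is a coproduct if and only if both squares are
pullbacks (everything in the two-dimensional sense). -/
structure IsExtensive₂ : Prop where
  exists_initial : ∃ I : K, IsInitial₂ I
  exists_coproduct : ∀ X Y : K, ∃ (P : K) (inl : X ⟶ P) (inr : Y ⟶ P), IsCoproduct₂ inl inr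
  exists_pullback_coprojection : ∀ {X Y P : K} (inl : X ⟶ P) (inr : Y ⟶ P),
    IsCoproduct₂ inl inr → ∀ {Z : K} (z : Z ⟶ P),
      (∃ (A : K) (a : A ⟶ Z) (s : A ⟶ X), IsPullback₂ a s z inl) ∧
      (∃ (B : K) (b : B ⟶ Z) (t : B ⟶ Y), IsPullback₂ b t z inr)
  coproduct_iff : ∀ {X Y P : K} (inl : X ⟶ P) (inr : Y ⟶ P), IsCoproduct₂ inl inr →
    ∀ {A B Z : K} (a : A ⟶ Z) (b : B ⟶ Z) (s : A ⟶ X) (t : B ⟶ Y) (z : Z ⟶ P),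
      a ≫ z = s ≫ inl → b ≫ z = t ≫ inr →
      (IsCoproduct₂ a b ↔ IsPullback₂ a s z inl ∧ IsPullback₂ b t z inr)

end Basic

section Weighted

variable {J : Type} [Bicategory.{0, 0} J]
  {K : Type u} [Bicategory.{w, v} K] [Bicategory.Strict K]

/-- A cocone with vertex `X` under the 2-functor `D : J → K` weighted by the 2-functor
`W : Jᵒᵖ → Cat`, that is, a strictly 2-natural transformation `W ⟶ K(D -, X)`. -/
structure WeightedCocone (W : StrictPseudofunctor Jᵒᵖ Cat.{0, 0}) (D : StrictPseudofunctor J K)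
    (X : K) where
  leg : ∀ j : J, W.obj (op j) ⥤ (D.obj j ⟶ X)
  naturality : ∀ {j k : J} (f : j ⟶ k) (x : W.obj (op k)),
    (leg j).obj ((W.map f.op).toFunctor.obj x) = D.map f ≫ (leg k).obj x
  naturality_map : ∀ {j k : J} (f : j ⟶ k) {x y : W.obj (op k)} (a : x ⟶ y),
    (leg j).map ((W.map f.op).toFunctor.map a) =
      eqToHom (naturality f x) ≫ D.map f ◁ (leg k).map a ≫ eqToHom (naturality f y).symm
  naturality₂ : ∀ {j k : J} {f g : j ⟶ k} (α : f ⟶ g) (x : W.obj (op k)),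
    (leg j).map ((W.map₂ (Bicategory.Opposite.op2 α)).toNatTrans.app x) =
      eqToHom (naturality f x) ≫ D.map₂ α ▷ (leg k).obj x ≫ eqToHom (naturality g x).symm

/-- The weighted cocone `φ` exhibits `C` as the `W`-weighted colimit of `D`: composition with `φ`
is an isomorphism of categories from `K(C, X)` to the category of `W`-weighted cocones with vertex
`X` and modifications between them, for every `X`. -/
structure IsWeightedColimit {W : StrictPseudofunctor Jᵒᵖ Cat.{0, 0}} {D : StrictPseudofunctor J K}
    {C : K} (φ : WeightedCocone W D C) : Prop where
  existsUnique_desc : ∀ {X : K} (ψ : WeightedCocone W D X),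
    ∃! u : C ⟶ X, ∀ j, φ.leg j ⋙ Bicategory.postcomp (D.obj j) u = ψ.leg j
  existsUnique_desc₂ : ∀ {X : K} (u v : C ⟶ X)
    (μ : ∀ j, φ.leg j ⋙ Bicategory.postcomp (D.obj j) u ⟶
      φ.leg j ⋙ Bicategory.postcomp (D.obj j) v),
    (∀ {j k : J} (f : j ⟶ k) (x : W.obj (op k)),
      (μ j).app ((W.map f.op).toFunctor.obj x) =
        eqToHom (by
          simp only [Functor.comp_obj, postcomp_obj, φ.naturality, Bicategory.Strict.assoc]) ≫
        D.map f ◁ (μ k).app x ≫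
        eqToHom (by
          simp only [Functor.comp_obj, postcomp_obj, φ.naturality, Bicategory.Strict.assoc])) →
    ∃! γ : u ⟶ v, ∀ j (x : W.obj (op j)), (φ.leg j).obj x ◁ γ = (μ j).app x

variable (K)

/-- The 2-category `K` has finite 2-colimits: all colimits weighted by 2-functors `W : Jᵒᵖ → Cat`
where `J` is a finite 2-category and `W` takes values in finite categories. -/
def HasFiniteColimits₂ : Prop :=
  ∀ (J : Type) [Bicategory.{0, 0} J] [Bicategory.Strict J] [Finite J]
    [∀ j k : J, FinCategory (j ⟶ k)]
    (W : StrictPseudofunctor Jᵒᵖ Cat.{0, 0}) [∀ j : J, FinCategory (W.obj (op j))]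
    (D : StrictPseudofunctor J K),
    ∃ (C : K) (φ : WeightedCocone W D C), IsWeightedColimit φ

end Weighted

end TwoCat

/-! ## Internal categories and internal graphs -/

section Internal

variable (E : Type u) [Category.{v} E]

/-- A category internal to `E`. The domain of `comp` is the object of composable pairs; a pair
`(f, g)` with `tgt f = src g` is composed in diagrammatic order. Associativity is stated on
generalised elements; taking the universal composable triple gives the usual diagram. -/
structure InternalCat [HasPullbacks E] where
  obj : E
  arr : E
  src : arr ⟶ obj
  tgt : arr ⟶ obj
  ident : obj ⟶ arr
  comp : pullback tgt src ⟶ arr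
  ident_src : ident ≫ src = 𝟙 obj
  ident_tgt : ident ≫ tgt = 𝟙 obj
  comp_src : comp ≫ src = pullback.fst tgt src ≫ src
  comp_tgt : comp ≫ tgt = pullback.snd tgt src ≫ tgt
  ident_comp : pullback.lift (src ≫ ident) (𝟙 arr) (by simp [ident_tgt]) ≫ comp = 𝟙 arr
  comp_ident : pullback.lift (𝟙 arr) (tgt ≫ ident) (by simp [ident_src]) ≫ comp = 𝟙 arr
  assoc : ∀ {T : E} (f g h : T ⟶ arr) (hfg : f ≫ tgt = g ≫ src) (hgh : g ≫ tgt = h ≫ src),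
    pullback.lift (pullback.lift f g hfg ≫ comp) h (by
      rw [Category.assoc, comp_tgt, pullback.lift_snd_assoc, hgh]) ≫ comp =
      pullback.lift f (pullback.lift g h hgh ≫ comp) (by
        rw [Category.assoc, comp_src, pullback.lift_fst_assoc, hfg]) ≫ comp

/-- A (directed, not necessarily reflexive) graph internal to `E`. -/
structure InternalGraph where
  obj : E
  arr : E
  src : arr ⟶ obj
  tgt : arr ⟶ obj

variable {E}

namespace InternalGraph

/-- A morphism of internal graphs. -/
@[ext]
structure Hom (G H : InternalGraph E) where
  onObj : G.obj ⟶ H.obj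
  onArr : G.arr ⟶ H.arr
  onArr_src : onArr ≫ H.src = G.src ≫ onObj
  onArr_tgt : onArr ≫ H.tgt = G.tgt ≫ onObj

/-- The category `Gph(E)` of graphs internal to `E`. -/
instance : Category (InternalGraph E) where
  Hom := Hom
  id G := ⟨𝟙 _, 𝟙 _, by simp, by simp⟩
  comp f g := ⟨f.onObj ≫ g.onObj, f.onArr ≫ g.onArr,
    by rw [Category.assoc, g.onArr_src, ← Category.assoc, f.onArr_src, Category.assoc],
    by rw [Category.assoc, g.onArr_tgt, ← Category.assoc, f.onArr_tgt, Category.assoc]⟩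
  id_comp f := Hom.ext (Category.id_comp _) (Category.id_comp _)
  comp_id f := Hom.ext (Category.comp_id _) (Category.comp_id _)
  assoc f g h := Hom.ext (Category.assoc _ _ _) (Category.assoc _ _ _)

end InternalGraph

namespace InternalCat

variable [HasPullbacks E]

/-- The composite of a composable pair of generalised elements of the object of arrows. -/
noncomputable def cmp (A : InternalCat E) {T : E} (f g : T ⟶ A.arr) (h : f ≫ A.tgt = g ≫ A.src) :
    T ⟶ A.arr :=
  pullback.lift f g h ≫ A.comp

section cmp

variable (A : InternalCat E) {S T : E}

lemma cmp_src (f g : T ⟶ A.arr) (h : f ≫ A.tgt = g ≫ A.src) : A.cmp f g h ≫ A.src = f ≫ A.src := by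
  rw [cmp, Category.assoc, A.comp_src, pullback.lift_fst_assoc]

lemma cmp_tgt (f g : T ⟶ A.arr) (h : f ≫ A.tgt = g ≫ A.src) : A.cmp f g h ≫ A.tgt = g ≫ A.tgt := by
  rw [cmp, Category.assoc, A.comp_tgt, pullback.lift_snd_assoc]

lemma precomp_cmp (t : S ⟶ T) (f g : T ⟶ A.arr) (h : f ≫ A.tgt = g ≫ A.src) :
    t ≫ A.cmp f g h = A.cmp (t ≫ f) (t ≫ g) (by simp [h]) := by
  simp only [cmp, ← Category.assoc]
  congr 1
  apply pullback.hom_ext <;>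
    simp only [Category.assoc, pullback.lift_fst, pullback.lift_snd]

lemma cmp_congr {f f' g g' : T ⟶ A.arr} (hf : f = f') (hg : g = g') (h : f ≫ A.tgt = g ≫ A.src) :
    A.cmp f g h = A.cmp f' g' (by rw [← hf, ← hg, h]) := by
  subst hf hg
  rfl

lemma cmp_assoc (f g h : T ⟶ A.arr) (hfg : f ≫ A.tgt = g ≫ A.src) (hgh : g ≫ A.tgt = h ≫ A.src) :
    A.cmp (A.cmp f g hfg) h (by rw [cmp_tgt, hgh]) =
      A.cmp f (A.cmp g h hgh) (by rw [cmp_src, hfg]) :=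
  A.assoc f g h hfg hgh

lemma ident_cmp (x : T ⟶ A.obj) (f : T ⟶ A.arr) (h : (x ≫ A.ident) ≫ A.tgt = f ≫ A.src) :
    A.cmp (x ≫ A.ident) f h = f := by
  have hx : x = f ≫ A.src := by simpa [A.ident_tgt] using h
  have key : f ≫ A.cmp (A.src ≫ A.ident) (𝟙 A.arr) (by simp [A.ident_tgt]) = f := by
    rw [cmp, A.ident_comp, Category.comp_id]
  subst hx
  rw [precomp_cmp] at key
  simpa using key

lemma cmp_ident (f : T ⟶ A.arr) (x : T ⟶ A.obj) (h : f ≫ A.tgt = (x ≫ A.ident) ≫ A.src) :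
    A.cmp f (x ≫ A.ident) h = f := by
  have hx : x = f ≫ A.tgt := by simpa [A.ident_src] using h.symm
  have key : f ≫ A.cmp (𝟙 A.arr) (A.tgt ≫ A.ident) (by simp [A.ident_src]) = f := by
    rw [cmp, A.comp_ident, Category.comp_id]
  subst hx
  rw [precomp_cmp] at key
  simpa using key

end cmp

/-- An internal functor. -/
@[ext]
structure Hom (A B : InternalCat E) where
  onObj : A.obj ⟶ B.obj
  onArr : A.arr ⟶ B.arr
  onArr_src : onArr ≫ B.src = A.src ≫ onObj
  onArr_tgt : onArr ≫ B.tgt = A.tgt ≫ onObj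
  ident_onArr : A.ident ≫ onArr = onObj ≫ B.ident
  comp_onArr : A.comp ≫ onArr =
    pullback.lift (pullback.fst A.tgt A.src ≫ onArr) (pullback.snd A.tgt A.src ≫ onArr)
      (by rw [Category.assoc, Category.assoc, onArr_src, onArr_tgt, ← Category.assoc,
        pullback.condition, Category.assoc]) ≫ B.comp

namespace Hom

variable {A B C : InternalCat E}

lemma composable (F : Hom A B) {T : E} {f g : T ⟶ A.arr} (h : f ≫ A.tgt = g ≫ A.src) :
    (f ≫ F.onArr) ≫ B.tgt = (g ≫ F.onArr) ≫ B.src := by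
  rw [Category.assoc, Category.assoc, F.onArr_src, F.onArr_tgt, ← Category.assoc, h,
    Category.assoc]

/-- The action of an internal functor on composable pairs. -/
noncomputable def onPairs (F : Hom A B) : pullback A.tgt A.src ⟶ pullback B.tgt B.src :=
  pullback.lift (pullback.fst A.tgt A.src ≫ F.onArr) (pullback.snd A.tgt A.src ≫ F.onArr)
    (F.composable pullback.condition)

lemma cmp_onArr (F : Hom A B) {T : E} (f g : T ⟶ A.arr) (h : f ≫ A.tgt = g ≫ A.src) :
    A.cmp f g h ≫ F.onArr = B.cmp (f ≫ F.onArr) (g ≫ F.onArr) (F.composable h) := by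
  simp only [cmp, Category.assoc, F.comp_onArr]
  simp only [← Category.assoc]
  congr 1
  apply pullback.hom_ext <;>
    simp only [Category.assoc, pullback.lift_fst, pullback.lift_snd, pullback.lift_fst_assoc, pullback.lift_snd_assoc]

/-- The identity internal functor. -/
def id (A : InternalCat E) : Hom A A where
  onObj := 𝟙 _
  onArr := 𝟙 _
  onArr_src := by simp
  onArr_tgt := by simp
  ident_onArr := by simp
  comp_onArr := by
    rw [Category.comp_id]
    conv_lhs => rw [← Category.id_comp A.comp]
    congr 1
    apply pullback.hom_ext <;> simp

/-- Composition of internal functors. -/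
def comp (F : Hom A B) (G : Hom B C) : Hom A C where
  onObj := F.onObj ≫ G.onObj
  onArr := F.onArr ≫ G.onArr
  onArr_src := by rw [Category.assoc, G.onArr_src, ← Category.assoc, F.onArr_src, Category.assoc]
  onArr_tgt := by rw [Category.assoc, G.onArr_tgt, ← Category.assoc, F.onArr_tgt, Category.assoc]
  ident_onArr := by
    rw [← Category.assoc, F.ident_onArr, Category.assoc, G.ident_onArr, Category.assoc]
  comp_onArr := by
    rw [← Category.assoc, F.comp_onArr]
    refine (G.cmp_onArr _ _ _).trans (cmp_congr _ ?_ ?_ _) <;> simp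

end Hom

/-- An internal natural transformation. -/
@[ext]
structure NatTrans {A B : InternalCat E} (F G : Hom A B) where
  app : A.obj ⟶ B.arr
  app_src : app ≫ B.src = F.onObj
  app_tgt : app ≫ B.tgt = G.onObj
  naturality :
    B.cmp F.onArr (A.tgt ≫ app) (by rw [Category.assoc, app_src, F.onArr_tgt]) =
      B.cmp (A.src ≫ app) G.onArr (by rw [Category.assoc, app_tgt, G.onArr_src])

namespace NatTrans

variable {A B C : InternalCat E}

/-- The identity-on-components transformation between functors that are equal. -/
def ofEq {F G : Hom A B} (h : F = G) : NatTrans F G where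
  app := F.onObj ≫ B.ident
  app_src := by rw [Category.assoc, B.ident_src, Category.comp_id]
  app_tgt := by rw [Category.assoc, B.ident_tgt, Category.comp_id, h]
  naturality := by
    subst h
    exact (cmp_congr _ rfl (Category.assoc _ _ _).symm _).trans ((cmp_ident _ _ _ (by
      rw [Category.assoc, B.ident_src, Category.comp_id, F.onArr_tgt])).trans
      ((ident_cmp _ (A.src ≫ F.onObj) _ (by
        rw [Category.assoc, B.ident_tgt, Category.comp_id, F.onArr_src])).symm.trans
        (cmp_congr _ (Category.assoc _ _ _) rfl _)))

/-- Vertical composition. -/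
noncomputable def vcomp {F G H : Hom A B} (α : NatTrans F G) (β : NatTrans G H) :
    NatTrans F H where
  app := B.cmp α.app β.app (by rw [α.app_tgt, β.app_src])
  app_src := by rw [cmp_src, α.app_src]
  app_tgt := by rw [cmp_tgt, β.app_tgt]
  naturality := by
    have h₁ : (A.tgt ≫ α.app) ≫ B.tgt = (A.tgt ≫ β.app) ≫ B.src := by
      rw [Category.assoc, Category.assoc, α.app_tgt, β.app_src]
    have h₂ : (A.src ≫ α.app) ≫ B.tgt = (A.src ≫ β.app) ≫ B.src := by
      rw [Category.assoc, Category.assoc, α.app_tgt, β.app_src]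
    have h₃ : F.onArr ≫ B.tgt = (A.tgt ≫ α.app) ≫ B.src := by
      rw [Category.assoc, α.app_src, F.onArr_tgt]
    have h₄ : (A.src ≫ α.app) ≫ B.tgt = G.onArr ≫ B.src := by
      rw [Category.assoc, α.app_tgt, G.onArr_src]
    have h₅ : G.onArr ≫ B.tgt = (A.tgt ≫ β.app) ≫ B.src := by
      rw [Category.assoc, β.app_src, G.onArr_tgt]
    have h₆ : (A.src ≫ β.app) ≫ B.tgt = H.onArr ≫ B.src := by
      rw [Category.assoc, β.app_tgt, H.onArr_src]
    calc _ = B.cmp F.onArr (B.cmp (A.tgt ≫ α.app) (A.tgt ≫ β.app) h₁) (by rw [cmp_src, h₃]) :=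
          cmp_congr _ rfl (precomp_cmp _ _ _ _ _) _
      _ = B.cmp (B.cmp F.onArr (A.tgt ≫ α.app) h₃) (A.tgt ≫ β.app) (by rw [cmp_tgt, h₁]) :=
          (cmp_assoc _ _ _ _ _ _).symm
      _ = B.cmp (B.cmp (A.src ≫ α.app) G.onArr h₄) (A.tgt ≫ β.app) (by rw [cmp_tgt, h₅]) :=
          cmp_congr _ α.naturality rfl _
      _ = B.cmp (A.src ≫ α.app) (B.cmp G.onArr (A.tgt ≫ β.app) h₅) (by rw [cmp_src, h₄]) :=
          cmp_assoc _ _ _ _ _ _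
      _ = B.cmp (A.src ≫ α.app) (B.cmp (A.src ≫ β.app) H.onArr h₆) (by rw [cmp_src, h₂]) :=
          cmp_congr _ rfl β.naturality _
      _ = B.cmp (B.cmp (A.src ≫ α.app) (A.src ≫ β.app) h₂) H.onArr (by rw [cmp_tgt, h₆]) :=
          (cmp_assoc _ _ _ _ _ _).symm
      _ = _ := cmp_congr _ (precomp_cmp _ _ _ _ _).symm rfl _

/-- Whiskering an internal natural transformation with a functor on the domain side. -/
def whiskerL (F : Hom A B) {G H : Hom B C} (α : NatTrans G H) :
    NatTrans (F.comp G) (F.comp H) where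
  app := F.onObj ≫ α.app
  app_src := by rw [Category.assoc, α.app_src]; rfl
  app_tgt := by rw [Category.assoc, α.app_tgt]; rfl
  naturality := by
    have key := congrArg (F.onArr ≫ ·) α.naturality
    simp only [precomp_cmp] at key
    refine (cmp_congr _ rfl ?_ _).trans (key.trans (cmp_congr _ ?_ rfl _))
    · rw [← Category.assoc, ← F.onArr_tgt, Category.assoc]
    · rw [← Category.assoc, F.onArr_src, Category.assoc]

/-- Whiskering an internal natural transformation with a functor on the codomain side. -/
def whiskerR {F G : Hom A B} (α : NatTrans F G) (H : Hom B C) :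
    NatTrans (F.comp H) (G.comp H) where
  app := α.app ≫ H.onArr
  app_src := by rw [Category.assoc, H.onArr_src, ← Category.assoc, α.app_src]; rfl
  app_tgt := by rw [Category.assoc, H.onArr_tgt, ← Category.assoc, α.app_tgt]; rfl
  naturality := by
    have key := congrArg (· ≫ H.onArr) α.naturality
    simp only [Hom.cmp_onArr] at key
    exact (cmp_congr _ rfl (Category.assoc _ _ _).symm _).trans
      (key.trans (cmp_congr _ (Category.assoc _ _ _) rfl _))

end NatTrans

/-- The category of internal functors and internal natural transformations. -/
noncomputable instance homCategory (A B : InternalCat E) : Category (Hom A B) where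
  Hom F G := NatTrans F G
  id _ := NatTrans.ofEq rfl
  comp := NatTrans.vcomp
  id_comp _ := NatTrans.ext (ident_cmp _ _ _ _)
  comp_id _ := NatTrans.ext (cmp_ident _ _ _ _)
  assoc _ _ _ := NatTrans.ext (cmp_assoc _ _ _ _ _ _)

/-- Equal internal functors are isomorphic through identity components. -/
noncomputable def isoOfEq {A B : InternalCat E} {F G : Hom A B} (h : F = G) :
    F ≅ G where
  hom := NatTrans.ofEq h
  inv := NatTrans.ofEq h.symm
  hom_inv_id := by
    subst h
    exact NatTrans.ext (cmp_ident _ _ _ _)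
  inv_hom_id := by
    subst h
    exact NatTrans.ext (cmp_ident _ _ _ _)

lemma ofEq_vcomp {A B : InternalCat E} {F F' G : Hom A B} (h : F = F') (α : NatTrans F' G) :
    ((NatTrans.ofEq h).vcomp α).app = α.app :=
  ident_cmp _ _ _ _

lemma vcomp_ofEq {A B : InternalCat E} {F G G' : Hom A B} (α : NatTrans F G) (h : G = G') :
    (α.vcomp (NatTrans.ofEq h)).app = α.app :=
  cmp_ident _ _ _ _

lemma ofEq_vcomp_vcomp_ofEq {A B : InternalCat E} {F F' G G' : Hom A B} (h : F = F')
    (α : NatTrans F' G) (h' : G = G') :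
    ((NatTrans.ofEq h).vcomp (α.vcomp (NatTrans.ofEq h'))).app = α.app :=
  (ofEq_vcomp _ _).trans (vcomp_ofEq _ _)

lemma ofEq_vcomp_ofEq {A B : InternalCat E} {F G H : Hom A B} (h : F = G) (h' : G = H) :
    (NatTrans.ofEq h).vcomp (NatTrans.ofEq h') = NatTrans.ofEq (h.trans h') := by
  subst h
  exact NatTrans.ext (ofEq_vcomp _ _)

lemma ofEq_whiskerR {A B C : InternalCat E} {F G : Hom A B} (h : F = G) (H : Hom B C) :
    (NatTrans.ofEq h).whiskerR H = NatTrans.ofEq (congrArg (Hom.comp · H) h) := by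
  refine NatTrans.ext ?_
  change (F.onObj ≫ B.ident) ≫ H.onArr = (F.onObj ≫ H.onObj) ≫ C.ident
  rw [Category.assoc, H.ident_onArr, Category.assoc]

lemma whiskerL_ofEq {A B C : InternalCat E} (F : Hom A B) {G H : Hom B C} (h : G = H) :
    NatTrans.whiskerL F (NatTrans.ofEq h) = NatTrans.ofEq (congrArg (Hom.comp F ·) h) :=
  NatTrans.ext (Category.assoc _ _ _).symm

lemma Hom.id_comp {A B : InternalCat E} (F : Hom A B) : (Hom.id A).comp F = F :=
  Hom.ext (Category.id_comp _) (Category.id_comp _)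

lemma Hom.comp_id {A B : InternalCat E} (F : Hom A B) : F.comp (Hom.id B) = F :=
  Hom.ext (Category.comp_id _) (Category.comp_id _)

lemma Hom.assoc {A B C D : InternalCat E} (F : Hom A B) (G : Hom B C) (H : Hom C D) :
    (F.comp G).comp H = F.comp (G.comp H) :=
  Hom.ext (Category.assoc _ _ _) (Category.assoc _ _ _)

/-- The 2-category `Cat(E)` of internal categories, functors and natural transformations. -/
noncomputable instance : Bicategory (InternalCat E) where
  Hom := Hom
  id := Hom.id
  comp := Hom.comp
  homCategory := homCategory
  whiskerLeft F _ _ α := NatTrans.whiskerL F α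
  whiskerRight α H := NatTrans.whiskerR α H
  associator F G H := isoOfEq (Hom.assoc F G H)
  leftUnitor F := isoOfEq (Hom.id_comp F)
  rightUnitor F := isoOfEq (Hom.comp_id F)
  whiskerLeft_id F G := NatTrans.ext (Category.assoc _ _ _).symm
  whiskerLeft_comp F _ _ _ α β := NatTrans.ext (precomp_cmp _ _ _ _ _)
  id_whiskerLeft {_ _ F G} α := NatTrans.ext
    ((Category.id_comp _).trans
      (ofEq_vcomp_vcomp_ofEq (Hom.id_comp F) α (Hom.id_comp G).symm).symm)
  comp_whiskerLeft F G H H' α := NatTrans.ext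
    ((Category.assoc _ _ _).trans (ofEq_vcomp_vcomp_ofEq (Hom.assoc F G H)
      (NatTrans.whiskerL F (NatTrans.whiskerL G α)) (Hom.assoc F G H').symm).symm)
  id_whiskerRight F G := ofEq_whiskerR _ _
  comp_whiskerRight α β H := NatTrans.ext (H.cmp_onArr _ _ _)
  whiskerRight_id {_ _ F G} α := NatTrans.ext
    ((Category.comp_id _).trans
      (ofEq_vcomp_vcomp_ofEq (Hom.comp_id F) α (Hom.comp_id G).symm).symm)
  whiskerRight_comp {_ _ _ _ F F'} α G H := NatTrans.ext
    ((Category.assoc _ _ _).symm.trans (ofEq_vcomp_vcomp_ofEq (Hom.assoc F G H).symm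
      (NatTrans.whiskerR (NatTrans.whiskerR α G) H) (Hom.assoc F' G H)).symm)
  whisker_assoc F G G' α H := NatTrans.ext
    ((Category.assoc _ _ _).trans (ofEq_vcomp_vcomp_ofEq (Hom.assoc F G H)
      (NatTrans.whiskerL F (NatTrans.whiskerR α H)) (Hom.assoc F G' H).symm).symm)
  whisker_exchange {A B C F G H I} α β := NatTrans.ext (by
    have key := congrArg (α.app ≫ ·) β.naturality
    simp only [precomp_cmp] at key
    refine Eq.trans (cmp_congr _ ?_ rfl _) (key.symm.trans (cmp_congr _ rfl ?_ _))
    · change F.onObj ≫ β.app = _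
      rw [← Category.assoc, α.app_src]
    · change _ = G.onObj ≫ β.app
      rw [← Category.assoc, α.app_tgt])
  pentagon F G H I := by
    change ((NatTrans.ofEq (Hom.assoc F G H)).whiskerR I).vcomp
      ((NatTrans.ofEq (Hom.assoc F (Hom.comp G H) I)).vcomp
        (NatTrans.whiskerL F (NatTrans.ofEq (Hom.assoc G H I)))) =
      (NatTrans.ofEq (Hom.assoc (Hom.comp F G) H I)).vcomp
        (NatTrans.ofEq (Hom.assoc F G (Hom.comp H I)))
    simp only [ofEq_whiskerR, whiskerL_ofEq, ofEq_vcomp_ofEq]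
  triangle F G := by
    change (NatTrans.ofEq (Hom.assoc F (Hom.id _) G)).vcomp
      (NatTrans.whiskerL F (NatTrans.ofEq (Hom.id_comp G))) =
      (NatTrans.ofEq (Hom.comp_id F)).whiskerR G
    simp only [ofEq_whiskerR, whiskerL_ofEq, ofEq_vcomp_ofEq]

lemma eqToIso_eq_isoOfEq {A B : InternalCat E} {F G : Hom A B} (h : F = G) :
    eqToIso h = isoOfEq h := by
  subst h
  rfl

instance : Bicategory.Strict (InternalCat E) where
  id_comp := Hom.id_comp
  comp_id := Hom.comp_id
  assoc := Hom.assoc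
  leftUnitor_eqToIso _ := (eqToIso_eq_isoOfEq _).symm
  rightUnitor_eqToIso _ := (eqToIso_eq_isoOfEq _).symm
  associator_eqToIso _ _ _ := (eqToIso_eq_isoOfEq _).symm

variable (E) in
/-- The forgetful functor `U : Cat(E)₁ ⥤ Gph(E)`; the category structure on its domain is the
underlying category of the 2-category `Cat(E)`. -/
def forgetToGraph : InternalCat E ⥤ InternalGraph E where
  obj A := ⟨A.obj, A.arr, A.src, A.tgt⟩
  map F := ⟨Hom.onObj F, Hom.onArr F, Hom.onArr_src F, Hom.onArr_tgt F⟩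

/-- An internal functor is a discrete Conduché fibration if the square
```
  X₂ --F₂--> Y₂
  |          |
 comp       comp
  v          v
  X₁ --F₁--> Y₁
```
is a pullback. -/
def IsDiscreteConduche {X Y : InternalCat E} (F : X ⟶ Y) : Prop :=
  IsPullback (Hom.onPairs F) X.comp Y.comp (Hom.onArr F)

variable (E) in
/-- Coequalisers in `Cat(E)` of parallel pairs of internal functors that agree on objects are stable
under pullback along discrete Conduché fibrations: given a coequaliser `F, G : A ⇉ B ⟶ C` of
such a pair, a functor `c : C ⟶ Y` and a discrete Conduché fibration `p : X ⟶ Y`, the pulled back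
diagram `F', G' : A' ⇉ B' ⟶ C'` over `X` is a coequaliser. -/
def ConducheStableCoequalizers : Prop :=
  ∀ {A B C X Y : InternalCat E} (F G : A ⟶ B) (Q : B ⟶ C), Hom.onObj F = Hom.onObj G →
    TwoCat.IsCoequalizer₂ F G Q → ∀ (c : C ⟶ Y) (p : X ⟶ Y), IsDiscreteConduche p →
    ∀ {A' B' C' : InternalCat E} (pA : A' ⟶ A) (a : A' ⟶ X) (pB : B' ⟶ B) (b : B' ⟶ X)
      (pC : C' ⟶ C) (c' : C' ⟶ X) (F' G' : A' ⟶ B') (Q' : B' ⟶ C'),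
      TwoCat.IsPullback₂ pA a (F ≫ Q ≫ c) p →
      TwoCat.IsPullback₂ pB b (Q ≫ c) p →
      TwoCat.IsPullback₂ pC c' c p →
      F' ≫ pB = pA ≫ F → F' ≫ b = a →
      G' ≫ pB = pA ≫ G → G' ≫ b = a →
      Q' ≫ pC = pB ≫ Q → Q' ≫ c' = b →
      TwoCat.IsCoequalizer₂ F' G' Q'

end InternalCat

variable (E) in
/-- `E` has pullback-stable coequalisers: it has coequalisers, and given a coequaliser
`f, g : X ⇉ Y ⟶ C`, a morphism `c : C ⟶ B` and a morphism `i : A ⟶ B`, the diagram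
`f', g' : X' ⇉ Y' ⟶ C'` over `A` obtained by pulling back along `i` is a coequaliser. -/
def HasPullbackStableCoequalizers : Prop :=
  HasCoequalizers E ∧
  ∀ {X Y C A B : E} (f g : X ⟶ Y) (q : Y ⟶ C) (w : f ≫ q = g ≫ q),
    Nonempty (IsColimit (Cofork.ofπ q w)) → ∀ (c : C ⟶ B) (i : A ⟶ B)
    {X' Y' C' : E} (pX : X' ⟶ X) (x : X' ⟶ A) (pY : Y' ⟶ Y) (y : Y' ⟶ A)
      (pC : C' ⟶ C) (c' : C' ⟶ A) (f' g' : X' ⟶ Y') (q' : Y' ⟶ C') (w' : f' ≫ q' = g' ≫ q'),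
      IsPullback pX x (f ≫ q ≫ c) i →
      IsPullback pY y (q ≫ c) i →
      IsPullback pC c' c i →
      f' ≫ pY = pX ≫ f → f' ≫ y = x →
      g' ≫ pY = pX ≫ g → g' ≫ y = x →
      q' ≫ pC = pY ≫ q → q' ≫ c' = y →
      Nonempty (IsColimit (Cofork.ofπ q' w'))

end Internal

/-!
Both halves of the equivalence rest on a comparison between constructions in `Cat(E)` and
constructions on the objects of objects and of arrows.

Two-dimensional universal properties reduce to one-dimensional ones, because a 2-cell into `X` is a
functor into the internal category of arrows of `X` (`isCoproduct₂_of_existsUnique`,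
`isCoequalizer₂_of_existsUnique`, `CoconeData.isWeightedColimit`). Pullbacks in `Cat(E)` are
computed on objects and on arrows (`isPullback₂_iff`), and when `E` is extensive the same is true of
coproducts (`isCoproduct₂_iff`); so extensivity passes from `E` to `Cat(E)` (`isExtensive₂`).

Suppose that coequalisers in `E` are stable. Let `u, v` be a pair of families of parallel arrows of
an internal category `L`, closed under composition with arrows of `L` on both sides. The coequaliser
of `u` and `v` in `E` is stable, hence composition descends to it, one factor at a time, and the
result is a quotient category with the same objects (`IsIdealPair.exists_quotient`). Any pair `p, q`
of families of parallel arrows generates such a pair: compose with arrows on both sides, over the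
object of composable triples whose middle term is an element of the family. This gives universal
solutions of `p = q` (`exists_parallelQuotient`), and it has two consequences.
* Together with free categories on graphs it provides a universal solution of arbitrary finite
  systems of equations between objects and arrows (`IsEquational.exists_quotient`). A finite
  weighted colimit is such a solution: take the coproduct of all the functors and free arrows of
  which a cocone consists, and impose the axioms of a cocone (`hasFiniteColimits₂`).
* A coequaliser of functors that agree on objects is, on arrows, a coequaliser in `E` of a pair of
  maps defined on an object of composable triples. A discrete Conduché fibration lifts
  factorisations uniquely, so these triples are preserved by pulling back along it
  (`isPullback_triple`), and stability in `E` gives stability in `Cat(E)`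
  (`conducheStableCoequalizers`).

In the converse direction, `E` is embedded in `Cat(E)` by discrete categories, which preserve and
reflect pullbacks and coproducts (`isPullback₂_disc_iff`, `isCoproduct₂_disc_iff`). A colimit of
discrete categories retracts the discrete category on its objects, so that passage to objects turns
it into a colimit in `E` (`onObj_comp_fromDisc`); this yields extensivity and coequalisers. The free
category on a graph is the coinserter of its source and target, seen as functors between discrete
categories (`isRightAdjoint_forgetToGraph`). For stability, a family `Y ⟶ B` is encoded as its
suspension, the category with two copies of `B` as objects and `Y` as the object of non-identity
arrows. Suspension turns a coequaliser over `B` into a coequaliser of functors that agree on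
objects, change of base along `A ⟶ B` is pullback along the functor between discrete categories,
which is a discrete Conduché fibration, and suspension reflects isomorphisms
(`hasPullbackStableCoequalizers`).
-/

/-! ### Internal functors and natural transformations -/

namespace InternalCat
variable {E : Type u} [Category.{v} E] [HasPullbacks E]

section Basic
variable {A B C : InternalCat E}

@[simp] lemma onObj_comp (F : A ⟶ B) (G : B ⟶ C) :
    Hom.onObj (F ≫ G) = Hom.onObj F ≫ Hom.onObj G := rfl

@[simp] lemma onArr_comp (F : A ⟶ B) (G : B ⟶ C) :
    Hom.onArr (F ≫ G) = Hom.onArr F ≫ Hom.onArr G := rfl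

@[ext] lemma hom_ext {F G : A ⟶ B} (h₀ : Hom.onObj F = Hom.onObj G)
    (h₁ : Hom.onArr F = Hom.onArr G) : F = G := Hom.ext h₀ h₁

/-- An internal functor is determined by its action on arrows. -/
lemma hom_ext_arr {F G : A ⟶ B} (h : Hom.onArr F = Hom.onArr G) : F = G := by
  refine hom_ext ?_ h
  have key (F : A ⟶ B) : Hom.onObj F = A.ident ≫ Hom.onArr F ≫ B.src := by
    rw [Hom.onArr_src, ← Category.assoc, A.ident_src, Category.id_comp]
  rw [key F, key G, h]

@[ext] lemma hom₂_ext {F G : A ⟶ B} {α β : F ⟶ G} (h : NatTrans.app α = NatTrans.app β) :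
    α = β := NatTrans.ext h

@[simp] lemma app_whiskerLeft (F : A ⟶ B) {G H : B ⟶ C} (α : G ⟶ H) :
    NatTrans.app (F ◁ α) = Hom.onObj F ≫ NatTrans.app α := rfl

@[simp] lemma app_whiskerRight {F G : A ⟶ B} (α : F ⟶ G) (H : B ⟶ C) :
    NatTrans.app (α ▷ H) = NatTrans.app α ≫ Hom.onArr H := rfl

@[simp] lemma app_id (F : A ⟶ B) : NatTrans.app (𝟙 F) = Hom.onObj F ≫ B.ident := rfl

@[simp] lemma app_eqToHom_comp {F G H : A ⟶ B} (h : F = G) (α : G ⟶ H) :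
    NatTrans.app (eqToHom h ≫ α) = NatTrans.app α := by
  subst h; simp

@[simp] lemma app_comp_eqToHom {F G H : A ⟶ B} (α : F ⟶ G) (h : G = H) :
    NatTrans.app (α ≫ eqToHom h) = NatTrans.app α := by
  subst h; simp

lemma cmp_fst_snd (A : InternalCat E) :
    A.cmp (pullback.fst A.tgt A.src) (pullback.snd A.tgt A.src) pullback.condition = A.comp := by
  have : pullback.lift (pullback.fst A.tgt A.src) (pullback.snd A.tgt A.src)
      pullback.condition = 𝟙 _ := by
    apply pullback.hom_ext <;> simp
  rw [cmp, this, Category.id_comp]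

lemma cmp_of_left_eq_ident (A : InternalCat E) {T : E} {i f : T ⟶ A.arr} (x : T ⟶ A.obj)
    (hi : i = x ≫ A.ident) (h : i ≫ A.tgt = f ≫ A.src) : A.cmp i f h = f := by
  subst hi
  exact A.ident_cmp x f h

lemma cmp_of_right_eq_ident (A : InternalCat E) {T : E} {f i : T ⟶ A.arr} (x : T ⟶ A.obj)
    (hi : i = x ≫ A.ident) (h : f ≫ A.tgt = i ≫ A.src) : A.cmp f i h = f := by
  subst hi
  exact A.cmp_ident f x h

/-- An internal functor from a morphism of underlying graphs that preserves identities and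
composites. -/
def homMk (onObj : A.obj ⟶ B.obj) (onArr : A.arr ⟶ B.arr)
    (onArr_src : onArr ≫ B.src = A.src ≫ onObj)
    (onArr_tgt : onArr ≫ B.tgt = A.tgt ≫ onObj) (ident_onArr : A.ident ≫ onArr = onObj ≫ B.ident)
    (cmp_onArr : ∀ {T : E} (f g : T ⟶ A.arr) (h : f ≫ A.tgt = g ≫ A.src),
      A.cmp f g h ≫ onArr = B.cmp (f ≫ onArr) (g ≫ onArr) (by
        rw [Category.assoc, Category.assoc, onArr_src, onArr_tgt, ← Category.assoc, h,
          Category.assoc])) : A ⟶ B :=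
  Hom.mk onObj onArr onArr_src onArr_tgt ident_onArr (by
    rw [← cmp_fst_snd A]; exact cmp_onArr _ _ _)

/-- An internal category whose composition is given on generalised elements. -/
@[reducible] noncomputable def ofCmp (obj arr : E) (src tgt : arr ⟶ obj) (ident : obj ⟶ arr)
    (c : ∀ {T : E} (f g : T ⟶ arr), f ≫ tgt = g ≫ src → (T ⟶ arr))
    (comp_c : ∀ {S T : E} (s : S ⟶ T) (f g : T ⟶ arr) (h : f ≫ tgt = g ≫ src),
      s ≫ c f g h = c (s ≫ f) (s ≫ g) (by simp [h]))
    (ident_src : ident ≫ src = 𝟙 obj) (ident_tgt : ident ≫ tgt = 𝟙 obj)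
    (c_src : ∀ {T : E} (f g : T ⟶ arr) (h : f ≫ tgt = g ≫ src), c f g h ≫ src = f ≫ src)
    (c_tgt : ∀ {T : E} (f g : T ⟶ arr) (h : f ≫ tgt = g ≫ src), c f g h ≫ tgt = g ≫ tgt)
    (ident_c : ∀ h, c (src ≫ ident) (𝟙 arr) h = 𝟙 arr)
    (c_ident : ∀ h, c (𝟙 arr) (tgt ≫ ident) h = 𝟙 arr)
    (assoc : ∀ {T : E} (f g h : T ⟶ arr) (hfg : f ≫ tgt = g ≫ src) (hgh : g ≫ tgt = h ≫ src),
      c (c f g hfg) h (by rw [c_tgt, hgh]) = c f (c g h hgh) (by rw [c_src, hfg])) :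
    InternalCat E :=
  have key : ∀ {T : E} (f g : T ⟶ arr) (h : f ≫ tgt = g ≫ src),
      pullback.lift f g h ≫ c (pullback.fst tgt src) (pullback.snd tgt src) pullback.condition =
        c f g h := fun f g h => by
    simp only [comp_c, pullback.lift_fst, pullback.lift_snd]
  { obj := obj
    arr := arr
    src := src
    tgt := tgt
    ident := ident
    comp := c (pullback.fst tgt src) (pullback.snd tgt src) pullback.condition
    ident_src := ident_src
    ident_tgt := ident_tgt
    comp_src := c_src _ _ _
    comp_tgt := c_tgt _ _ _
    ident_comp := by rw [key, ident_c]
    comp_ident := by rw [key, c_ident]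
    assoc := fun f g h hfg hgh => by simp only [key]; exact assoc f g h hfg hgh }

lemma ofCmp_cmp {obj arr : E} {src tgt : arr ⟶ obj} {ident : obj ⟶ arr}
    {c : ∀ {T : E} (f g : T ⟶ arr), f ≫ tgt = g ≫ src → (T ⟶ arr)}
    {comp_c : ∀ {S T : E} (s : S ⟶ T) (f g : T ⟶ arr) (h : f ≫ tgt = g ≫ src),
      s ≫ c f g h = c (s ≫ f) (s ≫ g) (by simp [h])}
    {ident_src ident_tgt c_src c_tgt ident_c c_ident assoc} {T : E} (f g : T ⟶ arr)
    (h : f ≫ tgt = g ≫ src) :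
    (ofCmp obj arr src tgt ident c comp_c ident_src ident_tgt c_src c_tgt ident_c c_ident
      assoc).cmp f g h = c f g h := by
  change pullback.lift f g h ≫ c (pullback.fst tgt src) (pullback.snd tgt src) _ = _
  simp only [comp_c, pullback.lift_fst, pullback.lift_snd]

end Basic

/-! ### The internal category of arrows -/

section ArrowCat
variable (X : InternalCat E) {S T : E}

lemma lift_comp_eq {f g f' g' : T ⟶ X.arr} {h : f ≫ X.tgt = g ≫ X.src}
    {h' : f' ≫ X.tgt = g' ≫ X.src} (e : X.cmp f g h = X.cmp f' g' h') :
    pullback.lift f g h ≫ X.comp = pullback.lift f' g' h' ≫ X.comp := e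

/-- A commutative square `t · r = l · b` of generalised arrows, as a generalised element of the
object of squares. -/
noncomputable def sq (t r l b : T ⟶ X.arr) (h₁ : t ≫ X.tgt = r ≫ X.src) (h₂ : l ≫ X.tgt = b ≫ X.src)
    (h : X.cmp t r h₁ = X.cmp l b h₂) : T ⟶ pullback X.comp X.comp :=
  pullback.lift (pullback.lift t r h₁) (pullback.lift l b h₂) (X.lift_comp_eq h)

/-- The top edge of the universal square. -/
noncomputable def sqTop : pullback X.comp X.comp ⟶ X.arr := pullback.fst _ _ ≫ pullback.fst _ _

/-- The right edge of the universal square. -/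
noncomputable def sqRight : pullback X.comp X.comp ⟶ X.arr := pullback.fst _ _ ≫ pullback.snd _ _

/-- The left edge of the universal square. -/
noncomputable def sqLeft : pullback X.comp X.comp ⟶ X.arr := pullback.snd _ _ ≫ pullback.fst _ _

/-- The bottom edge of the universal square. -/
noncomputable def sqBot : pullback X.comp X.comp ⟶ X.arr := pullback.snd _ _ ≫ pullback.snd _ _

section
variable (t r l b : T ⟶ X.arr) (h₁ : t ≫ X.tgt = r ≫ X.src) (h₂ : l ≫ X.tgt = b ≫ X.src)
    (h : X.cmp t r h₁ = X.cmp l b h₂)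

@[simp] lemma sq_top : X.sq t r l b h₁ h₂ h ≫ X.sqTop = t := by
  rw [sq, sqTop, pullback.lift_fst_assoc, pullback.lift_fst]
@[simp] lemma sq_right : X.sq t r l b h₁ h₂ h ≫ X.sqRight = r := by
  rw [sq, sqRight, pullback.lift_fst_assoc, pullback.lift_snd]
@[simp] lemma sq_left : X.sq t r l b h₁ h₂ h ≫ X.sqLeft = l := by
  rw [sq, sqLeft, pullback.lift_snd_assoc, pullback.lift_fst]
@[simp] lemma sq_bot : X.sq t r l b h₁ h₂ h ≫ X.sqBot = b := by
  rw [sq, sqBot, pullback.lift_snd_assoc, pullback.lift_snd]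
end

variable {X}

lemma sq_hom_ext {s s' : T ⟶ pullback X.comp X.comp} (ht : s ≫ X.sqTop = s' ≫ X.sqTop)
    (hr : s ≫ X.sqRight = s' ≫ X.sqRight) (hl : s ≫ X.sqLeft = s' ≫ X.sqLeft)
    (hb : s ≫ X.sqBot = s' ≫ X.sqBot) : s = s' := by
  apply pullback.hom_ext <;> apply pullback.hom_ext <;>
    simpa [sqTop, sqRight, sqLeft, sqBot] using by assumption

variable (X)

lemma sqTop_tgt : X.sqTop ≫ X.tgt = X.sqRight ≫ X.src := by
  simp [sqTop, sqRight, pullback.condition]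

lemma sqLeft_tgt : X.sqLeft ≫ X.tgt = X.sqBot ≫ X.src := by
  simp [sqLeft, sqBot, pullback.condition]

lemma sq_comm : X.cmp X.sqTop X.sqRight X.sqTop_tgt = X.cmp X.sqLeft X.sqBot X.sqLeft_tgt := by
  have h := pullback.condition (f := X.comp) (g := X.comp)
  have e₁ := congrArg (pullback.fst X.comp X.comp ≫ ·) X.cmp_fst_snd
  have e₂ := congrArg (pullback.snd X.comp X.comp ≫ ·) X.cmp_fst_snd
  simp only [precomp_cmp] at e₁ e₂
  exact e₁.trans (h.trans e₂.symm)

lemma sqTop_src : X.sqTop ≫ X.src = X.sqLeft ≫ X.src := by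
  rw [← X.cmp_src _ _ X.sqTop_tgt, sq_comm, cmp_src]

lemma sqBot_tgt : X.sqBot ≫ X.tgt = X.sqRight ≫ X.tgt := by
  rw [← X.cmp_tgt _ _ X.sqLeft_tgt, ← sq_comm, cmp_tgt]

lemma sq_comm' (s : T ⟶ pullback X.comp X.comp) :
    X.cmp (s ≫ X.sqTop) (s ≫ X.sqRight) (by simp [sqTop_tgt]) =
      X.cmp (s ≫ X.sqLeft) (s ≫ X.sqBot) (by simp [sqLeft_tgt]) := by
  rw [← precomp_cmp _ _ _ _ X.sqTop_tgt, sq_comm, precomp_cmp]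

lemma sq_paste (s s' : T ⟶ pullback X.comp X.comp) (h : s ≫ X.sqRight = s' ≫ X.sqLeft)
    (h₁ : (s ≫ X.sqTop) ≫ X.tgt = (s' ≫ X.sqTop) ≫ X.src)
    (h₂ : (s ≫ X.sqBot) ≫ X.tgt = (s' ≫ X.sqBot) ≫ X.src) :
    X.cmp (X.cmp (s ≫ X.sqTop) (s' ≫ X.sqTop) h₁) (s' ≫ X.sqRight)
        (by rw [cmp_tgt]; simp [sqTop_tgt]) =
      X.cmp (s ≫ X.sqLeft) (X.cmp (s ≫ X.sqBot) (s' ≫ X.sqBot) h₂)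
        (by rw [cmp_src]; simp [sqLeft_tgt]) := by
  have e : (s' ≫ X.sqLeft) ≫ X.tgt = (s' ≫ X.sqBot) ≫ X.src := by simp [sqLeft_tgt]
  have e' : (s ≫ X.sqTop) ≫ X.tgt = (s ≫ X.sqRight) ≫ X.src := by simp [sqTop_tgt]
  calc _ = X.cmp (s ≫ X.sqTop) (X.cmp (s' ≫ X.sqTop) (s' ≫ X.sqRight) (by simp [sqTop_tgt])) _ :=
        cmp_assoc _ _ _ _ _ _
    _ = X.cmp (s ≫ X.sqTop) (X.cmp (s ≫ X.sqRight) (s' ≫ X.sqBot) (by rw [h, e]))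
          (by rw [cmp_src, e']) :=
        cmp_congr _ rfl ((X.sq_comm' s').trans (cmp_congr _ h.symm rfl _)) _
    _ = X.cmp (X.cmp (s ≫ X.sqTop) (s ≫ X.sqRight) e') (s' ≫ X.sqBot) (by rw [cmp_tgt, h, e]) :=
        (cmp_assoc _ _ _ _ _ _).symm
    _ = X.cmp (X.cmp (s ≫ X.sqLeft) (s ≫ X.sqBot) (by simp [sqLeft_tgt])) (s' ≫ X.sqBot)
          (by rw [cmp_tgt, h₂]) := cmp_congr _ (X.sq_comm' s) rfl _
    _ = _ := cmp_assoc _ _ _ _ _ _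

lemma sq_top_composable (s s' : T ⟶ pullback X.comp X.comp) (h : s ≫ X.sqRight = s' ≫ X.sqLeft) :
    (s ≫ X.sqTop) ≫ X.tgt = (s' ≫ X.sqTop) ≫ X.src := by
  rw [Category.assoc, Category.assoc, sqTop_tgt, sqTop_src, reassoc_of% h]

lemma sq_bot_composable (s s' : T ⟶ pullback X.comp X.comp) (h : s ≫ X.sqRight = s' ≫ X.sqLeft) :
    (s ≫ X.sqBot) ≫ X.tgt = (s' ≫ X.sqBot) ≫ X.src := by
  rw [Category.assoc, Category.assoc, sqBot_tgt, ← sqLeft_tgt, reassoc_of% h]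

/-- The cotensor of `X` by the arrow category: its objects are the arrows of `X`, its arrows are
the commutative squares in `X`, composed horizontally. -/
@[reducible] noncomputable def arrowCat : InternalCat E :=
  ofCmp X.arr (pullback X.comp X.comp) X.sqLeft X.sqRight
    (X.sq (X.src ≫ X.ident) (𝟙 _) (𝟙 _) (X.tgt ≫ X.ident) (by simp [ident_tgt])
      (by simp [ident_src]) (by rw [X.ident_cmp, X.cmp_ident]))
    (fun s s' h => X.sq (X.cmp (s ≫ X.sqTop) (s' ≫ X.sqTop) (X.sq_top_composable s s' h))
      (s' ≫ X.sqRight) (s ≫ X.sqLeft)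
      (X.cmp (s ≫ X.sqBot) (s' ≫ X.sqBot) (X.sq_bot_composable s s' h))
      (by rw [cmp_tgt]; simp [sqTop_tgt]) (by rw [cmp_src]; simp [sqLeft_tgt])
      (X.sq_paste s s' h _ _))
    (fun s f g h => by
      apply sq_hom_ext <;> simp [precomp_cmp])
    (by simp) (by simp) (fun f g h => by simp) (fun f g h => by simp)
    (fun h => by
      apply sq_hom_ext
      · have e := X.ident_cmp (X.sqLeft ≫ X.src) X.sqTop
          (by simp [ident_tgt, sqTop_src])
        simpa using e
      · simp
      · simp
      · have e := X.ident_cmp (X.sqLeft ≫ X.tgt) X.sqBot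
          (by simp [ident_tgt, sqLeft_tgt])
        simpa using e)
    (fun h => by
      apply sq_hom_ext
      · have e := X.cmp_ident X.sqTop (X.sqRight ≫ X.src)
          (by simp [ident_src, sqTop_tgt])
        simpa using e
      · simp
      · simp
      · have e := X.cmp_ident X.sqBot (X.sqRight ≫ X.tgt)
          (by simp [ident_src, sqBot_tgt])
        simpa using e)
    (fun f g h hfg hgh => by
      apply sq_hom_ext
      · simp only [sq_top]; exact cmp_assoc _ _ _ _ _ _
      · simp
      · simp
      · simp only [sq_bot]; exact cmp_assoc _ _ _ _ _ _)

lemma arrowCat_cmp (s s' : T ⟶ X.arrowCat.arr) (h : s ≫ X.arrowCat.tgt = s' ≫ X.arrowCat.src) :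
    X.arrowCat.cmp s s' h =
      X.sq (X.cmp (s ≫ X.sqTop) (s' ≫ X.sqTop) (X.sq_top_composable s s' h))
      (s' ≫ X.sqRight) (s ≫ X.sqLeft)
      (X.cmp (s ≫ X.sqBot) (s' ≫ X.sqBot) (X.sq_bot_composable s s' h))
      (by rw [cmp_tgt]; simp [sqTop_tgt]) (by rw [cmp_src]; simp [sqLeft_tgt])
      (X.sq_paste s s' h _ _) := by
  apply ofCmp_cmp
  intros
  apply sq_hom_ext <;> simp [precomp_cmp]

/-- The domain functor of the arrow category. -/
noncomputable def arrowDom : X.arrowCat ⟶ X :=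
  homMk X.src X.sqTop X.sqTop_src X.sqTop_tgt (by simp)
    (fun f g h => by rw [arrowCat_cmp, sq_top])

/-- The codomain functor of the arrow category. -/
noncomputable def arrowCod : X.arrowCat ⟶ X :=
  homMk X.tgt X.sqBot X.sqLeft_tgt.symm X.sqBot_tgt (by simp)
    (fun f g h => by rw [arrowCat_cmp, sq_bot])

variable {X} {A : InternalCat E}

/-- The internal functor into the arrow category classifying a natural transformation. -/
noncomputable def toArrow {F G : A ⟶ X} (α : F ⟶ G) : A ⟶ X.arrowCat :=
  homMk (NatTrans.app α)
    (X.sq (Hom.onArr F) (A.tgt ≫ NatTrans.app α) (A.src ≫ NatTrans.app α) (Hom.onArr G)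
      (by rw [Category.assoc, NatTrans.app_src, Hom.onArr_tgt])
      (by rw [Category.assoc, NatTrans.app_tgt, Hom.onArr_src]) (NatTrans.naturality α))
    (by simp) (by simp)
    (by
      have h₁ := A.ident_src
      have h₂ := A.ident_tgt
      apply sq_hom_ext <;> simp [Hom.ident_onArr, reassoc_of% h₁, reassoc_of% h₂]
      · rw [← NatTrans.app_src α, Category.assoc]
      · rw [← NatTrans.app_tgt α, Category.assoc])
    (fun f g h => by
      rw [arrowCat_cmp]
      apply sq_hom_ext
      · simp [Hom.cmp_onArr]
      · have := A.cmp_tgt f g h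
        simp [reassoc_of% this]
      · have := A.cmp_src f g h
        simp [reassoc_of% this]
      · simp [Hom.cmp_onArr])

@[simp] lemma toArrow_onObj {F G : A ⟶ X} (α : F ⟶ G) :
    Hom.onObj (toArrow α) = NatTrans.app α := rfl

@[simp] lemma toArrow_dom {F G : A ⟶ X} (α : F ⟶ G) : toArrow α ≫ X.arrowDom = F :=
  hom_ext_arr (X.sq_top _ _ _ _ _ _ (NatTrans.naturality α))

@[simp] lemma toArrow_cod {F G : A ⟶ X} (α : F ⟶ G) : toArrow α ≫ X.arrowCod = G :=
  hom_ext_arr (X.sq_bot _ _ _ _ _ _ (NatTrans.naturality α))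

/-- Arrows of the arrow category are determined by their domain, codomain, source and target. -/
lemma arrowCat_arr_ext {s s' : T ⟶ X.arrowCat.arr}
    (hd : s ≫ Hom.onArr X.arrowDom = s' ≫ Hom.onArr X.arrowDom)
    (hc : s ≫ Hom.onArr X.arrowCod = s' ≫ Hom.onArr X.arrowCod)
    (hs : s ≫ X.arrowCat.src = s' ≫ X.arrowCat.src)
    (ht : s ≫ X.arrowCat.tgt = s' ≫ X.arrowCat.tgt) : s = s' :=
  sq_hom_ext hd ht hs hc

lemma arrowCat_hom_ext {K K' : A ⟶ X.arrowCat} (hd : K ≫ X.arrowDom = K' ≫ X.arrowDom)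
    (hc : K ≫ X.arrowCod = K' ≫ X.arrowCod) (ho : Hom.onObj K = Hom.onObj K') : K = K' := by
  refine hom_ext ho (arrowCat_arr_ext (congrArg Hom.onArr hd) (congrArg Hom.onArr hc) ?_ ?_)
  · rw [Hom.onArr_src, Hom.onArr_src, ho]
  · rw [Hom.onArr_tgt, Hom.onArr_tgt, ho]

/-- The natural transformation classified by an internal functor into the arrow category. -/
noncomputable def ofArrow {F G : A ⟶ X} (K : A ⟶ X.arrowCat) (hd : K ≫ X.arrowDom = F)
    (hc : K ≫ X.arrowCod = G) : F ⟶ G :=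
  NatTrans.mk (F := F) (G := G) (Hom.onObj K) (congrArg Hom.onObj hd) (congrArg Hom.onObj hc) (by
    subst hd hc
    have h := X.sq_comm' (Hom.onArr K)
    refine (cmp_congr _ rfl ?_ _).trans (h.trans (cmp_congr _ ?_ rfl _))
    · exact (Hom.onArr_tgt K).symm
    · exact Hom.onArr_src K)

@[simp] lemma ofArrow_app {F G : A ⟶ X} (K : A ⟶ X.arrowCat) (hd : K ≫ X.arrowDom = F)
    (hc : K ≫ X.arrowCod = G) : NatTrans.app (ofArrow K hd hc) = Hom.onObj K := rfl

end ArrowCat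

/-! ### One-dimensional universal properties suffice -/

section TwoDim

/-- Since `X` has a cotensor by the arrow category, natural transformations extend along a functor
when functors do. -/
lemma isCoequalizer₂_of_existsUnique {A B C : InternalCat E} {F G : A ⟶ B} {Q : B ⟶ C}
    (hw : F ≫ Q = G ≫ Q)
    (hu : ∀ {Z : InternalCat E} (R : B ⟶ Z), F ≫ R = G ≫ R → ∃! t : C ⟶ Z, Q ≫ t = R) :
    TwoCat.IsCoequalizer₂ F G Q := by
  have hcancel {Z : InternalCat E} (s t : C ⟶ Z) (h : Q ≫ s = Q ≫ t) : s = t :=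
    (hu (Q ≫ t) (by rw [← Category.assoc, hw, Category.assoc])).unique h rfl
  refine ⟨hw, hu, fun {Z} s t α hα => ?_⟩
  have hα' : Hom.onObj F ≫ NatTrans.app α = Hom.onObj G ≫ NatTrans.app α := by
    simpa using congrArg NatTrans.app hα
  have e₁ : F ≫ Q ≫ s = G ≫ Q ≫ s := by rw [← Category.assoc, hw, Category.assoc]
  have e₂ : F ≫ Q ≫ t = G ≫ Q ≫ t := by rw [← Category.assoc, hw, Category.assoc]
  obtain ⟨K, hK, -⟩ := hu (toArrow α) (by
    apply arrowCat_hom_ext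
    · rw [Category.assoc, Category.assoc, toArrow_dom, e₁]
    · rw [Category.assoc, Category.assoc, toArrow_cod, e₂]
    · exact hα')
  refine ⟨ofArrow K (hcancel _ _ ?_) (hcancel _ _ ?_), ?_, fun γ hγ => ?_⟩
  · rw [← Category.assoc, hK, toArrow_dom]
  · rw [← Category.assoc, hK, toArrow_cod]
  · ext
    exact congrArg Hom.onObj hK
  · have : toArrow γ = K := hcancel _ _ (by
      rw [hK]
      apply arrowCat_hom_ext
      · simp
      · simp
      · exact congrArg NatTrans.app hγ)
    ext
    rw [ofArrow_app, ← this, toArrow_onObj]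

lemma isCoproduct₂_of_existsUnique {A B P : InternalCat E} {inl : A ⟶ P} {inr : B ⟶ P}
    (hu : ∀ {Z : InternalCat E} (f : A ⟶ Z) (g : B ⟶ Z), ∃! h : P ⟶ Z, inl ≫ h = f ∧ inr ≫ h = g) :
    TwoCat.IsCoproduct₂ inl inr := by
  have hcancel {Z : InternalCat E} (s t : P ⟶ Z) (h : inl ≫ s = inl ≫ t)
      (h' : inr ≫ s = inr ≫ t) : s = t := (hu (inl ≫ t) (inr ≫ t)).unique ⟨h, h'⟩ ⟨rfl, rfl⟩
  refine ⟨hu, fun {Z} s t α β => ?_⟩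
  obtain ⟨K, ⟨hl, hr⟩, -⟩ := hu (toArrow α) (toArrow β)
  refine ⟨ofArrow K (hcancel _ _ ?_ ?_) (hcancel _ _ ?_ ?_), ⟨?_, ?_⟩, fun γ hγ => ?_⟩
  · rw [← Category.assoc, hl, toArrow_dom]
  · rw [← Category.assoc, hr, toArrow_dom]
  · rw [← Category.assoc, hl, toArrow_cod]
  · rw [← Category.assoc, hr, toArrow_cod]
  · ext
    exact congrArg Hom.onObj hl
  · ext
    exact congrArg Hom.onObj hr
  · have : toArrow γ = K := by
      apply hcancel
      · rw [hl]
        apply arrowCat_hom_ext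
        · simp
        · simp
        · exact congrArg NatTrans.app hγ.1
      · rw [hr]
        apply arrowCat_hom_ext
        · simp
        · simp
        · exact congrArg NatTrans.app hγ.2
    ext
    rw [ofArrow_app, ← this, toArrow_onObj]

lemma isInitial₂_of_existsUnique {I : InternalCat E}
    (hu : ∀ Z : InternalCat E, ∃! _u : I ⟶ Z, True) : TwoCat.IsInitial₂ I := by
  have hcancel {Z : InternalCat E} (s t : I ⟶ Z) : s = t := (hu Z).unique trivial trivial
  refine fun Z => ⟨hu Z, fun s t => ?_⟩
  obtain ⟨K, -⟩ := hu Z.arrowCat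
  refine ⟨ofArrow K (hcancel _ _) (hcancel _ _), trivial, fun γ _ => ?_⟩
  ext
  rw [ofArrow_app, ← hcancel (toArrow γ) K, toArrow_onObj]

end TwoDim
end InternalCat

/-! ### Pullbacks of internal categories -/

lemma CategoryTheory.IsPullback.of_isIso_lift {E : Type u} [Category.{v} E] {P P' X Y Z : E}
    {fst : P ⟶ X} {snd : P ⟶ Y}
    {f : X ⟶ Z} {g : Y ⟶ Z} {fst' : P' ⟶ X} {snd' : P' ⟶ Y} (h : IsPullback fst' snd' f g)
    (l : P ⟶ P') [IsIso l] (h₁ : l ≫ fst' = fst) (h₂ : l ≫ snd' = snd) :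
    IsPullback fst snd f g :=
  IsPullback.of_iso h (asIso l).symm (Iso.refl _) (Iso.refl _) (Iso.refl _) (by simp [← h₁])
    (by simp [← h₂]) (by simp) (by simp)

namespace InternalCat
variable {E : Type u} [Category.{v} E] [HasPullbacks E]

section Pullback
variable {X Y Z P : InternalCat E}

/-- A square of internal functors is a two-dimensional pullback as soon as it is a pullback on
objects and on arrows. -/
lemma isPullback₂_of_isPullback {fst : P ⟶ X} {snd : P ⟶ Y} {f : X ⟶ Z} {g : Y ⟶ Z}
    (h₀ : IsPullback (Hom.onObj fst) (Hom.onObj snd) (Hom.onObj f) (Hom.onObj g))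
    (h₁ : IsPullback (Hom.onArr fst) (Hom.onArr snd) (Hom.onArr f) (Hom.onArr g)) :
    TwoCat.IsPullback₂ fst snd f g := by
  refine ⟨hom_ext h₀.w h₁.w, fun {T} a b hab => ?_, fun {T} l m α β hαβ => ?_⟩
  · have hab₀ : Hom.onObj a ≫ Hom.onObj f = Hom.onObj b ≫ Hom.onObj g := congrArg Hom.onObj hab
    have hab₁ : Hom.onArr a ≫ Hom.onArr f = Hom.onArr b ≫ Hom.onArr g := congrArg Hom.onArr hab
    refine ⟨homMk (h₀.lift _ _ hab₀) (h₁.lift _ _ hab₁) ?_ ?_ ?_ ?_, ⟨?_, ?_⟩, ?_⟩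
    · apply h₀.hom_ext <;> simp [← Hom.onArr_src]
    · apply h₀.hom_ext <;> simp [← Hom.onArr_tgt]
    · apply h₁.hom_ext <;> simp [Hom.ident_onArr]
    · intro S f g h
      apply h₁.hom_ext <;> simp [Hom.cmp_onArr]
    · exact hom_ext (h₀.lift_fst _ _ _) (h₁.lift_fst _ _ _)
    · exact hom_ext (h₀.lift_snd _ _ _) (h₁.lift_snd _ _ _)
    · rintro l ⟨rfl, rfl⟩
      refine hom_ext (h₀.hom_ext ?_ ?_) (h₁.hom_ext ?_ ?_)
      · exact (h₀.lift_fst _ _ _).symm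
      · exact (h₀.lift_snd _ _ _).symm
      · exact (h₁.lift_fst _ _ _).symm
      · exact (h₁.lift_snd _ _ _).symm
  · have e : NatTrans.app α ≫ Hom.onArr f = NatTrans.app β ≫ Hom.onArr g := by
      simpa using congrArg NatTrans.app hαβ
    have e₁ : h₁.lift _ _ e ≫ Hom.onArr fst = NatTrans.app α := h₁.lift_fst _ _ _
    have e₂ : h₁.lift _ _ e ≫ Hom.onArr snd = NatTrans.app β := h₁.lift_snd _ _ _
    refine ⟨NatTrans.mk (F := l) (G := m) (h₁.lift _ _ e) ?_ ?_ ?_, ⟨hom₂_ext e₁, hom₂_ext e₂⟩, ?_⟩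
    · apply h₀.hom_ext
      · rw [Category.assoc, ← Hom.onArr_src, reassoc_of% e₁, NatTrans.app_src, onObj_comp]
      · rw [Category.assoc, ← Hom.onArr_src, reassoc_of% e₂, NatTrans.app_src, onObj_comp]
    · apply h₀.hom_ext
      · rw [Category.assoc, ← Hom.onArr_tgt, reassoc_of% e₁, NatTrans.app_tgt, onObj_comp]
      · rw [Category.assoc, ← Hom.onArr_tgt, reassoc_of% e₂, NatTrans.app_tgt, onObj_comp]
    · apply h₁.hom_ext
      · simp only [Hom.cmp_onArr, Category.assoc, e₁]
        exact NatTrans.naturality α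
      · simp only [Hom.cmp_onArr, Category.assoc, e₂]
        exact NatTrans.naturality β
    · rintro γ ⟨rfl, rfl⟩
      exact hom₂_ext (h₁.hom_ext e₁.symm e₂.symm)

section Construction
variable {f : X ⟶ Z} {g : Y ⟶ Z} {P₀ P₁ : E} {p₀ : P₀ ⟶ X.obj} {q₀ : P₀ ⟶ Y.obj}
  {p₁ : P₁ ⟶ X.arr} {q₁ : P₁ ⟶ Y.arr}
  (h₀ : IsPullback p₀ q₀ (Hom.onObj f) (Hom.onObj g))
  (h₁ : IsPullback p₁ q₁ (Hom.onArr f) (Hom.onArr g))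

lemma exists_pullbackCmp {src tgt : P₁ ⟶ P₀} (hps : src ≫ p₀ = p₁ ≫ X.src)
    (hqs : src ≫ q₀ = q₁ ≫ Y.src) (hpt : tgt ≫ p₀ = p₁ ≫ X.tgt) (hqt : tgt ≫ q₀ = q₁ ≫ Y.tgt)
    (h₁ : IsPullback p₁ q₁ (Hom.onArr f) (Hom.onArr g))
    {T : E} (s t : T ⟶ P₁) (h : s ≫ tgt = t ≫ src) :
    ∃ c : T ⟶ P₁,
      c ≫ p₁ = X.cmp (s ≫ p₁) (t ≫ p₁) (by simp [← hps, ← hpt, reassoc_of% h]) ∧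
      c ≫ q₁ = Y.cmp (s ≫ q₁) (t ≫ q₁) (by simp [← hqs, ← hqt, reassoc_of% h]) := by
  have hw : p₁ ≫ Hom.onArr f = q₁ ≫ Hom.onArr g := h₁.w
  refine ⟨h₁.lift (X.cmp (s ≫ p₁) (t ≫ p₁) (by simp [← hps, ← hpt, reassoc_of% h]))
    (Y.cmp (s ≫ q₁) (t ≫ q₁) (by simp [← hqs, ← hqt, reassoc_of% h])) ?_,
    h₁.lift_fst _ _ _, h₁.lift_snd _ _ _⟩
  rw [Hom.cmp_onArr, Hom.cmp_onArr]
  exact cmp_congr _ (by simp [hw]) (by simp [hw]) _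

include h₀ h₁ in
/-- Componentwise pullbacks of internal categories exist: all the structure, and all the laws, are
induced from the two projections. -/
lemma exists_pullbackCat : ∃ (P : InternalCat E) (fst : P ⟶ X) (snd : P ⟶ Y),
    IsPullback (Hom.onObj fst) (Hom.onObj snd) (Hom.onObj f) (Hom.onObj g) ∧
    IsPullback (Hom.onArr fst) (Hom.onArr snd) (Hom.onArr f) (Hom.onArr g) := by
  obtain ⟨src, hps, hqs⟩ : ∃ src : P₁ ⟶ P₀, src ≫ p₀ = p₁ ≫ X.src ∧ src ≫ q₀ = q₁ ≫ Y.src :=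
    ⟨h₀.lift _ _ (by simp only [Category.assoc, ← Hom.onArr_src, h₁.w_assoc]),
      h₀.lift_fst _ _ _, h₀.lift_snd _ _ _⟩
  obtain ⟨tgt, hpt, hqt⟩ : ∃ tgt : P₁ ⟶ P₀, tgt ≫ p₀ = p₁ ≫ X.tgt ∧ tgt ≫ q₀ = q₁ ≫ Y.tgt :=
    ⟨h₀.lift _ _ (by simp only [Category.assoc, ← Hom.onArr_tgt, h₁.w_assoc]),
      h₀.lift_fst _ _ _, h₀.lift_snd _ _ _⟩
  obtain ⟨ident, hpi, hqi⟩ : ∃ ident : P₀ ⟶ P₁, ident ≫ p₁ = p₀ ≫ X.ident ∧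
      ident ≫ q₁ = q₀ ≫ Y.ident :=
    ⟨h₁.lift _ _ (by simp only [Category.assoc, Hom.ident_onArr, h₀.w_assoc]),
      h₁.lift_fst _ _ _, h₁.lift_snd _ _ _⟩
  choose c hpc hqc using @exists_pullbackCmp _ _ _ _ _ _ _ _ _ _ _ _ _ _ _ _ hps hqs hpt hqt h₁
  have c_nat : ∀ {S T : E} (s : S ⟶ T) (f g : T ⟶ P₁) (h : f ≫ tgt = g ≫ src),
      s ≫ c f g h = c (s ≫ f) (s ≫ g) (by simp [h]) := fun s f g h => by
    apply h₁.hom_ext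
    · rw [Category.assoc, hpc, hpc, precomp_cmp]
      exact cmp_congr _ (Category.assoc _ _ _).symm (Category.assoc _ _ _).symm _
    · rw [Category.assoc, hqc, hqc, precomp_cmp]
      exact cmp_congr _ (Category.assoc _ _ _).symm (Category.assoc _ _ _).symm _
  let P : InternalCat E := ofCmp P₀ P₁ src tgt ident c c_nat
    (by apply h₀.hom_ext <;> simp [hps, hqs, reassoc_of% hpi, reassoc_of% hqi, ident_src])
    (by apply h₀.hom_ext <;> simp [hpt, hqt, reassoc_of% hpi, reassoc_of% hqi, ident_tgt])
    (fun f g h => by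
      apply h₀.hom_ext
      · rw [Category.assoc, hps, ← Category.assoc, hpc, cmp_src, Category.assoc, ← hps,
          Category.assoc]
      · rw [Category.assoc, hqs, ← Category.assoc, hqc, cmp_src, Category.assoc, ← hqs,
          Category.assoc])
    (fun f g h => by
      apply h₀.hom_ext
      · rw [Category.assoc, hpt, ← Category.assoc, hpc, cmp_tgt, Category.assoc, ← hpt,
          Category.assoc]
      · rw [Category.assoc, hqt, ← Category.assoc, hqc, cmp_tgt, Category.assoc, ← hqt,
          Category.assoc])
    (fun h => by
      apply h₁.hom_ext
      · rw [hpc]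
        exact X.cmp_of_left_eq_ident (p₁ ≫ X.src)
          (by rw [Category.assoc, hpi, reassoc_of% hps, Category.assoc]) _
      · rw [hqc]
        exact Y.cmp_of_left_eq_ident (q₁ ≫ Y.src)
          (by rw [Category.assoc, hqi, reassoc_of% hqs, Category.assoc]) _)
    (fun h => by
      apply h₁.hom_ext
      · rw [hpc]
        exact X.cmp_of_right_eq_ident (p₁ ≫ X.tgt)
          (by rw [Category.assoc, hpi, reassoc_of% hpt, Category.assoc]) _
      · rw [hqc]
        exact Y.cmp_of_right_eq_ident (q₁ ≫ Y.tgt)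
          (by rw [Category.assoc, hqi, reassoc_of% hqt, Category.assoc]) _)
    (fun f g h hfg hgh => by
      apply h₁.hom_ext
      · simp only [hpc]
        exact cmp_assoc _ _ _ _ _ _
      · simp only [hqc]
        exact cmp_assoc _ _ _ _ _ _)
  have P_cmp {T : E} (s t : T ⟶ P₁) (h : s ≫ tgt = t ≫ src) : P.cmp s t h = c s t h :=
    ofCmp_cmp (comp_c := c_nat) s t h
  exact ⟨P, homMk p₀ p₁ hps.symm hpt.symm hpi (fun s t h => by rw [P_cmp, hpc]),
    homMk q₀ q₁ hqs.symm hqt.symm hqi (fun s t h => by rw [P_cmp, hqc]), h₀, h₁⟩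

end Construction

lemma exists_isPullback (f : X ⟶ Z) (g : Y ⟶ Z) :
    ∃ (P : InternalCat E) (fst : P ⟶ X) (snd : P ⟶ Y),
      IsPullback (Hom.onObj fst) (Hom.onObj snd) (Hom.onObj f) (Hom.onObj g) ∧
      IsPullback (Hom.onArr fst) (Hom.onArr snd) (Hom.onArr f) (Hom.onArr g) :=
  exists_pullbackCat (IsPullback.of_hasPullback _ _) (IsPullback.of_hasPullback _ _)

/-- An invertible internal functor is invertible on objects and on arrows. -/
lemma isIso_components {A B : InternalCat E} {F : A ⟶ B} {G : B ⟶ A} (h : F ≫ G = 𝟙 A)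
    (h' : G ≫ F = 𝟙 B) : IsIso (Hom.onObj F) ∧ IsIso (Hom.onArr F) :=
  ⟨⟨Hom.onObj G, congrArg Hom.onObj h, congrArg Hom.onObj h'⟩,
    ⟨Hom.onArr G, congrArg Hom.onArr h, congrArg Hom.onArr h'⟩⟩

/-- Pullbacks of internal categories are computed on objects and on arrows. -/
lemma isPullback₂_iff {fst : P ⟶ X} {snd : P ⟶ Y} {f : X ⟶ Z} {g : Y ⟶ Z} :
    TwoCat.IsPullback₂ fst snd f g ↔
      IsPullback (Hom.onObj fst) (Hom.onObj snd) (Hom.onObj f) (Hom.onObj g) ∧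
      IsPullback (Hom.onArr fst) (Hom.onArr snd) (Hom.onArr f) (Hom.onArr g) := by
  refine ⟨fun h => ?_, fun h => isPullback₂_of_isPullback h.1 h.2⟩
  obtain ⟨P', fst', snd', h₀, h₁⟩ := exists_isPullback f g
  have h' := isPullback₂_of_isPullback h₀ h₁
  obtain ⟨l, ⟨hl₁, hl₂⟩, -⟩ := h'.existsUnique_lift fst snd h.w
  obtain ⟨m, ⟨hm₁, hm₂⟩, -⟩ := h.existsUnique_lift fst' snd' h'.w
  have e₁ : l ≫ m = 𝟙 P := (h.existsUnique_lift fst snd h.w).unique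
    ⟨by rw [Category.assoc, hm₁, hl₁], by rw [Category.assoc, hm₂, hl₂]⟩
    ⟨Category.id_comp _, Category.id_comp _⟩
  have e₂ : m ≫ l = 𝟙 P' := (h'.existsUnique_lift fst' snd' h'.w).unique
    ⟨by rw [Category.assoc, hl₁, hm₁], by rw [Category.assoc, hl₂, hm₂]⟩
    ⟨Category.id_comp _, Category.id_comp _⟩
  obtain ⟨i₀, i₁⟩ := isIso_components e₁ e₂
  exact ⟨h₀.of_isIso_lift (Hom.onObj l) (congrArg Hom.onObj hl₁) (congrArg Hom.onObj hl₂),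
    h₁.of_isIso_lift (Hom.onArr l) (congrArg Hom.onArr hl₁) (congrArg Hom.onArr hl₂)⟩

variable (E) in
lemma hasPullbacks₂ : TwoCat.HasPullbacks₂ (InternalCat E) := fun f g => by
  obtain ⟨P, fst, snd, h⟩ := exists_isPullback f g
  exact ⟨P, fst, snd, isPullback₂_iff.2 h⟩

end Pullback
end InternalCat

/-! ### Coproducts in an extensive category -/

namespace ExtensiveLemmas
variable {E : Type u} [Category.{v} E] {X Y P A B Z T W : E}

/-- The cofan `X ⟶ P ⟵ Y` is a coproduct. -/
def IsCoprod (i : X ⟶ P) (j : Y ⟶ P) : Prop := Nonempty (IsColimit (BinaryCofan.mk i j))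

namespace IsCoprod
variable {i : X ⟶ P} {j : Y ⟶ P}

lemma symm (h : IsCoprod i j) : IsCoprod j i := ⟨BinaryCofan.isColimitFlip h.some⟩

lemma hom_ext (h : IsCoprod i j) {f g : P ⟶ W} (h₁ : i ≫ f = i ≫ g) (h₂ : j ≫ f = j ≫ g) :
    f = g := BinaryCofan.IsColimit.hom_ext h.some h₁ h₂

lemma exists_desc (h : IsCoprod i j) (f : X ⟶ W) (g : Y ⟶ W) :
    ∃ k : P ⟶ W, i ≫ k = f ∧ j ≫ k = g := by
  obtain ⟨k, h₁, h₂⟩ := BinaryCofan.IsColimit.desc' h.some f g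
  exact ⟨k, h₁, h₂⟩

lemma of_existsUnique (h : ∀ {W : E} (f : X ⟶ W) (g : Y ⟶ W), ∃! k : P ⟶ W, i ≫ k = f ∧ j ≫ k = g) :
    IsCoprod i j :=
  ⟨BinaryCofan.isColimitMk (fun s => (h s.inl s.inr).choose)
    (fun s => (h s.inl s.inr).choose_spec.1.1) (fun s => (h s.inl s.inr).choose_spec.1.2)
    (fun s m h₁ h₂ => (h s.inl s.inr).choose_spec.2 m ⟨h₁, h₂⟩)⟩

lemma coprod (X Y : E) [HasBinaryCoproduct X Y] :
    IsCoprod (coprod.inl : X ⟶ X ⨿ Y) (coprod.inr : Y ⟶ X ⨿ Y) :=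
  ⟨coprodIsCoprod X Y⟩

lemma exists_isCoprod (X Y : E) [HasBinaryCoproduct X Y] :
    ∃ (P : E) (i : X ⟶ P) (j : Y ⟶ P), IsCoprod i j := ⟨_, _, _, coprod X Y⟩

lemma comp_isIso (h : IsCoprod i j) (e : P ⟶ W) [IsIso e] : IsCoprod (i ≫ e) (j ≫ e) := by
  refine of_existsUnique fun f g => ?_
  obtain ⟨k, h₁, h₂⟩ := h.exists_desc f g
  refine ⟨inv e ≫ k, ⟨by simp [h₁], by simp [h₂]⟩, ?_⟩
  rintro l ⟨hl₁, hl₂⟩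
  rw [← cancel_epi e, IsIso.hom_inv_id_assoc]
  exact h.hom_ext (by rw [h₁, ← hl₁, Category.assoc]) (by rw [h₂, ← hl₂, Category.assoc])

/-- Two coproducts of the same objects are isomorphic. -/
lemma exists_iso (h : IsCoprod i j) {Q : E} {i' : X ⟶ Q} {j' : Y ⟶ Q} (h' : IsCoprod i' j') :
    ∃ e : P ⟶ Q, IsIso e ∧ i ≫ e = i' ∧ j ≫ e = j' := by
  obtain ⟨e, h₁, h₂⟩ := h.exists_desc i' j'
  obtain ⟨e', h₁', h₂'⟩ := h'.exists_desc i j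
  refine ⟨e, ⟨e', h.hom_ext ?_ ?_, h'.hom_ext ?_ ?_⟩, h₁, h₂⟩
  · rw [reassoc_of% h₁, h₁', Category.comp_id]
  · rw [reassoc_of% h₂, h₂', Category.comp_id]
  · rw [reassoc_of% h₁', h₁, Category.comp_id]
  · rw [reassoc_of% h₂', h₂, Category.comp_id]

variable [FinitaryExtensive E]

lemma iff_isPullback (h : IsCoprod i j) {a : A ⟶ Z} {b : B ⟶ Z} {s : A ⟶ X} {t : B ⟶ Y} {z : Z ⟶ P}
    (hs : a ≫ z = s ≫ i) (ht : b ≫ z = t ≫ j) :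
    IsCoprod a b ↔ IsPullback a s z i ∧ IsPullback b t z j :=
  (BinaryCofan.isVanKampen_iff _).1 (FinitaryExtensive.vanKampen _ h.some) (BinaryCofan.mk a b)
    s t z hs.symm ht.symm

lemma mono_left (h : IsCoprod i j) : Mono i := FinitaryExtensive.mono_inl_of_isColimit h.some

lemma mono_right (h : IsCoprod i j) : Mono j := FinitaryExtensive.mono_inr_of_isColimit h.some

/-- A morphism into a coproduct decomposes its domain. -/
lemma exists_decomposition [HasPullbacks E] (h : IsCoprod i j) (z : T ⟶ P) :
    ∃ (A B : E) (a : A ⟶ T) (b : B ⟶ T) (s : A ⟶ X) (t : B ⟶ Y),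
      IsCoprod a b ∧ IsPullback a s z i ∧ IsPullback b t z j := by
  have h₁ := IsPullback.of_hasPullback z i
  have h₂ := IsPullback.of_hasPullback z j
  exact ⟨_, _, _, _, _, _, (h.iff_isPullback h₁.w h₂.w).2 ⟨h₁, h₂⟩, h₁, h₂⟩

/-- Proof by cases: in order to compare two morphisms out of `T`, one may assume that a given
generalised element `z : T ⟶ P` of a coproduct comes from one of the summands. -/
lemma ext_cases [HasPullbacks E] (h : IsCoprod i j) (z : T ⟶ P) {f g : T ⟶ W}
    (hi : ∀ {S : E} (u : S ⟶ T) (x : S ⟶ X), u ≫ z = x ≫ i → u ≫ f = u ≫ g)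
    (hj : ∀ {S : E} (u : S ⟶ T) (y : S ⟶ Y), u ≫ z = y ≫ j → u ≫ f = u ≫ g) : f = g := by
  obtain ⟨A, B, a, b, s, t, hab, h₁, h₂⟩ := h.exists_decomposition z
  exact hab.hom_ext (hi a s h₁.w) (hj b t h₂.w)

/-- A generalised element cannot lie in both summands of a coproduct, unless its domain is
initial. -/
lemma eq_of_inl_eq_inr (h : IsCoprod i j) {x : T ⟶ X} {y : T ⟶ Y} (hxy : x ≫ i = y ≫ j)
    (f g : T ⟶ W) : f = g := by
  have hp := FinitaryExtensive.isPullback_initial_to_binaryCofan h.some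
  let e : T ⟶ ⊥_ E := hp.lift x y hxy
  have : IsIso e := HasStrictInitialObjects.out e initialIsInitial
  rw [← cancel_epi (inv e)]
  exact initialIsInitial.hom_ext _ _

/-- Coproducts of pullback squares over a common base are pullback squares. -/
lemma isPullback_coprod [HasPullbacks E] (h : IsCoprod i j) {X' Y' P' B' : E}
    {i' : X' ⟶ P'} {j' : Y' ⟶ P'}
    (h' : IsCoprod i' j') {pX : X' ⟶ X} {pY : Y' ⟶ Y} {pP : P' ⟶ P} {b : B' ⟶ B}
    {c : P ⟶ B} {c' : P' ⟶ B'} (hX : IsPullback pX (i' ≫ c') (i ≫ c) b)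
    (hY : IsPullback pY (j' ≫ c') (j ≫ c) b) (hi : i' ≫ pP = pX ≫ i) (hj : j' ≫ pP = pY ≫ j) :
    IsPullback pP c' c b := by
  have hQ := IsPullback.of_hasPullback c b
  have hw : pP ≫ c = c' ≫ b := h'.hom_ext (by rw [reassoc_of% hi, hX.w, Category.assoc])
    (by rw [reassoc_of% hj, hY.w, Category.assoc])
  let l : P' ⟶ pullback c b := hQ.lift pP c' hw
  have l₁ : l ≫ pullback.fst c b = pP := hQ.lift_fst _ _ _
  have l₂ : l ≫ pullback.snd c b = c' := hQ.lift_snd _ _ _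
  have e₁ : (i' ≫ l) ≫ pullback.fst c b = pX ≫ i := by rw [Category.assoc, l₁, hi]
  have e₂ : (j' ≫ l) ≫ pullback.fst c b = pY ≫ j := by rw [Category.assoc, l₁, hj]
  have sX : IsPullback (i' ≫ l) pX (pullback.fst c b) i := by
    refine IsPullback.of_right ?_ e₁ hQ.flip
    simpa [l₂] using hX.flip
  have sY : IsPullback (j' ≫ l) pY (pullback.fst c b) j := by
    refine IsPullback.of_right ?_ e₂ hQ.flip
    simpa [l₂] using hY.flip
  have hl := (h.iff_isPullback e₁ e₂).2 ⟨sX, sY⟩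
  obtain ⟨e, he, h₁, h₂⟩ := h'.exists_iso hl
  obtain rfl : e = l := h'.hom_ext h₁ h₂
  exact hQ.of_isIso_lift _ l₁ l₂

end IsCoprod

/-- Extensivity in terms of coproduct cofans. -/
lemma finitaryExtensive_of [HasPullbacks E] [HasFiniteCoproducts E]
    (h : ∀ {X Y P : E} {i : X ⟶ P} {j : Y ⟶ P}, IsCoprod i j → ∀ {A B Z : E} {a : A ⟶ Z} {b : B ⟶ Z}
      {s : A ⟶ X} {t : B ⟶ Y} {z : Z ⟶ P}, a ≫ z = s ≫ i → b ≫ z = t ≫ j →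
      (IsCoprod a b ↔ IsPullback a s z i ∧ IsPullback b t z j)) : FinitaryExtensive E where
  van_kampen' {X Y} c hc := by
    rw [BinaryCofan.isVanKampen_iff]
    intro X' Y' c' αX αY f hX hY
    have hc' : IsCoprod c.inl c.inr := ⟨hc.ofIsoColimit (isoBinaryCofanMk c)⟩
    refine Iff.trans ?_ (h hc' hX.symm hY.symm)
    exact ⟨fun ⟨l⟩ => ⟨l.ofIsoColimit (isoBinaryCofanMk c')⟩,
      fun ⟨l⟩ => ⟨l.ofIsoColimit (isoBinaryCofanMk c').symm⟩⟩

end ExtensiveLemmas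

/-! ### Coproducts of internal categories -/

namespace InternalCat
open ExtensiveLemmas
variable {E : Type u} [Category.{v} E] [HasPullbacks E] [FinitaryExtensive E]

section Coproduct
variable {A B P : InternalCat E}

/-- A cofan of internal functors is a two-dimensional coproduct as soon as it is a coproduct on
objects and on arrows. -/
lemma isCoproduct₂_of_isCoprod {inl : A ⟶ P} {inr : B ⟶ P}
    (h₀ : IsCoprod (Hom.onObj inl) (Hom.onObj inr))
    (h₁ : IsCoprod (Hom.onArr inl) (Hom.onArr inr)) : TwoCat.IsCoproduct₂ inl inr := by
  have hl := ((h₀.iff_isPullback (Hom.onArr_src inl) (Hom.onArr_src inr)).1 h₁).1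
  have hr := ((h₀.iff_isPullback (Hom.onArr_src inl) (Hom.onArr_src inr)).1 h₁).2
  refine isCoproduct₂_of_existsUnique fun {Z} F G => ?_
  obtain ⟨k₀, kl₀, kr₀⟩ := h₀.exists_desc (Hom.onObj F) (Hom.onObj G)
  obtain ⟨k₁, kl₁, kr₁⟩ := h₁.exists_desc (Hom.onArr F) (Hom.onArr G)
  -- The two summands are treated alike: on either of them, `k` restricts to a functor.
  have key {A : InternalCat E} {inl F : A ⟶ _} (kl₁ : Hom.onArr inl ≫ k₁ = Hom.onArr F)
      (hl : IsPullback (Hom.onArr inl) A.src P.src (Hom.onObj inl)) {S T : E} (f g : T ⟶ P.arr)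
      (h : f ≫ P.tgt = g ≫ P.src) (h' : (f ≫ k₁) ≫ Z.tgt = (g ≫ k₁) ≫ Z.src) (u : S ⟶ T)
      (x : S ⟶ A.arr) (hx : u ≫ f = x ≫ Hom.onArr inl) :
      u ≫ P.cmp f g h ≫ k₁ = u ≫ Z.cmp (f ≫ k₁) (g ≫ k₁) h' := by
    have hxy : (u ≫ g) ≫ P.src = (x ≫ A.tgt) ≫ Hom.onObj inl := by
      rw [Category.assoc, ← h, ← Category.assoc, hx, Category.assoc, Hom.onArr_tgt, Category.assoc]
    let y := hl.lift (u ≫ g) (x ≫ A.tgt) hxy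
    have hy : y ≫ Hom.onArr inl = u ≫ g := hl.lift_fst _ _ _
    have hy' : x ≫ A.tgt = y ≫ A.src := (hl.lift_snd _ _ _).symm
    rw [precomp_cmp, ← Category.assoc, precomp_cmp]
    rw [cmp_congr _ hx hy.symm, ← Hom.cmp_onArr _ _ _ hy', Category.assoc, kl₁, Hom.cmp_onArr]
    exact cmp_congr _ (by rw [reassoc_of% hx, kl₁]) (by rw [← kl₁, reassoc_of% hy]) _
  refine ⟨homMk k₀ k₁ (h₁.hom_ext ?_ ?_) (h₁.hom_ext ?_ ?_) (h₀.hom_ext ?_ ?_) ?_, ⟨?_, ?_⟩, ?_⟩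
  · rw [reassoc_of% kl₁, Hom.onArr_src, ← Category.assoc, Hom.onArr_src, Category.assoc, kl₀]
  · rw [reassoc_of% kr₁, Hom.onArr_src, ← Category.assoc, Hom.onArr_src, Category.assoc, kr₀]
  · rw [reassoc_of% kl₁, Hom.onArr_tgt, ← Category.assoc, Hom.onArr_tgt, Category.assoc, kl₀]
  · rw [reassoc_of% kr₁, Hom.onArr_tgt, ← Category.assoc, Hom.onArr_tgt, Category.assoc, kr₀]
  · rw [← Category.assoc, ← Hom.ident_onArr, Category.assoc, kl₁, Hom.ident_onArr, reassoc_of% kl₀]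
  · rw [← Category.assoc, ← Hom.ident_onArr, Category.assoc, kr₁, Hom.ident_onArr, reassoc_of% kr₀]
  · intro T f g h
    exact h₁.ext_cases f (key kl₁ hl f g h _) (key kr₁ hr f g h _)
  · exact hom_ext kl₀ kl₁
  · exact hom_ext kr₀ kr₁
  · rintro K ⟨rfl, rfl⟩
    exact hom_ext (h₀.hom_ext kl₀.symm kr₀.symm) (h₁.hom_ext kl₁.symm kr₁.symm)

section Construction
variable {A : InternalCat E} {P₀ P₁ : E} {src tgt : P₁ ⟶ P₀} {ident : P₀ ⟶ P₁}

/-- `i₀` and `i₁` exhibit the internal category `A` as a summand of a prospective internal category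
with composition `c`: arrows whose source lies in `A` come from `A`, and `c` restricts to the
composition of `A`. -/
structure IsSummand (A : InternalCat E) (src tgt : P₁ ⟶ P₀) (ident : P₀ ⟶ P₁)
    (c : ∀ {T : E} (f g : T ⟶ P₁), f ≫ tgt = g ≫ src → (T ⟶ P₁)) (i₀ : A.obj ⟶ P₀)
    (i₁ : A.arr ⟶ P₁) : Prop where
  isPullback : IsPullback i₁ A.src src i₀
  tgt_w : i₁ ≫ tgt = A.tgt ≫ i₀
  ident_w : i₀ ≫ ident = A.ident ≫ i₁
  comp_c : ∀ {S T : E} (s : S ⟶ T) (f g : T ⟶ P₁) (h : f ≫ tgt = g ≫ src),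
      s ≫ c f g h = c (s ≫ f) (s ≫ g) (by simp [h])
  c_w : ∀ {T : E} (f g : T ⟶ A.arr) (h : f ≫ A.tgt = g ≫ A.src)
    (h' : (f ≫ i₁) ≫ tgt = (g ≫ i₁) ≫ src), c (f ≫ i₁) (g ≫ i₁) h' = A.cmp f g h ≫ i₁

omit [FinitaryExtensive E] in
/-- An arrow composable after an arrow of the summand `A` belongs to `A`, since its source does. -/
lemma exists_next {i₀ : A.obj ⟶ P₀} {i₁ : A.arr ⟶ P₁} (h : IsPullback i₁ A.src src i₀)
    (ht : i₁ ≫ tgt = A.tgt ≫ i₀) {S : E} {f g : S ⟶ P₁} {x : S ⟶ A.arr} (hx : f = x ≫ i₁)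
    (hfg : f ≫ tgt = g ≫ src) : ∃ y : S ⟶ A.arr, g = y ≫ i₁ ∧ x ≫ A.tgt = y ≫ A.src := by
  have e : g ≫ src = (x ≫ A.tgt) ≫ i₀ := by rw [← hfg, hx, Category.assoc, ht, Category.assoc]
  exact ⟨h.lift g (x ≫ A.tgt) e, (h.lift_fst _ _ _).symm, (h.lift_snd _ _ _).symm⟩

namespace IsSummand
variable {c : ∀ {T : E} (f g : T ⟶ P₁), f ≫ tgt = g ≫ src → (T ⟶ P₁)} {i₀ : A.obj ⟶ P₀}
    {i₁ : A.arr ⟶ P₁} (H : IsSummand A src tgt ident c i₀ i₁) {S T : E}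

omit [FinitaryExtensive E]
include H

lemma comp_c_eq {u : S ⟶ T} {f g : T ⟶ P₁} {x y : S ⟶ A.arr} (h : f ≫ tgt = g ≫ src)
    (hx : u ≫ f = x ≫ i₁) (hy : u ≫ g = y ≫ i₁) (hxy : x ≫ A.tgt = y ≫ A.src) :
    u ≫ c f g h = A.cmp x y hxy ≫ i₁ := by
  rw [H.comp_c, ← H.c_w x y hxy (by rw [← hx, ← hy, Category.assoc, h, Category.assoc])]
  congr 1

lemma c_src (u : S ⟶ T) (f g : T ⟶ P₁) (h : f ≫ tgt = g ≫ src) (x : S ⟶ A.arr)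
    (hx : u ≫ f = x ≫ i₁) : u ≫ c f g h ≫ src = u ≫ f ≫ src := by
  obtain ⟨y, hy, hxy⟩ := exists_next H.isPullback H.tgt_w (g := u ≫ g) hx (by simp [h])
  rw [← Category.assoc, H.comp_c_eq h hx hy hxy, Category.assoc, H.isPullback.w,
    ← Category.assoc, cmp_src, reassoc_of% hx, H.isPullback.w, Category.assoc]

lemma c_tgt (u : S ⟶ T) (f g : T ⟶ P₁) (h : f ≫ tgt = g ≫ src) (x : S ⟶ A.arr)
    (hx : u ≫ f = x ≫ i₁) : u ≫ c f g h ≫ tgt = u ≫ g ≫ tgt := by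
  obtain ⟨y, hy, hxy⟩ := exists_next H.isPullback H.tgt_w (g := u ≫ g) hx (by simp [h])
  rw [← Category.assoc, H.comp_c_eq h hx hy hxy, Category.assoc, H.tgt_w,
    ← Category.assoc, cmp_tgt, reassoc_of% hy, H.tgt_w, Category.assoc]

lemma ident_c (u : S ⟶ P₁) (h : (src ≫ ident) ≫ tgt = 𝟙 P₁ ≫ src) (x : S ⟶ A.arr)
    (hx : u ≫ 𝟙 P₁ = x ≫ i₁) : u ≫ c (src ≫ ident) (𝟙 P₁) h = u ≫ 𝟙 P₁ := by
  have hx' : u ≫ src ≫ ident = (x ≫ A.src ≫ A.ident) ≫ i₁ := by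
    rw [Category.comp_id] at hx
    rw [reassoc_of% hx, H.isPullback.w_assoc, H.ident_w, Category.assoc, Category.assoc]
  have hxx : (x ≫ A.src ≫ A.ident) ≫ A.tgt = x ≫ A.src := by simp [ident_tgt]
  rw [H.comp_c_eq h hx' hx hxx, hx]
  congr 1
  exact A.cmp_of_left_eq_ident (x ≫ A.src) (Category.assoc _ _ _).symm hxx

lemma c_ident (u : S ⟶ P₁) (h : 𝟙 P₁ ≫ tgt = (tgt ≫ ident) ≫ src) (x : S ⟶ A.arr)
    (hx : u ≫ 𝟙 P₁ = x ≫ i₁) : u ≫ c (𝟙 P₁) (tgt ≫ ident) h = u ≫ 𝟙 P₁ := by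
  have hx' : u ≫ tgt ≫ ident = (x ≫ A.tgt ≫ A.ident) ≫ i₁ := by
    rw [Category.comp_id] at hx
    rw [reassoc_of% hx, reassoc_of% H.tgt_w, H.ident_w, Category.assoc, Category.assoc]
  have hxx : x ≫ A.tgt = (x ≫ A.tgt ≫ A.ident) ≫ A.src := by simp [ident_src]
  rw [H.comp_c_eq h hx hx' hxx, hx]
  congr 1
  exact A.cmp_of_right_eq_ident (x ≫ A.tgt) (Category.assoc _ _ _).symm hxx

lemma assoc (u : S ⟶ T) (f g k : T ⟶ P₁) (hfg : f ≫ tgt = g ≫ src) (hgk : g ≫ tgt = k ≫ src)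
    (h : c f g hfg ≫ tgt = k ≫ src) (h' : f ≫ tgt = c g k hgk ≫ src) (x : S ⟶ A.arr)
    (hx : u ≫ f = x ≫ i₁) : u ≫ c (c f g hfg) k h = u ≫ c f (c g k hgk) h' := by
  obtain ⟨y, hy, hxy⟩ := exists_next H.isPullback H.tgt_w (g := u ≫ g) hx (by simp [hfg])
  obtain ⟨z, hz, hyz⟩ := exists_next H.isPullback H.tgt_w (g := u ≫ k) hy (by simp [hgk])
  rw [H.comp_c_eq h (H.comp_c_eq hfg hx hy hxy) hz (by rw [cmp_tgt, hyz]),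
    H.comp_c_eq h' hx (H.comp_c_eq hgk hy hz hyz) (by rw [cmp_src, hxy]), cmp_assoc]

end IsSummand

end Construction

/-- Componentwise coproducts of internal categories exist. -/
lemma exists_coprodCat (A B : InternalCat E) : ∃ (P : InternalCat E) (inl : A ⟶ P) (inr : B ⟶ P),
    IsCoprod (Hom.onObj inl) (Hom.onObj inr) ∧ IsCoprod (Hom.onArr inl) (Hom.onArr inr) := by
  obtain ⟨P₀, i₀, j₀, h₀⟩ := IsCoprod.exists_isCoprod A.obj B.obj
  obtain ⟨P₁, i₁, j₁, h₁⟩ := IsCoprod.exists_isCoprod A.arr B.arr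
  obtain ⟨src, si, sj⟩ := h₁.exists_desc (A.src ≫ i₀) (B.src ≫ j₀)
  obtain ⟨tgt, ti, tj⟩ := h₁.exists_desc (A.tgt ≫ i₀) (B.tgt ≫ j₀)
  obtain ⟨ident, di, dj⟩ := h₀.exists_desc (A.ident ≫ i₁) (B.ident ≫ j₁)
  obtain ⟨pA, pB⟩ := (h₀.iff_isPullback si sj).1 h₁
  have mi := h₁.mono_left
  have mj := h₁.mono_right
  have hc {T : E} (f g : T ⟶ P₁) (h : f ≫ tgt = g ≫ src) : ∃ c : T ⟶ P₁,
      (∀ {S : E} (u : S ⟶ T) (x y : S ⟶ A.arr) (hxy : x ≫ A.tgt = y ≫ A.src), u ≫ f = x ≫ i₁ →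
        u ≫ g = y ≫ i₁ → u ≫ c = A.cmp x y hxy ≫ i₁) ∧
      (∀ {S : E} (u : S ⟶ T) (x y : S ⟶ B.arr) (hxy : x ≫ B.tgt = y ≫ B.src), u ≫ f = x ≫ j₁ →
        u ≫ g = y ≫ j₁ → u ≫ c = B.cmp x y hxy ≫ j₁) := by
    obtain ⟨S, S', a, b, x, x', hab, hx, hx'⟩ := h₁.exists_decomposition f
    obtain ⟨y, hy, hxy⟩ := exists_next pA ti (g := a ≫ g) hx.w (by simp [h])
    obtain ⟨y', hy', hxy'⟩ := exists_next pB tj (g := b ≫ g) hx'.w (by simp [h])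
    obtain ⟨c, ca, cb⟩ := hab.exists_desc (A.cmp x y hxy ≫ i₁) (B.cmp x' y' hxy' ≫ j₁)
    refine ⟨c, fun {R} u z w hzw hz hw => ?_, fun {R} u z w hzw hz hw => ?_⟩
    · have e₁ : hx.lift u z hz ≫ a = u := hx.lift_fst _ _ _
      have e₂ : hx.lift u z hz ≫ x = z := hx.lift_snd _ _ _
      have e₃ : hx.lift u z hz ≫ y = w := by
        rw [← cancel_mono i₁, Category.assoc, ← hy, reassoc_of% e₁, hw]
      rw [← e₁, Category.assoc, ca, ← Category.assoc, precomp_cmp]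
      exact congrArg (· ≫ i₁) (cmp_congr _ e₂ e₃ _)
    · have e₁ : hx'.lift u z hz ≫ b = u := hx'.lift_fst _ _ _
      have e₂ : hx'.lift u z hz ≫ x' = z := hx'.lift_snd _ _ _
      have e₃ : hx'.lift u z hz ≫ y' = w := by
        rw [← cancel_mono j₁, Category.assoc, ← hy', reassoc_of% e₁, hw]
      rw [← e₁, Category.assoc, cb, ← Category.assoc, precomp_cmp]
      exact congrArg (· ≫ j₁) (cmp_congr _ e₂ e₃ _)
  choose c cA cB using @hc
  have comp_c : ∀ {S T : E} (s : S ⟶ T) (f g : T ⟶ P₁) (h : f ≫ tgt = g ≫ src),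
      s ≫ c f g h = c (s ≫ f) (s ≫ g) (by simp [h]) := fun s f g h =>
    h₁.ext_cases (s ≫ f) (fun u x hx => by
      obtain ⟨y, hy, hxy⟩ := exists_next pA ti (g := u ≫ s ≫ g) hx (by simp [h])
      rw [cA (s ≫ f) (s ≫ g) _ u x y hxy hx hy, ← Category.assoc]
      exact cA f g h (u ≫ s) x y hxy (by rw [Category.assoc, hx]) (by rw [Category.assoc, hy]))
      (fun u x hx => by
      obtain ⟨y, hy, hxy⟩ := exists_next pB tj (g := u ≫ s ≫ g) hx (by simp [h])
      rw [cB (s ≫ f) (s ≫ g) _ u x y hxy hx hy, ← Category.assoc]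
      exact cB f g h (u ≫ s) x y hxy (by rw [Category.assoc, hx]) (by rw [Category.assoc, hy]))
  have HA : IsSummand A src tgt ident c i₀ i₁ := ⟨pA, ti, di, comp_c, fun f g h h' => by
    rw [← cA _ _ h' (𝟙 _) f g h (Category.id_comp _) (Category.id_comp _), Category.id_comp]⟩
  have HB : IsSummand B src tgt ident c j₀ j₁ := ⟨pB, tj, dj, comp_c, fun f g h h' => by
    rw [← cB _ _ h' (𝟙 _) f g h (Category.id_comp _) (Category.id_comp _), Category.id_comp]⟩
  let P : InternalCat E := ofCmp P₀ P₁ src tgt ident c comp_c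
    (h₀.hom_ext (by rw [reassoc_of% di, si, reassoc_of% A.ident_src, Category.comp_id])
      (by rw [reassoc_of% dj, sj, reassoc_of% B.ident_src, Category.comp_id]))
    (h₀.hom_ext (by rw [reassoc_of% di, ti, reassoc_of% A.ident_tgt, Category.comp_id])
      (by rw [reassoc_of% dj, tj, reassoc_of% B.ident_tgt, Category.comp_id]))
    (fun f g h => h₁.ext_cases f (fun u x hx => HA.c_src u f g h x hx)
      (fun u x hx => HB.c_src u f g h x hx))
    (fun f g h => h₁.ext_cases f (fun u x hx => HA.c_tgt u f g h x hx)
      (fun u x hx => HB.c_tgt u f g h x hx))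
    (fun h => h₁.ext_cases (𝟙 _) (fun u x hx => HA.ident_c u h x hx)
      (fun u x hx => HB.ident_c u h x hx))
    (fun h => h₁.ext_cases (𝟙 _) (fun u x hx => HA.c_ident u h x hx)
      (fun u x hx => HB.c_ident u h x hx))
    (fun f g k hfg hgk => h₁.ext_cases f (fun u x hx => HA.assoc u f g k hfg hgk _ _ x hx)
      (fun u x hx => HB.assoc u f g k hfg hgk _ _ x hx))
  have P_cmp {T : E} (s t : T ⟶ P₁) (h : s ≫ tgt = t ≫ src) : P.cmp s t h = c s t h :=
    ofCmp_cmp (comp_c := comp_c) s t h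
  exact ⟨P, homMk i₀ i₁ si ti di.symm (fun s t h => by rw [P_cmp, HA.c_w s t h]),
    homMk j₀ j₁ sj tj dj.symm (fun s t h => by rw [P_cmp, HB.c_w s t h]), h₀, h₁⟩

/-- Coproducts of internal categories are computed on objects and on arrows: the coproduct
constructed from those in `E` has this property, and any other coproduct is isomorphic to it. -/
lemma isCoproduct₂_iff {inl : A ⟶ P} {inr : B ⟶ P} : TwoCat.IsCoproduct₂ inl inr ↔
    IsCoprod (Hom.onObj inl) (Hom.onObj inr) ∧ IsCoprod (Hom.onArr inl) (Hom.onArr inr) := by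
  refine ⟨fun h => ?_, fun h => isCoproduct₂_of_isCoprod h.1 h.2⟩
  obtain ⟨P', inl', inr', h₀, h₁⟩ := exists_coprodCat A B
  have h' := isCoproduct₂_of_isCoprod h₀ h₁
  obtain ⟨l, ⟨hl₁, hl₂⟩, -⟩ := h'.existsUnique_desc inl inr
  obtain ⟨m, ⟨hm₁, hm₂⟩, -⟩ := h.existsUnique_desc inl' inr'
  have e₁ : l ≫ m = 𝟙 P' := (h'.existsUnique_desc inl' inr').unique
    ⟨by rw [← Category.assoc, hl₁, hm₁], by rw [← Category.assoc, hl₂, hm₂]⟩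
    ⟨Category.comp_id _, Category.comp_id _⟩
  have e₂ : m ≫ l = 𝟙 P := (h.existsUnique_desc inl inr).unique
    ⟨by rw [← Category.assoc, hm₁, hl₁], by rw [← Category.assoc, hm₂, hl₂]⟩
    ⟨Category.comp_id _, Category.comp_id _⟩
  obtain ⟨i₀, i₁⟩ := isIso_components e₁ e₂
  subst hl₁ hl₂
  exact ⟨h₀.comp_isIso _, h₁.comp_isIso _⟩

/-- The internal category with no objects. -/
lemma exists_initialCat : ∃ I : InternalCat E, ∀ Z : InternalCat E, ∃! _u : I ⟶ Z, True := by
  have strict {T W : E} (t : T ⟶ ⊥_ E) (f g : T ⟶ W) : f = g := by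
    have : IsIso t := HasStrictInitialObjects.out t initialIsInitial
    rw [← cancel_epi (inv t)]
    exact initialIsInitial.hom_ext _ _
  refine ⟨ofCmp (⊥_ E) (⊥_ E) (𝟙 _) (𝟙 _) (𝟙 _) (fun f _ _ => f) (fun _ _ _ _ => rfl)
    (strict (𝟙 _) _ _) (strict (𝟙 _) _ _) (fun f _ _ => strict f _ _) (fun f _ _ => strict f _ _)
    (fun _ => strict (𝟙 _) _ _) (fun _ => strict (𝟙 _) _ _) (fun f _ _ _ _ => strict f _ _),
    fun Z => ⟨homMk (initial.to _) (initial.to _) (strict (𝟙 _) _ _) (strict (𝟙 _) _ _)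
      (strict (𝟙 _) _ _) (fun f _ _ => strict f _ _), trivial, fun F _ => hom_ext ?_ ?_⟩⟩
  · exact strict (𝟙 _) _ _
  · exact strict (𝟙 _) _ _

variable (E) in
/-- Extensivity is inherited by internal categories, because coproducts and pullbacks of internal
categories are both computed on objects and on arrows. -/
lemma isExtensive₂ : TwoCat.IsExtensive₂ (InternalCat E) where
  exists_initial := by
    obtain ⟨I, hI⟩ := exists_initialCat (E := E)
    exact ⟨I, isInitial₂_of_existsUnique hI⟩
  exists_coproduct X Y := by
    obtain ⟨P, inl, inr, h⟩ := exists_coprodCat X Y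
    exact ⟨P, inl, inr, isCoproduct₂_iff.2 h⟩
  exists_pullback_coprojection inl inr _ _ z := ⟨hasPullbacks₂ E z inl, hasPullbacks₂ E z inr⟩
  coproduct_iff := by
    intro X Y Q inl inr h A B Z a b s t z hs ht
    rw [isCoproduct₂_iff] at h ⊢
    rw [isPullback₂_iff, isPullback₂_iff,
      h.1.iff_isPullback (congrArg Hom.onObj hs) (congrArg Hom.onObj ht),
      h.2.iff_isPullback (congrArg Hom.onArr hs) (congrArg Hom.onArr ht)]
    tauto

end Coproduct
end InternalCat

/-! ### Stable coequalisers -/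

namespace StableCoequalizer
variable {E : Type u} [Category.{v} E] {X Y C W T T' : E}

/-- `q` is a coequaliser of `f` and `g`. -/
def IsCoeq (f g : X ⟶ Y) (q : Y ⟶ C) : Prop :=
  ∃ w : f ≫ q = g ≫ q, Nonempty (IsColimit (Cofork.ofπ q w))

namespace IsCoeq
variable {f g : X ⟶ Y} {q : Y ⟶ C}

lemma of_existsUnique (w : f ≫ q = g ≫ q)
    (h : ∀ {W : E} (k : Y ⟶ W), f ≫ k = g ≫ k → ∃! l : C ⟶ W, q ≫ l = k) : IsCoeq f g q :=
  ⟨w, ⟨Cofork.IsColimit.mk _ (fun s => (h s.π s.condition).choose)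
    (fun s => (h s.π s.condition).choose_spec.1)
    (fun s m hm => (h s.π s.condition).choose_spec.2 m hm)⟩⟩

lemma w (h : IsCoeq f g q) : f ≫ q = g ≫ q := h.choose

lemma exists_desc (h : IsCoeq f g q) (k : Y ⟶ W) (hk : f ≫ k = g ≫ k) : ∃ l : C ⟶ W, q ≫ l = k :=
  ⟨_, (Cofork.IsColimit.desc' h.choose_spec.some k hk).2⟩

lemma epi (h : IsCoeq f g q) : Epi q :=
  ⟨fun _ _ e => Cofork.IsColimit.hom_ext h.choose_spec.some e⟩

lemma comp_isIso (h : IsCoeq f g q) (e : C ⟶ W) [IsIso e] : IsCoeq f g (q ≫ e) := by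
  have := h.epi
  refine of_existsUnique (by rw [← Category.assoc, h.w, Category.assoc]) fun k hk => ?_
  obtain ⟨l, hl⟩ := h.exists_desc k hk
  refine ⟨inv e ≫ l, by simp [hl], fun m hm => ?_⟩
  rw [← cancel_epi (q ≫ e), hm]
  simp [hl]

lemma exists_isCoeq [HasCoequalizers E] (f g : X ⟶ Y) : ∃ (C : E) (q : Y ⟶ C), IsCoeq f g q :=
  ⟨_, coequalizer.π f g, coequalizer.condition f g, ⟨coequalizerIsCoequalizer f g⟩⟩

variable [HasPullbacks E] (hE : HasPullbackStableCoequalizers E)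
include hE

/-- Descent along the pullback `e : T' ⟶ T` of a stable coequaliser `q`: a morphism out of `T'`
descends to `T` if it identifies any two generalised elements of `T'` over the same element of
`T` whose images in `Y` are related by the relation defining `q`. -/
lemma exists_descend (h : IsCoeq f g q) {x : T' ⟶ Y} {e : T' ⟶ T} {s : T ⟶ C}
    (hp : IsPullback x e q s) (m : T' ⟶ W)
    (hm : ∀ {S : E} (a b : S ⟶ T') (r : S ⟶ X), a ≫ x = r ≫ f → b ≫ x = r ≫ g →
      a ≫ e = b ≫ e → a ≫ m = b ≫ m) : ∃ m' : T ⟶ W, e ≫ m' = m := by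
  obtain ⟨w, ⟨hq⟩⟩ := h
  have hX := IsPullback.of_hasPullback (f ≫ q ≫ 𝟙 C) s
  let f' := hp.lift (pullback.fst _ _ ≫ f) (pullback.snd _ _) (by simpa using hX.w)
  let g' := hp.lift (pullback.fst _ _ ≫ g) (pullback.snd _ _) (by simpa [w] using hX.w)
  have hf₁ : f' ≫ x = _ := hp.lift_fst _ _ _
  have hf₂ : f' ≫ e = _ := hp.lift_snd _ _ _
  have hg₁ : g' ≫ x = _ := hp.lift_fst _ _ _
  have hg₂ : g' ≫ e = _ := hp.lift_snd _ _ _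
  obtain ⟨c⟩ := hE.2 f g q w ⟨hq⟩ (𝟙 C) s _ _ x e s (𝟙 T) f' g' e (hf₂.trans hg₂.symm) hX
    (by simpa using hp) (IsPullback.of_horiz_isIso_mono ⟨by simp⟩).flip hf₁ hf₂ hg₁ hg₂ hp.w.symm
    (Category.comp_id _)
  exact ⟨_, (Cofork.IsColimit.desc' c m
    (hm f' g' _ hf₁ hg₁ (hf₂.trans hg₂.symm))).2⟩

/-- Stable coequalisers are stable epimorphisms. -/
lemma epi_of_isPullback (h : IsCoeq f g q) {x : T' ⟶ Y} {e : T' ⟶ T} {s : T ⟶ C}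
    (hp : IsPullback x e q s) : Epi e := by
  obtain ⟨w, ⟨hq⟩⟩ := h
  have hX := IsPullback.of_hasPullback (f ≫ q ≫ 𝟙 C) s
  let f' := hp.lift (pullback.fst _ _ ≫ f) (pullback.snd _ _) (by simpa using hX.w)
  let g' := hp.lift (pullback.fst _ _ ≫ g) (pullback.snd _ _) (by simpa [w] using hX.w)
  have hf₁ : f' ≫ x = _ := hp.lift_fst _ _ _
  have hf₂ : f' ≫ e = _ := hp.lift_snd _ _ _
  have hg₁ : g' ≫ x = _ := hp.lift_fst _ _ _
  have hg₂ : g' ≫ e = _ := hp.lift_snd _ _ _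
  obtain ⟨c⟩ := hE.2 f g q w ⟨hq⟩ (𝟙 C) s _ _ x e s (𝟙 T) f' g' e (hf₂.trans hg₂.symm) hX
    (by simpa using hp) (IsPullback.of_horiz_isIso_mono ⟨by simp⟩).flip hf₁ hf₂ hg₁ hg₂ hp.w.symm
    (Category.comp_id _)
  exact ⟨fun _ _ e => Cofork.IsColimit.hom_ext c e⟩

/-- Every generalised element of a stable coequaliser lifts along a cover of its domain. -/
lemma exists_cover (h : IsCoeq f g q) (s : T ⟶ C) :
    ∃ (S : E) (e : S ⟶ T) (y : S ⟶ Y), Epi e ∧ e ≫ s = y ≫ q := by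
  have hp := IsPullback.of_hasPullback q s
  exact ⟨_, _, _, h.epi_of_isPullback hE hp, hp.w.symm⟩

end IsCoeq
end StableCoequalizer

/-! ### Quotients of internal categories that are the identity on objects -/

namespace InternalCat
open StableCoequalizer
variable {E : Type u} [Category.{v} E] [HasPullbacks E]

section Quotient
variable {L : InternalCat E} {R T : E}

/-- A parallel pair of families of arrows `u, v : R ⇉ L₁` with common sources and targets, which
is closed under composition with arrows of `L` on both sides. -/
structure IsIdealPair (L : InternalCat E) (u v : R ⟶ L.arr) : Prop where
  src_eq : u ≫ L.src = v ≫ L.src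
  tgt_eq : u ≫ L.tgt = v ≫ L.tgt
  comp_left : ∀ {S : E} (f : S ⟶ L.arr) (r : S ⟶ R) (h : f ≫ L.tgt = (r ≫ u) ≫ L.src)
    (h' : f ≫ L.tgt = (r ≫ v) ≫ L.src),
    ∃ r' : S ⟶ R, L.cmp f (r ≫ u) h = r' ≫ u ∧ L.cmp f (r ≫ v) h' = r' ≫ v
  comp_right : ∀ {S : E} (r : S ⟶ R) (f : S ⟶ L.arr) (h : (r ≫ u) ≫ L.tgt = f ≫ L.src)
    (h' : (r ≫ v) ≫ L.tgt = f ≫ L.src),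
    ∃ r' : S ⟶ R, L.cmp (r ≫ u) f h = r' ≫ u ∧ L.cmp (r ≫ v) f h' = r' ≫ v

variable {u v : R ⟶ L.arr} (hE : HasPullbackStableCoequalizers E)
include hE

/-- Composition descends to the quotient by an ideal pair, one factor at a time. -/
lemma IsIdealPair.exists_cmp (H : IsIdealPair L u v) {C : E} {q : L.arr ⟶ C} (hq : IsCoeq u v q)
    {src tgt : C ⟶ L.obj} (hs : q ≫ src = L.src) (ht : q ≫ tgt = L.tgt) (s t : T ⟶ C)
    (h : s ≫ tgt = t ≫ src) : ∃ c : T ⟶ C, ∀ {S : E} (e : S ⟶ T) (x y : S ⟶ L.arr)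
      (hxy : x ≫ L.tgt = y ≫ L.src), e ≫ s = x ≫ q → e ≫ t = y ≫ q →
        e ≫ c = L.cmp x y hxy ≫ q := by
  have h₁ := IsPullback.of_hasPullback q s
  generalize pullback q s = T₁, pullback.fst q s = x₁, pullback.snd q s = e₁ at h₁
  have h₂ := IsPullback.of_hasPullback q (e₁ ≫ t)
  generalize pullback q (e₁ ≫ t) = T₂, pullback.fst q (e₁ ≫ t) = x₂,
    pullback.snd q (e₁ ≫ t) = e₂ at h₂
  have h₁₂ : (e₂ ≫ x₁) ≫ L.tgt = x₂ ≫ L.src := by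
    rw [← ht, ← hs, Category.assoc, reassoc_of% h₁.w, h, reassoc_of% h₂.w]
  -- `T₂` covers `T₁`, which covers `T`; descend along the second factor first.
  obtain ⟨m, hm⟩ := hq.exists_descend hE h₂ (L.cmp (e₂ ≫ x₁) x₂ h₁₂ ≫ q) (fun a b r ha hb hab => by
    obtain ⟨r', hr₁, hr₂⟩ := H.comp_left (a ≫ e₂ ≫ x₁) r
      (by rw [← ha, Category.assoc, Category.assoc, Category.assoc, ← h₁₂, Category.assoc])
      (by rw [← hb, reassoc_of% hab, Category.assoc, h₁₂, Category.assoc])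
    rw [← Category.assoc, ← Category.assoc, precomp_cmp, precomp_cmp,
      L.cmp_congr rfl ha, L.cmp_congr (by rw [← Category.assoc, ← hab, Category.assoc]) hb,
      hr₁, hr₂, Category.assoc, hq.w, Category.assoc])
  -- For the first factor, the second one has to be lifted to `L` again before `comp_right` applies.
  obtain ⟨c, hc⟩ := hq.exists_descend hE h₁ m (fun {S} a b r ha hb hab => by
    obtain ⟨S', k, y, hk, hy⟩ := hq.exists_cover hE (a ≫ e₁ ≫ t)
    obtain ⟨a', ha₁, ha₂⟩ : ∃ a' : S' ⟶ T₂, a' ≫ x₂ = y ∧ a' ≫ e₂ = k ≫ a :=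
      ⟨h₂.lift y (k ≫ a) (by rw [← hy, Category.assoc]), h₂.lift_fst _ _ _, h₂.lift_snd _ _ _⟩
    obtain ⟨b', hb₁, hb₂⟩ : ∃ b' : S' ⟶ T₂, b' ≫ x₂ = y ∧ b' ≫ e₂ = k ≫ b :=
      ⟨h₂.lift y (k ≫ b) (by rw [← hy, Category.assoc, reassoc_of% hab]), h₂.lift_fst _ _ _,
        h₂.lift_snd _ _ _⟩
    have ea : a' ≫ e₂ ≫ x₁ = (k ≫ r) ≫ u := by rw [reassoc_of% ha₂, ha, Category.assoc]
    have eb : b' ≫ e₂ ≫ x₁ = (k ≫ r) ≫ v := by rw [reassoc_of% hb₂, hb, Category.assoc]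
    obtain ⟨r', hr₁, hr₂⟩ := H.comp_right (k ≫ r) y
      (by rw [← ea, ← ha₁, Category.assoc, h₁₂, Category.assoc])
      (by rw [← eb, ← hb₁, Category.assoc, h₁₂, Category.assoc])
    rw [← cancel_epi k, ← reassoc_of% ha₂, ← reassoc_of% hb₂, hm, ← Category.assoc,
      ← Category.assoc, precomp_cmp, precomp_cmp, L.cmp_congr ea ha₁, L.cmp_congr eb hb₁, hr₁, hr₂,
      Category.assoc, hq.w, Category.assoc])
  refine ⟨c, fun {S} e x y hxy hx hy => ?_⟩
  obtain ⟨a, ha₁, ha₂⟩ : ∃ a : S ⟶ T₁, a ≫ x₁ = x ∧ a ≫ e₁ = e :=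
    ⟨h₁.lift x e hx.symm, h₁.lift_fst _ _ _, h₁.lift_snd _ _ _⟩
  obtain ⟨b, hb₁, hb₂⟩ : ∃ b : S ⟶ T₂, b ≫ x₂ = y ∧ b ≫ e₂ = a :=
    ⟨h₂.lift y a (by rw [reassoc_of% ha₂, hy]), h₂.lift_fst _ _ _, h₂.lift_snd _ _ _⟩
  rw [← ha₂, Category.assoc, hc, ← hb₂, Category.assoc, hm, ← Category.assoc, precomp_cmp]
  exact congrArg (· ≫ q) (cmp_congr _ (by rw [reassoc_of% hb₂, ha₁]) hb₁ _)

/-- The quotient of an internal category by an ideal pair. -/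
lemma IsIdealPair.exists_quotient (H : IsIdealPair L u v) :
    ∃ (C : InternalCat E) (Q : L ⟶ C), IsIso (Hom.onObj Q) ∧ IsCoeq u v (Hom.onArr Q) := by
  have := hE.1
  obtain ⟨C, q, hq⟩ := IsCoeq.exists_isCoeq u v
  obtain ⟨src, hs⟩ := hq.exists_desc L.src H.src_eq
  obtain ⟨tgt, ht⟩ := hq.exists_desc L.tgt H.tgt_eq
  have hepi := hq.epi
  have hxy {S : E} {x y : S ⟶ L.arr} (h : (x ≫ q) ≫ tgt = (y ≫ q) ≫ src) :
      x ≫ L.tgt = y ≫ L.src := by simpa [hs, ht] using h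
  have hc {T : E} (s t : T ⟶ C) (h : s ≫ tgt = t ≫ src) := H.exists_cmp hE hq hs ht s t h
  choose c hc using @hc
  -- Equalities of morphisms into `C` are checked after lifting all the elements involved to `L`.
  have cover₁ {T W : E} (s : T ⟶ C) {k l : T ⟶ W}
      (h : ∀ {S : E} (e : S ⟶ T) (x : S ⟶ L.arr), e ≫ s = x ≫ q → e ≫ k = e ≫ l) : k = l := by
    obtain ⟨S, e, x, he, hx⟩ := hq.exists_cover hE s
    exact (cancel_epi e).1 (h e x hx)
  have cover₂ {T W : E} (s t : T ⟶ C) {k l : T ⟶ W}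
      (h : ∀ {S : E} (e : S ⟶ T) (x y : S ⟶ L.arr), e ≫ s = x ≫ q → e ≫ t = y ≫ q →
        e ≫ k = e ≫ l) : k = l :=
    cover₁ s fun e x hx => cover₁ (e ≫ t) fun e' y hy => by
      rw [← Category.assoc, h (e' ≫ e) (e' ≫ x) y (by simp [hx]) (by simpa using hy),
        Category.assoc]
  have comp_c : ∀ {S T : E} (s : S ⟶ T) (f g : T ⟶ C) (h : f ≫ tgt = g ≫ src),
      s ≫ c f g h = c (s ≫ f) (s ≫ g) (by simp [h]) := fun s f g h =>
    cover₂ (s ≫ f) (s ≫ g) fun e x y hx hy => by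
      have hxy' : x ≫ L.tgt = y ≫ L.src := hxy (by rw [← hx, ← hy]; simp [h])
      rw [hc (s ≫ f) (s ≫ g) _ e x y hxy' hx hy, ← Category.assoc]
      exact hc f g h (e ≫ s) x y hxy' (by simpa using hx) (by simpa using hy)
  let D : InternalCat E := ofCmp L.obj C src tgt (L.ident ≫ q) c comp_c
    (by rw [Category.assoc, hs, L.ident_src]) (by rw [Category.assoc, ht, L.ident_tgt])
    (fun f g h => cover₂ f g fun e x y hx hy => by
      have hxy' : x ≫ L.tgt = y ≫ L.src := hxy (by rw [← hx, ← hy]; simp [h])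
      rw [← Category.assoc, hc f g h e x y hxy' hx hy, Category.assoc, hs, cmp_src,
        reassoc_of% hx, hs])
    (fun f g h => cover₂ f g fun e x y hx hy => by
      have hxy' : x ≫ L.tgt = y ≫ L.src := hxy (by rw [← hx, ← hy]; simp [h])
      rw [← Category.assoc, hc f g h e x y hxy' hx hy, Category.assoc, ht, cmp_tgt,
        reassoc_of% hy, ht])
    (fun h => by
      have hl : (L.src ≫ L.ident) ≫ L.tgt = 𝟙 _ ≫ L.src := by simp [ident_tgt]
      rw [← cancel_epi q, hc _ _ h q (L.src ≫ L.ident) (𝟙 _) hl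
          (by rw [reassoc_of% hs, Category.assoc]) (by simp),
        L.cmp_of_left_eq_ident L.src rfl hl]
      simp)
    (fun h => by
      have hl : 𝟙 _ ≫ L.tgt = (L.tgt ≫ L.ident) ≫ L.src := by simp [ident_src]
      rw [← cancel_epi q, hc _ _ h q (𝟙 _) (L.tgt ≫ L.ident) hl (by simp)
          (by rw [reassoc_of% ht, Category.assoc]),
        L.cmp_of_right_eq_ident L.tgt rfl hl]
      simp)
    (fun f g k hfg hgk => cover₂ f g fun e x y hx hy => cover₁ (e ≫ k) fun e' z hz => by
      have exy : (e' ≫ x) ≫ L.tgt = (e' ≫ y) ≫ L.src := hxy (by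
        rw [Category.assoc e' x q, ← hx, Category.assoc e' y q, ← hy]; simp [hfg])
      have eyz : (e' ≫ y) ≫ L.tgt = z ≫ L.src := hxy (by
        rw [Category.assoc e' y q, ← hy, ← hz]; simp [hgk])
      have hx' : (e' ≫ e) ≫ f = (e' ≫ x) ≫ q := by simp [hx]
      have hy' : (e' ≫ e) ≫ g = (e' ≫ y) ≫ q := by simp [hy]
      have hz' : (e' ≫ e) ≫ k = z ≫ q := by simpa using hz
      rw [← Category.assoc, ← Category.assoc,
        hc _ _ _ (e' ≫ e) (L.cmp (e' ≫ x) (e' ≫ y) exy) z (by rw [cmp_tgt, eyz])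
          (hc f g hfg _ _ _ exy hx' hy') hz',
        hc _ _ _ (e' ≫ e) (e' ≫ x) (L.cmp (e' ≫ y) z eyz) (by rw [cmp_src, exy]) hx'
          (hc g k hgk _ _ _ eyz hy' hz'), cmp_assoc])
  have D_cmp {T : E} (s t : T ⟶ C) (h : s ≫ tgt = t ≫ src) : D.cmp s t h = c s t h :=
    ofCmp_cmp (comp_c := comp_c) s t h
  refine ⟨D, homMk (𝟙 _) q (by simp [D, hs]) (by simp [D, ht]) (by simp [D]) fun f g h => ?_, ?_, hq⟩
  · have e := hc (f ≫ q) (g ≫ q) (by simpa [hs, ht] using h) (𝟙 _) f g h (Category.id_comp _)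
      (Category.id_comp _)
    rw [D_cmp, ← e, Category.id_comp]
  · exact inferInstanceAs (IsIso (𝟙 L.obj))

/-- A functor which is invertible on objects and a stable coequaliser on arrows has the universal
property of a quotient. -/
lemma existsUnique_desc_of_isCoeq {C : InternalCat E} {Q : L ⟶ C} [IsIso (Hom.onObj Q)]
    (hq : IsCoeq u v (Hom.onArr Q)) {Z : InternalCat E} (H : L ⟶ Z)
    (hH : u ≫ Hom.onArr H = v ≫ Hom.onArr H) : ∃! H' : C ⟶ Z, Q ≫ H' = H := by
  have hepi := hq.epi
  obtain ⟨k, hk⟩ := hq.exists_desc (Hom.onArr H) hH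
  have hk₀ : Hom.onObj Q ≫ inv (Hom.onObj Q) ≫ Hom.onObj H = Hom.onObj H := by simp
  refine ⟨homMk (inv (Hom.onObj Q) ≫ Hom.onObj H) k ?_ ?_ ?_ ?_, hom_ext hk₀ hk, ?_⟩
  · rw [← cancel_epi (Hom.onArr Q), reassoc_of% hk, Hom.onArr_src, ← Category.assoc, Hom.onArr_src,
      Category.assoc, hk₀]
  · rw [← cancel_epi (Hom.onArr Q), reassoc_of% hk, Hom.onArr_tgt, ← Category.assoc, Hom.onArr_tgt,
      Category.assoc, hk₀]
  · rw [← cancel_epi (Hom.onObj Q), ← Category.assoc, ← Hom.ident_onArr, Category.assoc, hk,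
      Hom.ident_onArr]
    simp
  · intro T f g h
    obtain ⟨S, e, x, he, hx⟩ := hq.exists_cover hE f
    obtain ⟨S', e', y, he', hy⟩ := hq.exists_cover hE (e ≫ g)
    have hx' : (e' ≫ e) ≫ f = (e' ≫ x) ≫ Hom.onArr Q := by simp [hx]
    have hy' : (e' ≫ e) ≫ g = y ≫ Hom.onArr Q := by simpa using hy
    have hxy : (e' ≫ x) ≫ L.tgt = y ≫ L.src := by
      rw [← cancel_mono (Hom.onObj Q)]
      calc ((e' ≫ x) ≫ L.tgt) ≫ Hom.onObj Q = ((e' ≫ x) ≫ Hom.onArr Q) ≫ C.tgt := by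
            simp [Hom.onArr_tgt]
        _ = ((e' ≫ e) ≫ f) ≫ C.tgt := by rw [hx']
        _ = ((e' ≫ e) ≫ g) ≫ C.src := by simp [h]
        _ = (y ≫ Hom.onArr Q) ≫ C.src := by rw [hy']
        _ = _ := by simp [Hom.onArr_src]
    rw [← cancel_epi (e' ≫ e), ← Category.assoc _ _ k, precomp_cmp, precomp_cmp,
      C.cmp_congr hx' hy', ← Hom.cmp_onArr Q _ _ hxy, Category.assoc (L.cmp _ _ _)]
    refine (congrArg (L.cmp _ _ hxy ≫ ·) hk).trans ((Hom.cmp_onArr H _ _ hxy).trans ?_)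
    exact cmp_congr _ (by rw [← hk, ← Category.assoc, ← hx', Category.assoc])
      (by rw [← hk, ← Category.assoc, ← hy', Category.assoc]) _
  · rintro K rfl
    refine hom_ext ?_ ?_
    · rw [← cancel_epi (Hom.onObj Q)]; exact hk₀.symm
    · rw [← cancel_epi (Hom.onArr Q)]; exact hk.symm

end Quotient

/-! ### The ideal pair generated by a pair of families of parallel arrows -/

section Ideal
variable {L : InternalCat E} {R T : E}

/-- `R` is the object of composable triples `(a, p t, b)` in `L`. -/
structure IsTriple (L : InternalCat E) (p : T ⟶ L.arr) (a : R ⟶ L.arr) (t : R ⟶ T)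
    (b : R ⟶ L.arr) : Prop where
  w₁ : a ≫ L.tgt = (t ≫ p) ≫ L.src
  w₂ : (t ≫ p) ≫ L.tgt = b ≫ L.src
  exists_lift : ∀ {S : E} (a' : S ⟶ L.arr) (t' : S ⟶ T) (b' : S ⟶ L.arr),
    a' ≫ L.tgt = (t' ≫ p) ≫ L.src → (t' ≫ p) ≫ L.tgt = b' ≫ L.src →
    ∃ l : S ⟶ R, l ≫ a = a' ∧ l ≫ t = t' ∧ l ≫ b = b'
  hom_ext : ∀ {S : E} (l l' : S ⟶ R), l ≫ a = l' ≫ a → l ≫ t = l' ≫ t → l ≫ b = l' ≫ b → l = l'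

lemma exists_isTriple (L : InternalCat E) (p : T ⟶ L.arr) :
    ∃ (R : E) (a : R ⟶ L.arr) (t : R ⟶ T) (b : R ⟶ L.arr), IsTriple L p a t b := by
  have h₁ := IsPullback.of_hasPullback L.tgt (p ≫ L.src)
  generalize pullback L.tgt (p ≫ L.src) = R₁, pullback.fst L.tgt (p ≫ L.src) = a₁,
    pullback.snd L.tgt (p ≫ L.src) = t₁ at h₁
  have h₂ := IsPullback.of_hasPullback (t₁ ≫ p ≫ L.tgt) L.src
  generalize pullback (t₁ ≫ p ≫ L.tgt) L.src = R, pullback.fst (t₁ ≫ p ≫ L.tgt) L.src = r,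
    pullback.snd (t₁ ≫ p ≫ L.tgt) L.src = b at h₂
  refine ⟨R, r ≫ a₁, r ≫ t₁, b, ⟨?_, ?_, ?_, ?_⟩⟩
  · simp [h₁.w]
  · simpa using h₂.w
  · intro S a' t' b' ha hb
    obtain ⟨l, hl₁, hl₂⟩ := h₁.exists_lift a' t' (by simpa using ha)
    obtain ⟨m, hm₁, hm₂⟩ := h₂.exists_lift l b' (by simpa [reassoc_of% hl₂] using hb)
    exact ⟨m, by rw [reassoc_of% hm₁, hl₁], by rw [reassoc_of% hm₁, hl₂], hm₂⟩
  · intro S l l' ha ht hb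
    exact h₂.hom_ext (h₁.hom_ext (by simpa using ha) (by simpa using ht)) hb

namespace IsTriple
variable {p q : T ⟶ L.arr} {a : R ⟶ L.arr} {t : R ⟶ T} {b : R ⟶ L.arr}

/-- The composite of the universal composable triple. -/
noncomputable def cmp₃ (h : IsTriple L p a t b) : R ⟶ L.arr :=
  L.cmp (L.cmp a (t ≫ p) h.w₁) b (by rw [cmp_tgt, h.w₂])

lemma comp_cmp₃ (h : IsTriple L p a t b) {S : E} (l : S ⟶ R) : l ≫ h.cmp₃ =
    L.cmp (L.cmp (l ≫ a) (l ≫ t ≫ p) (by simp [h.w₁])) (l ≫ b)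
      (by rw [cmp_tgt]; simpa using congrArg (l ≫ ·) h.w₂) := by
  rw [cmp₃, precomp_cmp, L.cmp_congr (precomp_cmp _ _ _ _ _) rfl]

lemma of_parallel (h : IsTriple L p a t b) (hs : p ≫ L.src = q ≫ L.src)
    (ht : p ≫ L.tgt = q ≫ L.tgt) : IsTriple L q a t b where
  w₁ := by rw [h.w₁, Category.assoc, hs, Category.assoc]
  w₂ := by rw [← h.w₂, Category.assoc, ← ht, Category.assoc]
  exists_lift a' t' b' h₁ h₂ := h.exists_lift a' t' b' (by simpa [hs] using h₁)
    (by simpa [ht] using h₂)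
  hom_ext := h.hom_ext

/-- Composing the universal triple with a further arrow only changes its outer terms, by
associativity. -/
lemma isIdealPair (h : IsTriple L p a t b) (hs : p ≫ L.src = q ≫ L.src)
    (ht : p ≫ L.tgt = q ≫ L.tgt) : IsIdealPair L h.cmp₃ (h.of_parallel hs ht).cmp₃ where
  src_eq := by simp only [cmp₃, cmp_src]
  tgt_eq := by simp only [cmp₃, cmp_tgt]
  comp_left {S} f r hf hf' := by
    have e₁ : f ≫ L.tgt = (r ≫ a) ≫ L.src := by
      rw [hf, comp_cmp₃, cmp_src, cmp_src]
    obtain ⟨r', ha, ht', hb⟩ := h.exists_lift (L.cmp f (r ≫ a) e₁) (r ≫ t) (r ≫ b)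
      (by rw [cmp_tgt]; simpa using congrArg (r ≫ ·) h.w₁)
      (by simpa using congrArg (r ≫ ·) h.w₂)
    have key {p : T ⟶ L.arr} (h : IsTriple L p a t b) (hf) :
        L.cmp f (r ≫ h.cmp₃) hf = r' ≫ h.cmp₃ := by
      have e₂ : (r ≫ a) ≫ L.tgt = (r ≫ t ≫ p) ≫ L.src := by simpa using congrArg (r ≫ ·) h.w₁
      have e₃ : (r ≫ t ≫ p) ≫ L.tgt = (r ≫ b) ≫ L.src := by simpa using congrArg (r ≫ ·) h.w₂
      calc _ = L.cmp f (L.cmp (L.cmp (r ≫ a) (r ≫ t ≫ p) e₂) (r ≫ b) (by rw [cmp_tgt, e₃]))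
            (by rw [cmp_src, cmp_src, e₁]) := L.cmp_congr rfl (h.comp_cmp₃ r) hf
        _ = L.cmp (L.cmp f (L.cmp (r ≫ a) (r ≫ t ≫ p) e₂) (by rw [cmp_src, e₁])) (r ≫ b)
            (by rw [cmp_tgt, cmp_tgt, e₃]) := (L.cmp_assoc _ _ _ _ _).symm
        _ = L.cmp (L.cmp (L.cmp f (r ≫ a) e₁) (r ≫ t ≫ p) (by rw [cmp_tgt, e₂])) (r ≫ b)
            (by rw [cmp_tgt, e₃]) := L.cmp_congr (L.cmp_assoc _ _ _ _ _).symm rfl _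
        _ = _ := ((h.comp_cmp₃ r').trans
            (L.cmp_congr (L.cmp_congr ha (by rw [reassoc_of% ht']) _) hb _)).symm
    exact ⟨r', key h hf, key _ hf'⟩
  comp_right {S} r f hf hf' := by
    have e₁ : (r ≫ b) ≫ L.tgt = f ≫ L.src := by
      rw [← hf, comp_cmp₃, cmp_tgt]
    obtain ⟨r', ha, ht', hb⟩ := h.exists_lift (r ≫ a) (r ≫ t) (L.cmp (r ≫ b) f e₁)
      (by simpa using congrArg (r ≫ ·) h.w₁)
      (by rw [cmp_src]; simpa using congrArg (r ≫ ·) h.w₂)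
    have key {p : T ⟶ L.arr} (h : IsTriple L p a t b) (hf) :
        L.cmp (r ≫ h.cmp₃) f hf = r' ≫ h.cmp₃ := by
      have e₂ : (r ≫ a) ≫ L.tgt = (r ≫ t ≫ p) ≫ L.src := by simpa using congrArg (r ≫ ·) h.w₁
      have e₃ : (r ≫ t ≫ p) ≫ L.tgt = (r ≫ b) ≫ L.src := by simpa using congrArg (r ≫ ·) h.w₂
      calc _ = L.cmp (L.cmp (L.cmp (r ≫ a) (r ≫ t ≫ p) e₂) (r ≫ b) (by rw [cmp_tgt, e₃])) f
            (by rw [cmp_tgt, e₁]) := L.cmp_congr (h.comp_cmp₃ r) rfl hf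
        _ = L.cmp (L.cmp (r ≫ a) (r ≫ t ≫ p) e₂) (L.cmp (r ≫ b) f e₁)
            (by rw [cmp_tgt, cmp_src, e₃]) := L.cmp_assoc _ _ _ _ _
        _ = _ := ((h.comp_cmp₃ r').trans
            (L.cmp_congr (L.cmp_congr ha (by rw [reassoc_of% ht']) _) hb _)).symm
    exact ⟨r', key h hf, key _ hf'⟩

/-- A functor identifies the ideal pair generated by `p` and `q` if and only if it identifies `p`
and `q`. -/
lemma cmp₃_comp_eq_iff (h : IsTriple L p a t b) (hs : p ≫ L.src = q ≫ L.src)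
    (ht : p ≫ L.tgt = q ≫ L.tgt) {Z : InternalCat E} (H : L ⟶ Z) :
    h.cmp₃ ≫ Hom.onArr H = (h.of_parallel hs ht).cmp₃ ≫ Hom.onArr H ↔
      p ≫ Hom.onArr H = q ≫ Hom.onArr H := by
  constructor
  · intro e
    have e₁ : (p ≫ L.src ≫ L.ident) ≫ L.tgt = (𝟙 T ≫ p) ≫ L.src := by simp [ident_tgt]
    have e₂ : (𝟙 T ≫ p) ≫ L.tgt = (p ≫ L.tgt ≫ L.ident) ≫ L.src := by simp [ident_src]
    obtain ⟨r, ha, ht', hb⟩ := h.exists_lift _ _ _ e₁ e₂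
    have key {p' : T ⟶ L.arr} (h : IsTriple L p' a t b) (hps : p ≫ L.src = p' ≫ L.src) :
        r ≫ h.cmp₃ = p' := by
      have h' : r ≫ t ≫ p' = p' := by rw [reassoc_of% ht']
      rw [h.comp_cmp₃, L.cmp_of_right_eq_ident (p ≫ L.tgt) (by rw [hb, Category.assoc]),
        L.cmp_of_left_eq_ident (p ≫ L.src) (by rw [ha, Category.assoc]), h']
    have := congrArg (r ≫ ·) e
    simpa only [← Category.assoc, key h rfl, key (h.of_parallel hs ht) hs] using this
  · intro e
    simp only [cmp₃, Hom.cmp_onArr]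
    exact cmp_congr _ (cmp_congr _ rfl (by simp [e]) _) rfl _

end IsTriple

/-- Imposing relations between parallel arrows of an internal category. -/
lemma exists_parallelQuotient (hE : HasPullbackStableCoequalizers E) (L : InternalCat E)
    (p q : T ⟶ L.arr) (hs : p ≫ L.src = q ≫ L.src) (ht : p ≫ L.tgt = q ≫ L.tgt) :
    ∃ (C : InternalCat E) (Q : L ⟶ C), IsIso (Hom.onObj Q) ∧
      p ≫ Hom.onArr Q = q ≫ Hom.onArr Q ∧ ∀ {Z : InternalCat E} (H : L ⟶ Z),
        p ≫ Hom.onArr H = q ≫ Hom.onArr H → ∃! H' : C ⟶ Z, Q ≫ H' = H := by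
  obtain ⟨R, a, t, b, h⟩ := exists_isTriple L p
  obtain ⟨C, Q, hQ, hq⟩ := (h.isIdealPair hs ht).exists_quotient hE
  exact ⟨C, Q, hQ, (h.cmp₃_comp_eq_iff hs ht Q).1 hq.w, fun H hH =>
    existsUnique_desc_of_isCoeq hE hq H ((h.cmp₃_comp_eq_iff hs ht H).2 hH)⟩

end Ideal
end InternalCat

/-! ### Stability along discrete Conduché fibrations -/

namespace CategoryTheory

lemma IsPullback.of_exists_lift {E : Type u} [Category.{v} E] {P X Y Z : E} {fst : P ⟶ X}
    {snd : P ⟶ Y} {f : X ⟶ Z} {g : Y ⟶ Z} (w : fst ≫ f = snd ≫ g)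
    (h : ∀ {S : E} (a : S ⟶ X) (b : S ⟶ Y), a ≫ f = b ≫ g → ∃ l : S ⟶ P, l ≫ fst = a ∧ l ≫ snd = b)
    (h' : ∀ {S : E} (l l' : S ⟶ P), l ≫ fst = l' ≫ fst → l ≫ snd = l' ≫ snd → l = l') :
    IsPullback fst snd f g :=
  ⟨⟨w⟩, ⟨PullbackCone.IsLimit.mk w (fun s => (h s.fst s.snd s.condition).choose)
    (fun s => (h s.fst s.snd s.condition).choose_spec.1)
    (fun s => (h s.fst s.snd s.condition).choose_spec.2)
    (fun s _ h₁ h₂ => h' _ _ (h₁.trans (h s.fst s.snd s.condition).choose_spec.1.symm)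
      (h₂.trans (h s.fst s.snd s.condition).choose_spec.2.symm))⟩⟩

end CategoryTheory

namespace InternalCat
open StableCoequalizer
variable {E : Type u} [Category.{v} E] [HasPullbacks E]

section Conduche
variable {X Y : InternalCat E} {p : X ⟶ Y}

/-- Factorisations of the image of an arrow lift along a discrete Conduché fibration. -/
lemma IsDiscreteConduche.exists_lift (hp : IsDiscreteConduche p) {S : E} {f g : S ⟶ Y.arr}
    (h : f ≫ Y.tgt = g ≫ Y.src) {ξ : S ⟶ X.arr} (e : ξ ≫ Hom.onArr p = Y.cmp f g h) :
    ∃ (x y : S ⟶ X.arr) (hxy : x ≫ X.tgt = y ≫ X.src),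
      x ≫ Hom.onArr p = f ∧ y ≫ Hom.onArr p = g ∧ X.cmp x y hxy = ξ := by
  obtain ⟨l, h₁, h₂⟩ := IsPullback.exists_lift hp (pullback.lift f g h) ξ e.symm
  have e₁ := congrArg (· ≫ pullback.fst _ _) h₁
  have e₂ := congrArg (· ≫ pullback.snd _ _) h₁
  simp only [Hom.onPairs, Category.assoc, pullback.lift_fst, pullback.lift_snd] at e₁ e₂
  refine ⟨l ≫ pullback.fst _ _, l ≫ pullback.snd _ _, by simp [pullback.condition],
    by simpa using e₁, by simpa using e₂, ?_⟩
  rw [← precomp_cmp _ _ _ _ pullback.condition, cmp_fst_snd, h₂]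

/-- The lifts of factorisations along a discrete Conduché fibration are unique. -/
lemma IsDiscreteConduche.lift_unique (hp : IsDiscreteConduche p) {S : E} {x y x' y' : S ⟶ X.arr}
    {h : x ≫ X.tgt = y ≫ X.src} {h' : x' ≫ X.tgt = y' ≫ X.src}
    (hx : x ≫ Hom.onArr p = x' ≫ Hom.onArr p) (hy : y ≫ Hom.onArr p = y' ≫ Hom.onArr p)
    (e : X.cmp x y h = X.cmp x' y' h') : x = x' ∧ y = y' := by
  have key : pullback.lift x y h = pullback.lift x' y' h' := by
    refine IsPullback.hom_ext hp ?_ e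
    apply pullback.hom_ext
    · simp only [Hom.onPairs, Category.assoc, pullback.lift_fst, pullback.lift_fst_assoc, hx]
    · simp only [Hom.onPairs, Category.assoc, pullback.lift_snd, pullback.lift_snd_assoc, hy]
  constructor
  · simpa only [pullback.lift_fst] using congrArg (· ≫ pullback.fst _ _) key
  · simpa only [pullback.lift_snd] using congrArg (· ≫ pullback.snd _ _) key

end Conduche

section SameOnObjects
variable {A B C : InternalCat E} {F G : A ⟶ B} {Q : B ⟶ C} {R : E} {a b : R ⟶ B.arr} {t : R ⟶ A.arr}

lemma onArr_src_eq (h₀ : Hom.onObj F = Hom.onObj G) :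
    Hom.onArr F ≫ B.src = Hom.onArr G ≫ B.src := by
  rw [Hom.onArr_src, Hom.onArr_src, h₀]

lemma onArr_tgt_eq (h₀ : Hom.onObj F = Hom.onObj G) :
    Hom.onArr F ≫ B.tgt = Hom.onArr G ≫ B.tgt := by
  rw [Hom.onArr_tgt, Hom.onArr_tgt, h₀]

/-- A coequaliser of internal functors that agree on objects is invertible on objects, and on arrows
it is the coequaliser of the ideal pair generated by the two functors. -/
lemma isCoeq_of_isCoequalizer₂ (hE : HasPullbackStableCoequalizers E)
    (h₀ : Hom.onObj F = Hom.onObj G) (hQ : TwoCat.IsCoequalizer₂ F G Q)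
    (h : IsTriple B (Hom.onArr F) a t b) : IsIso (Hom.onObj Q) ∧
      IsCoeq h.cmp₃ (h.of_parallel (onArr_src_eq h₀) (onArr_tgt_eq h₀)).cmp₃ (Hom.onArr Q) := by
  obtain ⟨D, P, hP, hP'⟩ := (h.isIdealPair (onArr_src_eq h₀) (onArr_tgt_eq h₀)).exists_quotient hE
  have hD {Z : InternalCat E} (H : B ⟶ Z) (hH : F ≫ H = G ≫ H) : ∃! H' : D ⟶ Z, P ≫ H' = H :=
    existsUnique_desc_of_isCoeq hE hP' H ((h.cmp₃_comp_eq_iff (onArr_src_eq h₀) (onArr_tgt_eq h₀)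
      H).2 (congrArg Hom.onArr hH))
  have hPw : F ≫ P = G ≫ P := hom_ext_arr
    ((h.cmp₃_comp_eq_iff (onArr_src_eq h₀) (onArr_tgt_eq h₀) P).1 hP'.w)
  obtain ⟨l, hl, -⟩ := hD Q hQ.w
  obtain ⟨m, hm, -⟩ := hQ.existsUnique_desc P hPw
  have e₁ : l ≫ m = 𝟙 D := (hD P hPw).unique (by rw [← Category.assoc, hl, hm]) (Category.comp_id _)
  have e₂ : m ≫ l = 𝟙 C := (hQ.existsUnique_desc Q hQ.w).unique
    (by rw [← Category.assoc, hm, hl]) (Category.comp_id _)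
  obtain ⟨i₀, i₁⟩ := isIso_components e₁ e₂
  subst hl
  exact ⟨inferInstanceAs (IsIso (Hom.onObj P ≫ Hom.onObj l)), hP'.comp_isIso _⟩

/-- Converse of `isCoeq_of_isCoequalizer₂`. -/
lemma isCoequalizer₂_of_isCoeq (hE : HasPullbackStableCoequalizers E)
    (h₀ : Hom.onObj F = Hom.onObj G) (h : IsTriple B (Hom.onArr F) a t b) [IsIso (Hom.onObj Q)]
    (hQ : IsCoeq h.cmp₃ (h.of_parallel (onArr_src_eq h₀) (onArr_tgt_eq h₀)).cmp₃ (Hom.onArr Q)) :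
    TwoCat.IsCoequalizer₂ F G Q :=
  isCoequalizer₂_of_existsUnique
    (hom_ext_arr ((h.cmp₃_comp_eq_iff (onArr_src_eq h₀) (onArr_tgt_eq h₀) Q).1 hQ.w))
    fun H hH => existsUnique_desc_of_isCoeq hE hQ H ((h.cmp₃_comp_eq_iff (onArr_src_eq h₀)
      (onArr_tgt_eq h₀) H).2 (congrArg Hom.onArr hH))

end SameOnObjects

/-- A discrete Conduché fibration lifts the factorisation of a composite of three arrows uniquely,
so the object of triples, and with it the ideal pair defining the coequaliser, is stable under
pullback along it. -/
lemma isPullback_triple {A B X Y A' B' : InternalCat E} {F : A ⟶ B} {K : B ⟶ Y} {p : X ⟶ Y}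
    (hp : IsDiscreteConduche p) {pA : A' ⟶ A} {a : A' ⟶ X} {pB : B' ⟶ B} {b : B' ⟶ X} {F' : A' ⟶ B'}
    (hA : IsPullback (Hom.onArr pA) (Hom.onArr a) (Hom.onArr (F ≫ K)) (Hom.onArr p))
    (hB₀ : IsPullback (Hom.onObj pB) (Hom.onObj b) (Hom.onObj K) (Hom.onObj p))
    (hB : IsPullback (Hom.onArr pB) (Hom.onArr b) (Hom.onArr K) (Hom.onArr p))
    (h₁ : F' ≫ pB = pA ≫ F) (h₂ : F' ≫ b = a) {R R' : E} {l r : R ⟶ B.arr} {t : R ⟶ A.arr}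
    {l' r' : R' ⟶ B'.arr} {t' : R' ⟶ A'.arr} (hR : IsTriple B (Hom.onArr F) l t r)
    (hR' : IsTriple B' (Hom.onArr F') l' t' r') {ρ : R' ⟶ R} (hl : ρ ≫ l = l' ≫ Hom.onArr pB)
    (ht : ρ ≫ t = t' ≫ Hom.onArr pA) (hr : ρ ≫ r = r' ≫ Hom.onArr pB) :
    IsPullback ρ (hR'.cmp₃ ≫ Hom.onArr b) (hR.cmp₃ ≫ Hom.onArr K) (Hom.onArr p) := by
  have h₁' : Hom.onArr F' ≫ Hom.onArr pB = Hom.onArr pA ≫ Hom.onArr F := congrArg Hom.onArr h₁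
  have h₂' : Hom.onArr F' ≫ Hom.onArr b = Hom.onArr a := congrArg Hom.onArr h₂
  have hρ : ρ ≫ hR.cmp₃ = hR'.cmp₃ ≫ Hom.onArr pB := by
    rw [hR.comp_cmp₃, IsTriple.cmp₃, Hom.cmp_onArr]
    exact cmp_congr _ ((cmp_congr _ hl (by rw [reassoc_of% ht, Category.assoc, h₁']) _).trans
      (Hom.cmp_onArr _ _ _ _).symm) hr _
  have expand {S : E} (s : S ⟶ R') : s ≫ hR'.cmp₃ ≫ Hom.onArr b =
      X.cmp (X.cmp (s ≫ l' ≫ Hom.onArr b) (s ≫ t' ≫ Hom.onArr a)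
        (by
          have e := congrArg (s ≫ ·) (Hom.composable b hR'.w₁)
          simpa [h₂'] using e))
        (s ≫ r' ≫ Hom.onArr b) (by
          have e := congrArg (s ≫ ·) (Hom.composable b hR'.w₂)
          rw [cmp_tgt]
          simpa [h₂'] using e) := by
    rw [IsTriple.cmp₃, Hom.cmp_onArr, precomp_cmp]
    refine cmp_congr _ ?_ rfl _
    rw [Hom.cmp_onArr, precomp_cmp]
    exact cmp_congr _ rfl (by rw [Category.assoc, h₂']) _
  refine IsPullback.of_exists_lift ?_ ?_ ?_
  · rw [reassoc_of% hρ, hB.w, Category.assoc]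
  · intro S σ ξ h
    have e₁ : (σ ≫ l) ≫ B.tgt = (σ ≫ t ≫ Hom.onArr F) ≫ B.src := by
      simpa using congrArg (σ ≫ ·) hR.w₁
    have e₂ : (σ ≫ t ≫ Hom.onArr F) ≫ B.tgt = (σ ≫ r) ≫ B.src := by
      simpa using congrArg (σ ≫ ·) hR.w₂
    rw [← Category.assoc, hR.comp_cmp₃, Hom.cmp_onArr] at h
    obtain ⟨ξ₁₂, ξ₃, c₁, i₁₂, i₃, rfl⟩ := hp.exists_lift _ h.symm
    rw [Hom.cmp_onArr] at i₁₂
    obtain ⟨ξ₁, ξ₂, c₂, i₁, i₂, rfl⟩ := hp.exists_lift _ i₁₂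
    obtain ⟨α, α₁, α₂⟩ := hB.exists_lift (σ ≫ l) ξ₁ i₁.symm
    obtain ⟨β, β₁, β₂⟩ := hB.exists_lift (σ ≫ r) ξ₃ i₃.symm
    obtain ⟨φ, φ₁, φ₂⟩ := hA.exists_lift (σ ≫ t) ξ₂ (by rw [i₂]; simp)
    rw [cmp_tgt] at c₁
    obtain ⟨s, s₁, s₂, s₃⟩ := hR'.exists_lift α φ β
      (by
        apply hB₀.hom_ext
        · rw [Category.assoc, Category.assoc, ← Hom.onArr_tgt, ← Hom.onArr_src, reassoc_of% α₁,
            Category.assoc, reassoc_of% h₁', reassoc_of% φ₁]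
          simpa using e₁
        · rw [Category.assoc, Category.assoc, ← Hom.onArr_tgt, ← Hom.onArr_src, reassoc_of% α₂,
            Category.assoc, reassoc_of% h₂', reassoc_of% φ₂, c₂])
      (by
        apply hB₀.hom_ext
        · rw [Category.assoc, Category.assoc, Category.assoc, ← Hom.onArr_tgt, ← Hom.onArr_src,
            reassoc_of% β₁, reassoc_of% h₁', reassoc_of% φ₁]
          simpa using e₂
        · rw [Category.assoc, Category.assoc, Category.assoc, ← Hom.onArr_tgt, ← Hom.onArr_src,
            reassoc_of% β₂, reassoc_of% h₂', reassoc_of% φ₂, c₁])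
    refine ⟨s, hR.hom_ext _ _ ?_ ?_ ?_, ?_⟩
    · rw [Category.assoc, hl, reassoc_of% s₁, α₁]
    · rw [Category.assoc, ht, reassoc_of% s₂, φ₁]
    · rw [Category.assoc, hr, reassoc_of% s₃, β₁]
    · rw [expand]
      exact cmp_congr _ (cmp_congr _ (by rw [reassoc_of% s₁, α₂]) (by rw [reassoc_of% s₂, φ₂]) _)
        (by rw [reassoc_of% s₃, β₂]) _
  · intro S s s' hs hs'
    have fl : (s ≫ l') ≫ Hom.onArr pB = (s' ≫ l') ≫ Hom.onArr pB := by
      rw [Category.assoc, Category.assoc, ← hl, reassoc_of% hs]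
    have fr : (s ≫ r') ≫ Hom.onArr pB = (s' ≫ r') ≫ Hom.onArr pB := by
      rw [Category.assoc, Category.assoc, ← hr, reassoc_of% hs]
    have ft : (s ≫ t') ≫ Hom.onArr pA = (s' ≫ t') ≫ Hom.onArr pA := by
      rw [Category.assoc, Category.assoc, ← ht, reassoc_of% hs]
    have gl : (s ≫ l' ≫ Hom.onArr b) ≫ Hom.onArr p = (s' ≫ l' ≫ Hom.onArr b) ≫ Hom.onArr p := by
      simp only [Category.assoc, ← hB.w]
      simpa using congrArg (· ≫ Hom.onArr K) fl
    have gr : (s ≫ r' ≫ Hom.onArr b) ≫ Hom.onArr p = (s' ≫ r' ≫ Hom.onArr b) ≫ Hom.onArr p := by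
      simp only [Category.assoc, ← hB.w]
      simpa using congrArg (· ≫ Hom.onArr K) fr
    have gt : (s ≫ t' ≫ Hom.onArr a) ≫ Hom.onArr p = (s' ≫ t' ≫ Hom.onArr a) ≫ Hom.onArr p := by
      simp only [Category.assoc, ← hA.w]
      simpa using congrArg (· ≫ Hom.onArr (F ≫ K)) ft
    rw [expand, expand] at hs'
    obtain ⟨k₁₂, k₃⟩ := hp.lift_unique
      (by rw [Hom.cmp_onArr, Hom.cmp_onArr]; exact cmp_congr _ gl gt _) gr hs'
    obtain ⟨k₁, k₂⟩ := hp.lift_unique gl gt k₁₂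
    refine hR'.hom_ext _ _ (hB.hom_ext fl ?_) (hA.hom_ext ft ?_) (hB.hom_ext fr ?_)
    · simpa using k₁
    · simpa using k₂
    · simpa using k₃

variable (E) in
/-- By `isCoeq_of_isCoequalizer₂` the coequaliser of functors that agree on objects is described on
arrows by a coequaliser in `E`. Its domain is an object of triples, so by `isPullback_triple` the
pulled back diagram is, on arrows, a pullback of that coequaliser, and stability in `E` applies. -/
lemma conducheStableCoequalizers (hE : HasPullbackStableCoequalizers E) :
    ConducheStableCoequalizers E := by
  intro A B C X Y F G Q h₀ hQ c p hp A' B' C' pA a pB b pC c' F' G' Q' hA hB hC hF₁ hF₂ hG₁ hG₂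
    hQ₁ hQ₂
  rw [isPullback₂_iff] at hA hB hC
  obtain ⟨R, l, t, r, hR⟩ := exists_isTriple B (Hom.onArr F)
  obtain ⟨R', l', t', r', hR'⟩ := exists_isTriple B' (Hom.onArr F')
  obtain ⟨iQ, cQ⟩ := isCoeq_of_isCoequalizer₂ hE h₀ hQ hR
  have h₀' : Hom.onObj F' = Hom.onObj G' := by
    apply hB.1.hom_ext
    · change Hom.onObj (F' ≫ pB) = Hom.onObj (G' ≫ pB)
      rw [hF₁, hG₁, onObj_comp, onObj_comp, h₀]
    · change Hom.onObj (F' ≫ b) = Hom.onObj (G' ≫ b)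
      rw [hF₂, hG₂]
  have hQ₁₀ : Hom.onObj Q' ≫ Hom.onObj pC = Hom.onObj pB ≫ Hom.onObj Q := congrArg Hom.onObj hQ₁
  have hQ₂₀ : Hom.onObj Q' ≫ Hom.onObj c' = Hom.onObj b := congrArg Hom.onObj hQ₂
  have hF₁' : Hom.onArr F' ≫ Hom.onArr pB = Hom.onArr pA ≫ Hom.onArr F := congrArg Hom.onArr hF₁
  have hF₂' : Hom.onArr F' ≫ Hom.onArr b = Hom.onArr a := congrArg Hom.onArr hF₂
  have hG₁' : Hom.onArr G' ≫ Hom.onArr pB = Hom.onArr pA ≫ Hom.onArr G := congrArg Hom.onArr hG₁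
  have hG₂' : Hom.onArr G' ≫ Hom.onArr b = Hom.onArr a := congrArg Hom.onArr hG₂
  have iQ' : IsIso (Hom.onObj Q') := by
    have sq : IsPullback (Hom.onObj Q') (Hom.onObj pB) (Hom.onObj pC) (Hom.onObj Q) :=
      IsPullback.of_right (t := hC.1.flip) (by rw [hQ₂₀]; exact hB.1.flip) hQ₁₀
    exact sq.isIso_fst_of_isIso
  obtain ⟨ρ, hl, ht, hr⟩ := hR.exists_lift (l' ≫ Hom.onArr pB) (t' ≫ Hom.onArr pA)
    (r' ≫ Hom.onArr pB)
    (by rw [Category.assoc _ (Hom.onArr pA), ← hF₁', ← Category.assoc]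
        exact Hom.composable pB hR'.w₁)
    (by rw [Category.assoc _ (Hom.onArr pA), ← hF₁', ← Category.assoc]
        exact Hom.composable pB hR'.w₂)
  have hpb := isPullback_triple hp hA.2 hB.1 hB.2 hF₁ hF₂ hR hR' hl ht hr
  have comp {F F' : _} (hF₁' : Hom.onArr F' ≫ Hom.onArr pB = Hom.onArr pA ≫ Hom.onArr F)
      (hR : IsTriple B (Hom.onArr F) l t r) (hR' : IsTriple B' (Hom.onArr F') l' t' r') :
      hR'.cmp₃ ≫ Hom.onArr pB = ρ ≫ hR.cmp₃ := by
    rw [hR.comp_cmp₃, IsTriple.cmp₃, Hom.cmp_onArr]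
    exact (cmp_congr _ ((cmp_congr _ hl (by rw [reassoc_of% ht, Category.assoc, hF₁']) _).trans
      (Hom.cmp_onArr _ _ _ _).symm) hr _).symm
  have hG := hR.of_parallel (onArr_src_eq h₀) (onArr_tgt_eq h₀)
  have hG' := hR'.of_parallel (onArr_src_eq h₀') (onArr_tgt_eq h₀')
  have hb : hG'.cmp₃ ≫ Hom.onArr b = hR'.cmp₃ ≫ Hom.onArr b := by
    simp only [IsTriple.cmp₃, Hom.cmp_onArr]
    exact cmp_congr _ (cmp_congr _ rfl (by simp only [Category.assoc, hF₂', hG₂']) _) rfl _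
  have hw : hR'.cmp₃ ≫ Hom.onArr Q' = hG'.cmp₃ ≫ Hom.onArr Q' := by
    have e₁ : Hom.onArr Q' ≫ Hom.onArr pC = Hom.onArr pB ≫ Hom.onArr Q := congrArg Hom.onArr hQ₁
    have e₂ : Hom.onArr Q' ≫ Hom.onArr c' = Hom.onArr b := congrArg Hom.onArr hQ₂
    apply hC.2.hom_ext
    · rw [Category.assoc, Category.assoc, e₁, reassoc_of% comp hF₁' hR hR',
        reassoc_of% comp hG₁' hG hG', cQ.w]
    · rw [Category.assoc, Category.assoc, e₂, hb]
  refine isCoequalizer₂_of_isCoeq hE h₀' hR' ⟨hw, ?_⟩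
  exact hE.2 _ _ _ cQ.w cQ.choose_spec (Hom.onArr c) (Hom.onArr p) ρ (hR'.cmp₃ ≫ Hom.onArr b)
    (Hom.onArr pB) (Hom.onArr b) (Hom.onArr pC) (Hom.onArr c') hR'.cmp₃ hG'.cmp₃ (Hom.onArr Q') hw
    hpb hB.2 hC.2 (comp hF₁' hR hR') rfl (comp hG₁' hG hG') hb (congrArg Hom.onArr hQ₁)
    (congrArg Hom.onArr hQ₂)

end InternalCat

/-! ### Free internal categories and quotients by arbitrary relations -/

namespace ExtensiveLemmas

/-- In the presence of coproducts, two parallel pairs with the same codomain may be replaced by a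
single one with the same coequalising morphisms. -/
lemma exists_pair_iff {E : Type u} [Category.{v} E] [HasBinaryCoproducts E] {T T' Z : E}
    (p q : T ⟶ Z) (p' q' : T' ⟶ Z) : ∃ (S : E) (a b : S ⟶ Z), ∀ {W : E} (f : Z ⟶ W),
      a ≫ f = b ≫ f ↔ p ≫ f = q ≫ f ∧ p' ≫ f = q' ≫ f := by
  obtain ⟨S, i, j, h⟩ := IsCoprod.exists_isCoprod T T'
  obtain ⟨a, ha, ha'⟩ := h.exists_desc p p'
  obtain ⟨b, hb, hb'⟩ := h.exists_desc q q'
  refine ⟨S, a, b, fun f => ⟨fun e => ⟨?_, ?_⟩, fun e => h.hom_ext ?_ ?_⟩⟩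
  · rw [← ha, ← hb, Category.assoc, e, Category.assoc]
  · rw [← ha', ← hb', Category.assoc, e, Category.assoc]
  · rw [reassoc_of% ha, reassoc_of% hb, e.1]
  · rw [reassoc_of% ha', reassoc_of% hb', e.2]

end ExtensiveLemmas

namespace InternalCat
open StableCoequalizer ExtensiveLemmas
variable {E : Type u} [Category.{v} E] [HasPullbacks E]

section Free

/-- The free internal category on a graph, with its universal property unfolded. -/
lemma exists_freeCat (hU : (forgetToGraph E).IsRightAdjoint) {G₀ G₁ : E} (s t : G₁ ⟶ G₀) :
    ∃ (L : InternalCat E) (η₀ : G₀ ⟶ L.obj) (η₁ : G₁ ⟶ L.arr),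
      (η₁ ≫ L.src = s ≫ η₀ ∧ η₁ ≫ L.tgt = t ≫ η₀) ∧
      ∀ {X : InternalCat E} (x₀ : G₀ ⟶ X.obj) (x₁ : G₁ ⟶ X.arr), x₁ ≫ X.src = s ≫ x₀ →
        x₁ ≫ X.tgt = t ≫ x₀ → ∃! H : L ⟶ X, η₀ ≫ Hom.onObj H = x₀ ∧ η₁ ≫ Hom.onArr H = x₁ := by
  obtain ⟨F, ⟨adj⟩⟩ := hU.exists_leftAdjoint
  let G : InternalGraph E := ⟨G₀, G₁, s, t⟩
  let η : G ⟶ (forgetToGraph E).obj (F.obj G) := adj.unit.app G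
  refine ⟨F.obj G, InternalGraph.Hom.onObj η, InternalGraph.Hom.onArr η,
    ⟨InternalGraph.Hom.onArr_src η, InternalGraph.Hom.onArr_tgt η⟩, fun {X} x₀ x₁ hs ht => ?_⟩
  let x : G ⟶ (forgetToGraph E).obj X := InternalGraph.Hom.mk x₀ x₁ hs ht
  have key (H : F.obj G ⟶ X) : (InternalGraph.Hom.onObj η ≫ Hom.onObj H = x₀ ∧
      InternalGraph.Hom.onArr η ≫ Hom.onArr H = x₁) ↔ adj.homEquiv G X H = x := by
    rw [adj.homEquiv_unit]
    exact ⟨fun h => InternalGraph.Hom.ext h.1 h.2, fun h =>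
      ⟨congrArg InternalGraph.Hom.onObj h, congrArg InternalGraph.Hom.onArr h⟩⟩
  exact ⟨(adj.homEquiv G X).symm x, (key _).2 (Equiv.apply_symm_apply _ _), fun H hH =>
    ((Equiv.symm_apply_eq _).2 ((key H).1 hH).symm).symm⟩

/-- The free internal category on a family of arrows indexed by `T`. -/
lemma exists_freeArrow [FinitaryExtensive E] (hU : (forgetToGraph E).IsRightAdjoint) (T : E) :
    ∃ (L : InternalCat E) (η : T ⟶ L.arr), ∀ {X : InternalCat E} (x : T ⟶ X.arr),
      ∃! H : L ⟶ X, η ≫ Hom.onArr H = x := by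
  obtain ⟨P, i, j, hP⟩ := IsCoprod.exists_isCoprod T T
  obtain ⟨L, η₀, η₁, ⟨hs, ht⟩, h⟩ := exists_freeCat hU i j
  refine ⟨L, η₁, fun {X} x => ?_⟩
  obtain ⟨x₀, h₁, h₂⟩ := hP.exists_desc (x ≫ X.src) (x ≫ X.tgt)
  obtain ⟨H, hH, hu⟩ := h x₀ x h₁.symm h₂.symm
  refine ⟨H, hH.2, fun H' hH' => hu _ ⟨hP.hom_ext ?_ ?_, hH'⟩⟩
  · rw [← reassoc_of% hs, ← Hom.onArr_src, reassoc_of% hH', h₁]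
  · rw [← reassoc_of% ht, ← Hom.onArr_tgt, reassoc_of% hH', h₂]

end Free

section Equational
variable {R : InternalCat E}

/-- A property of the functors out of `R` which says that certain parallel pairs of generalised
arrows of `R` acquire the same image; finitely many such conditions amount to a single one, given
by a pair of morphisms into the object of arrows. -/
def IsEquational (R : InternalCat E) (Φ : ∀ X : InternalCat E, (R ⟶ X) → Prop) : Prop :=
  ∃ (T : E) (p q : T ⟶ R.arr), ∀ (X : InternalCat E) (H : R ⟶ X),
    Φ X H ↔ p ≫ Hom.onArr H = q ≫ Hom.onArr H

namespace IsEquational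

lemma congr {Φ Ψ : ∀ X : InternalCat E, (R ⟶ X) → Prop} (h : IsEquational R Φ)
    (e : ∀ X H, Φ X H ↔ Ψ X H) : IsEquational R Ψ := by
  obtain ⟨T, p, q, h⟩ := h
  exact ⟨T, p, q, fun X H => (e X H).symm.trans (h X H)⟩

lemma eqArr {T : E} (p q : T ⟶ R.arr) :
    IsEquational R fun _ H => p ≫ Hom.onArr H = q ≫ Hom.onArr H :=
  ⟨T, p, q, fun _ _ => Iff.rfl⟩

lemma eqObj {T : E} (x y : T ⟶ R.obj) :
    IsEquational R fun _ H => x ≫ Hom.onObj H = y ≫ Hom.onObj H := by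
  refine ⟨T, x ≫ R.ident, y ≫ R.ident, fun X H => ?_⟩
  have hX := X.ident_src
  have : Mono X.ident := mono_of_mono_fac hX
  simp only [Category.assoc, Hom.ident_onArr]
  rw [← Category.assoc, ← Category.assoc y]
  exact (cancel_mono X.ident).symm

lemma eqHom {A : InternalCat E} (F G : A ⟶ R) : IsEquational R fun _ H => F ≫ H = G ≫ H :=
  ⟨A.arr, Hom.onArr F, Hom.onArr G,
    fun _ _ => ⟨fun h => congrArg Hom.onArr h, fun h => hom_ext_arr h⟩⟩

lemma forall_finite [HasFiniteCoproducts E] {ι : Type} [Finite ι]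
    {Φ : ι → ∀ X : InternalCat E, (R ⟶ X) → Prop} (h : ∀ i, IsEquational R (Φ i)) :
    IsEquational R fun X H => ∀ i, Φ i X H := by
  choose T p q h using h
  refine ⟨∐ T, Sigma.desc p, Sigma.desc q, fun X H => ?_⟩
  simp only [h]
  refine ⟨fun e => Sigma.hom_ext _ _ fun i => by simpa using e i, fun e i => ?_⟩
  simpa using congrArg (Sigma.ι T i ≫ ·) e

lemma and [HasFiniteCoproducts E] {Φ Ψ : ∀ X : InternalCat E, (R ⟶ X) → Prop}
    (h : IsEquational R Φ) (h' : IsEquational R Ψ) :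
    IsEquational R fun X H => Φ X H ∧ Ψ X H := by
  obtain ⟨T, p, q, h⟩ := h
  obtain ⟨T', p', q', h'⟩ := h'
  obtain ⟨S, a, b, hS⟩ := exists_pair_iff p q p' q'
  exact ⟨S, a, b, fun X H => (and_congr (h X H) (h' X H)).trans (hS _).symm⟩

variable [FinitaryExtensive E] (hE : HasPullbackStableCoequalizers E)
  (hU : (forgetToGraph E).IsRightAdjoint)
include hE hU

/-- Equational conditions have universal solutions. The objects are identified first; the free
category on the resulting graph then turns all remaining relations, among them those which say that
the arrows of `R` are composed as in `R`, into relations between parallel arrows. -/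
lemma exists_quotient {Φ : ∀ X : InternalCat E, (R ⟶ X) → Prop} (h : IsEquational R Φ) :
    ∃ (C : InternalCat E) (π : R ⟶ C), Φ C π ∧
      ∀ {X : InternalCat E} (H : R ⟶ X), Φ X H → ∃! H' : C ⟶ X, π ≫ H' = H := by
  obtain ⟨T, p, q, h⟩ := h
  simp only [h]
  clear h Φ
  have := hE.1
  obtain ⟨S, a, b, hab⟩ := exists_pair_iff (p ≫ R.src) (q ≫ R.src) (p ≫ R.tgt) (q ≫ R.tgt)
  obtain ⟨C₀, c, hc⟩ := IsCoeq.exists_isCoeq a b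
  obtain ⟨hcs, hct⟩ := (hab c).1 hc.w
  simp only [Category.assoc] at hcs hct
  obtain ⟨L, η₀, η₁, ⟨hs, ht⟩, hL⟩ := exists_freeCat hU (R.src ≫ c) (R.tgt ≫ c)
  rw [Category.assoc] at hs ht
  have hcomp : (pullback.fst R.tgt R.src ≫ η₁) ≫ L.tgt =
      (pullback.snd R.tgt R.src ≫ η₁) ≫ L.src := by
    rw [Category.assoc, Category.assoc, hs, ht, pullback.condition_assoc]
  have hi := R.ident_src
  have hi' := R.ident_tgt
  have hk := R.comp_src
  have hk' := R.comp_tgt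
  obtain ⟨S', a', b', hab'⟩ := exists_pair_iff (R.comp ≫ η₁) (L.cmp _ _ hcomp) (p ≫ η₁) (q ≫ η₁)
  obtain ⟨S'', a'', b'', rel⟩ := exists_pair_iff (R.ident ≫ η₁) (c ≫ η₀ ≫ L.ident) a' b'
  simp only [hab', Category.assoc] at rel
  obtain ⟨C, Q, -, hQ, hCu⟩ := exists_parallelQuotient hE L a'' b''
    ((rel _).2 ⟨by rw [hs, reassoc_of% hi, L.ident_src, Category.comp_id],
      by rw [hs, reassoc_of% hk, cmp_src, Category.assoc, hs], by rw [hs, reassoc_of% hcs]⟩)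
    ((rel _).2 ⟨by rw [ht, reassoc_of% hi', L.ident_tgt, Category.comp_id],
      by rw [ht, reassoc_of% hk', cmp_tgt, Category.assoc, ht], by rw [ht, reassoc_of% hct]⟩)
  obtain ⟨q₁, q₂, q₃⟩ := (rel _).1 hQ
  have hcepi := hc.epi
  let π : R ⟶ C := Hom.mk (A := R) (B := C) (c ≫ η₀ ≫ Hom.onObj Q) (η₁ ≫ Hom.onArr Q)
    (by rw [Category.assoc, Hom.onArr_src, reassoc_of% hs])
    (by rw [Category.assoc, Hom.onArr_tgt, reassoc_of% ht])
    (by rw [← Category.assoc, Category.assoc, q₁, Hom.ident_onArr]; simp only [Category.assoc])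
    (by
      rw [q₂, Hom.cmp_onArr, cmp]
      simp only [Category.assoc])
  refine ⟨C, π, q₃, fun {X} H hH => ?_⟩
  obtain ⟨x₀, hx₀⟩ := hc.exists_desc (Hom.onObj H) ((hab _).2 ⟨
    by simpa [← Hom.onArr_src] using congrArg (· ≫ X.src) hH,
    by simpa [← Hom.onArr_tgt] using congrArg (· ≫ X.tgt) hH⟩)
  obtain ⟨K, ⟨hK₀, hK₁⟩, hKu⟩ := hL x₀ (Hom.onArr H)
    (by rw [Hom.onArr_src, Category.assoc, hx₀]) (by rw [Hom.onArr_tgt, Category.assoc, hx₀])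
  obtain ⟨H', hH', hu⟩ := hCu K ((rel _).2 ⟨by
      rw [hK₁, Hom.ident_onArr, Hom.ident_onArr, reassoc_of% hK₀, reassoc_of% hx₀],
    by
      rw [hK₁, Hom.cmp_onArr, ← cmp_fst_snd R, Hom.cmp_onArr]
      exact cmp_congr _ (by rw [Category.assoc, hK₁]) (by rw [Category.assoc, hK₁]) _,
    by rw [hK₁, hH]⟩)
  refine ⟨H', hom_ext_arr ?_, fun H'' hH'' => hu _ (hKu _ ⟨?_, ?_⟩)⟩
  · change (η₁ ≫ Hom.onArr Q) ≫ Hom.onArr H' = _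
    rw [Category.assoc, ← onArr_comp, hH', hK₁]
  · rw [← cancel_epi c, hx₀]
    have e : (c ≫ η₀ ≫ Hom.onObj Q) ≫ Hom.onObj H'' = _ := congrArg Hom.onObj hH''
    simpa using e
  · have e : (η₁ ≫ Hom.onArr Q) ≫ Hom.onArr H'' = _ := congrArg Hom.onArr hH''
    simpa using e

end IsEquational
end Equational

section Family
variable [FinitaryExtensive E]

/-- Finite coproducts of internal categories, from the initial object and the binary ones. -/
lemma exists_coproduct_family {ι : Type} [Finite ι] (A : ι → InternalCat E) :
    ∃ (R : InternalCat E) (F : ∀ i, A i ⟶ R), ∀ {X : InternalCat E} (G : ∀ i, A i ⟶ X),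
      ∃! H : R ⟶ X, ∀ i, F i ≫ H = G i := by
  have : HasInitial (InternalCat E) := by
    obtain ⟨I, hI⟩ := exists_initialCat (E := E)
    have (Y : InternalCat E) : Nonempty (I ⟶ Y) := ⟨(hI Y).choose⟩
    have (Y : InternalCat E) : Subsingleton (I ⟶ Y) := ⟨fun a b => (hI Y).unique trivial trivial⟩
    exact hasInitial_of_unique I
  have : HasBinaryCoproducts (InternalCat E) := by
    have (X Y : InternalCat E) : HasColimit (pair X Y) := by
      obtain ⟨P, inl, inr, h⟩ := exists_coprodCat X Y
      obtain ⟨h⟩ := IsCoprod.of_existsUnique (isCoproduct₂_iff.2 h).existsUnique_desc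
      exact ⟨⟨_, h⟩⟩
    exact hasBinaryCoproducts_of_hasColimit_pair _
  have := hasFiniteCoproducts_of_has_binary_and_initial (C := InternalCat E)
  refine ⟨∐ A, Sigma.ι A, fun G => ⟨Sigma.desc G, fun i => Sigma.ι_desc _ _, fun H hH => ?_⟩⟩
  exact Sigma.hom_ext _ _ fun i => (hH i).trans (Sigma.ι_desc _ _).symm

/-- The universal receptacle for finitely many functors and finitely many generalised arrows. -/
lemma exists_universal_family (hU : (forgetToGraph E).IsRightAdjoint) {ι κ : Type} [Finite ι]
    [Finite κ] (A : ι → InternalCat E) (T : κ → E) :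
    ∃ (R : InternalCat E) (F : ∀ i, A i ⟶ R) (t : ∀ k, T k ⟶ R.arr),
      ∀ {X : InternalCat E} (G : ∀ i, A i ⟶ X) (s : ∀ k, T k ⟶ X.arr),
        ∃! H : R ⟶ X, (∀ i, F i ≫ H = G i) ∧ ∀ k, t k ≫ Hom.onArr H = s k := by
  choose L η hL using fun k => exists_freeArrow hU (T k)
  obtain ⟨R, F, hR⟩ := exists_coproduct_family (Sum.elim A L)
  let F' (k : κ) : L k ⟶ R := F (.inr k)
  refine ⟨R, fun i => F (.inl i), fun k => η k ≫ Hom.onArr (F' k), fun {X} G s => ?_⟩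
  choose S hS hSu using fun k => hL k (s k)
  obtain ⟨H, hH, hu⟩ := hR (X := X) (fun z => Sum.rec G S z)
  refine ⟨H, ⟨fun i => hH (.inl i), fun k => ?_⟩, fun H' ⟨h₁, h₂⟩ => hu _ ?_⟩
  · have e : F' k ≫ H = S k := hH (.inr k)
    rw [Category.assoc, ← onArr_comp, e]
    exact hS k
  · rintro (i | k)
    · exact h₁ i
    · exact hSu k _ ((Category.assoc _ _ _).symm.trans (h₂ k))

end Family
end InternalCat

/-! ### Weighted colimits of internal categories -/

namespace InternalCat
open TwoCat
variable {E : Type u} [Category.{v} E] [HasPullbacks E]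

section Weighted
variable {J : Type} [Bicategory.{0, 0} J] (W : StrictPseudofunctor Jᵒᵖ Cat.{0, 0})
  (D : StrictPseudofunctor J (InternalCat E)) {X Y : InternalCat E}

/-- The raw data of a weighted cocone of internal categories: functors for the objects of the
values of the weight, families of arrows for their morphisms. -/
@[ext]
structure CoconeData (X : InternalCat E) where
  leg : ∀ (j : J) (_ : W.obj (op j)), D.obj j ⟶ X
  cell : ∀ (j : J) (x y : W.obj (op j)) (_ : x ⟶ y), (D.obj j).obj ⟶ X.arr

variable {W D}

namespace CoconeData

/-- Composition of the data of a weighted cocone with an internal functor. -/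
noncomputable def map (c : CoconeData W D X) (H : X ⟶ Y) : CoconeData W D Y where
  leg j x := c.leg j x ≫ H
  cell j x y a := c.cell j x y a ≫ Hom.onArr H

lemma map_comp {Z : InternalCat E} (c : CoconeData W D X) (H : X ⟶ Y) (K : Y ⟶ Z) :
    c.map (H ≫ K) = (c.map H).map K := by
  simp only [map, Category.assoc, onArr_comp]

/-- The axioms of a weighted cocone which do not involve the composition of the vertex. -/
structure IsGraphCocone (c : CoconeData W D X) : Prop where
  src : ∀ j x y a, c.cell j x y a ≫ X.src = Hom.onObj (c.leg j x)
  tgt : ∀ j x y a, c.cell j x y a ≫ X.tgt = Hom.onObj (c.leg j y)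
  map_id : ∀ j x, c.cell j x x (𝟙 x) = Hom.onObj (c.leg j x) ≫ X.ident
  naturality : ∀ (j k : J) (f : j ⟶ k) (x : W.obj (op k)),
    c.leg j ((W.map f.op).toFunctor.obj x) = D.map f ≫ c.leg k x
  naturality_map : ∀ (j k : J) (f : j ⟶ k) (x y : W.obj (op k)) (a : x ⟶ y),
    c.cell j _ _ ((W.map f.op).toFunctor.map a) = Hom.onObj (D.map f) ≫ c.cell k x y a
  naturality₂ : ∀ (j k : J) (f g : j ⟶ k) (α : f ⟶ g) (x : W.obj (op k)),
    c.cell j _ _ ((W.map₂ (Bicategory.Opposite.op2 α)).toNatTrans.app x) =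
      NatTrans.app (D.map₂ α) ≫ Hom.onArr (c.leg k x)

/-- The axioms of a weighted cocone of internal categories. -/
structure IsCocone (c : CoconeData W D X) : Prop extends IsGraphCocone c where
  natural : ∀ j x y a, X.cmp (Hom.onArr (c.leg j x)) ((D.obj j).tgt ≫ c.cell j x y a)
      (by rw [Category.assoc, src, Hom.onArr_tgt]) =
    X.cmp ((D.obj j).src ≫ c.cell j x y a) (Hom.onArr (c.leg j y))
      (by rw [Category.assoc, tgt, Hom.onArr_src])
  map_comp : ∀ j x y z a b, c.cell j x z (a ≫ b) = X.cmp (c.cell j x y a) (c.cell j y z b)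
      (by rw [src, tgt])

/-- The weighted cocone with given data. -/
noncomputable def IsCocone.cocone {c : CoconeData W D X} (h : c.IsCocone) :
    WeightedCocone W D X where
  leg j :=
    { obj := c.leg j
      map := fun a => NatTrans.mk (F := c.leg j _) (G := c.leg j _) (c.cell j _ _ a)
        (h.src j _ _ a) (h.tgt j _ _ a) (h.natural j _ _ a)
      map_id := fun x => hom₂_ext (h.map_id j x)
      map_comp := fun a b => hom₂_ext (h.map_comp j _ _ _ a b) }
  naturality f x := h.naturality _ _ f x
  naturality_map f _ _ a := by
    ext
    simpa using h.naturality_map _ _ f _ _ a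
  naturality₂ α x := by
    ext
    simpa using h.naturality₂ _ _ _ _ α x

/-- The data underlying a weighted cocone. -/
def ofCocone (ψ : WeightedCocone W D X) : CoconeData W D X where
  leg j x := (ψ.leg j).obj x
  cell j _ _ a := NatTrans.app ((ψ.leg j).map a)

lemma isCocone_ofCocone (ψ : WeightedCocone W D X) : (ofCocone ψ).IsCocone where
  src j x y a := NatTrans.app_src _
  tgt j x y a := NatTrans.app_tgt _
  map_id j x := by simp [ofCocone]
  naturality j k f x := ψ.naturality f x
  naturality_map j k f x y a := by
    have := congrArg NatTrans.app (ψ.naturality_map f a)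
    simp only [app_eqToHom_comp, app_comp_eqToHom] at this
    exact this
  naturality₂ j k f g α x := by
    have := congrArg NatTrans.app (ψ.naturality₂ α x)
    simp only [app_eqToHom_comp, app_comp_eqToHom] at this
    exact this
  natural j x y a := NatTrans.naturality _
  map_comp j x y z a b := by
    simp only [ofCocone, Functor.map_comp]
    rfl

/-- Equality of weighted cocones is equality of their data; no 2-cells `eqToHom` are involved in the
latter. -/
lemma cocone_comp_eq_iff {c : CoconeData W D X} (h : c.IsCocone) (u : X ⟶ Y)
    (ψ : WeightedCocone W D Y) :
    (∀ j, h.cocone.leg j ⋙ Bicategory.postcomp (D.obj j) u = ψ.leg j) ↔ c.map u = ofCocone ψ := by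
  constructor
  · intro e
    refine CoconeData.ext ?_ ?_
    · funext j x
      exact Functor.congr_obj (e j) x
    · funext j x y a
      have := congrArg NatTrans.app (Functor.congr_hom (e j) a)
      simp only [app_eqToHom_comp, app_comp_eqToHom] at this
      exact this
  · intro e j
    have e₁ (x) : c.leg j x ≫ u = (ψ.leg j).obj x := congrFun (congrFun (congrArg leg e) j) x
    have e₂ (x y a) : c.cell j x y a ≫ Hom.onArr u = NatTrans.app ((ψ.leg j).map a) :=
      congrFun (congrFun (congrFun (congrFun (congrArg cell e) j) x) y) a
    refine CategoryTheory.Functor.ext e₁ fun x y a => ?_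
    exact hom₂_ext ((e₂ x y a).trans
      ((app_eqToHom_comp _ _).trans (app_comp_eqToHom _ _)).symm)

lemma IsGraphCocone.map {c : CoconeData W D X} (h : c.IsGraphCocone) (H : X ⟶ Y) :
    (c.map H).IsGraphCocone where
  src j x y a := by
    have := h.src j x y a
    simp only [CoconeData.map, Category.assoc, Hom.onArr_src, onObj_comp, reassoc_of% this]
  tgt j x y a := by
    have := h.tgt j x y a
    simp only [CoconeData.map, Category.assoc, Hom.onArr_tgt, onObj_comp, reassoc_of% this]
  map_id j x := by
    have := h.map_id j x
    simp only [CoconeData.map, this, Category.assoc, Hom.ident_onArr, onObj_comp]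
  naturality j k f x := by
    simp only [CoconeData.map, h.naturality, Category.assoc]
  naturality_map j k f x y a := by
    simp only [CoconeData.map, h.naturality_map, Category.assoc]
  naturality₂ j k f g α x := by
    simp only [CoconeData.map, h.naturality₂, Category.assoc, onArr_comp]

lemma IsCocone.map {c : CoconeData W D X} (h : c.IsCocone) (H : X ⟶ Y) : (c.map H).IsCocone where
  toIsGraphCocone := h.toIsGraphCocone.map H
  natural j x y a := by
    have e := congrArg (· ≫ Hom.onArr H) (h.natural j x y a)
    simp only [Hom.cmp_onArr] at e
    exact (cmp_congr _ rfl (Category.assoc _ _ _).symm _).trans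
      (e.trans (cmp_congr _ (Category.assoc _ _ _) rfl _))
  map_comp j x y z a b := by
    have e := congrArg (· ≫ Hom.onArr H) (h.map_comp j x y z a b)
    simp only [Hom.cmp_onArr] at e
    exact e

/-- Weighted cocones with vertex the arrow category of `X` amount to two cocones with vertex `X`
and a modification between them. -/
lemma isCocone_arrowCat {c : CoconeData W D X.arrowCat} (hd : (c.map X.arrowDom).IsCocone)
    (hc : (c.map X.arrowCod).IsCocone)
    (hs : ∀ j x y a, c.cell j x y a ≫ X.arrowCat.src = Hom.onObj (c.leg j x))
    (ht : ∀ j x y a, c.cell j x y a ≫ X.arrowCat.tgt = Hom.onObj (c.leg j y))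
    (hn : ∀ (j k : J) (f : j ⟶ k) (x : W.obj (op k)),
      Hom.onObj (c.leg j ((W.map f.op).toFunctor.obj x)) =
        Hom.onObj (D.map f) ≫ Hom.onObj (c.leg k x)) : c.IsCocone where
  src := hs
  tgt := ht
  map_id j x := by
    refine arrowCat_arr_ext ((hd.map_id j x).trans ?_) ((hc.map_id j x).trans ?_) ?_ ?_
    · rw [Category.assoc, Hom.ident_onArr]
      exact Category.assoc _ _ _
    · rw [Category.assoc, Hom.ident_onArr]
      exact Category.assoc _ _ _
    · rw [hs, Category.assoc, ident_src, Category.comp_id]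
    · rw [ht, Category.assoc, ident_tgt, Category.comp_id]
  naturality j k f x := by
    refine arrowCat_hom_ext ((hd.naturality j k f x).trans ?_) ((hc.naturality j k f x).trans ?_)
      (hn j k f x)
    · exact (Category.assoc _ _ _).symm
    · exact (Category.assoc _ _ _).symm
  naturality_map j k f x y a := by
    refine arrowCat_arr_ext ((hd.naturality_map j k f x y a).trans ?_)
      ((hc.naturality_map j k f x y a).trans ?_) ?_ ?_
    · exact (Category.assoc _ _ _).symm
    · exact (Category.assoc _ _ _).symm
    · rw [hs, Category.assoc, hs, hn]
    · rw [ht, Category.assoc, ht, hn]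
  naturality₂ j k f g α x := by
    refine arrowCat_arr_ext ((hd.naturality₂ j k f g α x).trans ?_)
      ((hc.naturality₂ j k f g α x).trans ?_) ?_ ?_
    · exact (Category.assoc _ _ _).symm
    · exact (Category.assoc _ _ _).symm
    · rw [hs, Category.assoc, Hom.onArr_src, ← Category.assoc, NatTrans.app_src, hn]
    · rw [ht, Category.assoc, Hom.onArr_tgt, ← Category.assoc, NatTrans.app_tgt, hn]
  natural j x y a := by
    apply arrowCat_arr_ext
    · rw [Hom.cmp_onArr, Hom.cmp_onArr]
      exact (cmp_congr _ rfl (Category.assoc _ _ _) _).trans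
        ((hd.natural j x y a).trans (cmp_congr _ (Category.assoc _ _ _).symm rfl _))
    · rw [Hom.cmp_onArr, Hom.cmp_onArr]
      exact (cmp_congr _ rfl (Category.assoc _ _ _) _).trans
        ((hc.natural j x y a).trans (cmp_congr _ (Category.assoc _ _ _).symm rfl _))
    · rw [cmp_src, cmp_src, Category.assoc, hs, Hom.onArr_src]
    · rw [cmp_tgt, cmp_tgt, Category.assoc, ht, Hom.onArr_tgt]
  map_comp j x y z a b := by
    apply arrowCat_arr_ext
    · rw [Hom.cmp_onArr]
      exact hd.map_comp j x y z a b
    · rw [Hom.cmp_onArr]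
      exact hc.map_comp j x y z a b
    · rw [cmp_src, hs, hs]
    · rw [cmp_tgt, ht, ht]

/-- The two-dimensional universal property of a weighted colimit follows from the one-dimensional
one, applied to cocones whose vertex is an arrow category. -/
lemma isWeightedColimit {C : InternalCat E} {c : CoconeData W D C} (h : c.IsCocone)
    (hu : ∀ {X : InternalCat E} (c' : CoconeData W D X), c'.IsCocone → ∃! u : C ⟶ X, c.map u = c') :
    IsWeightedColimit h.cocone where
  existsUnique_desc ψ := by
    simp only [cocone_comp_eq_iff]
    exact hu _ (isCocone_ofCocone ψ)
  existsUnique_desc₂ {X} u v μ hμ := by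
    have hcancel {Z : InternalCat E} {s t : C ⟶ Z} (e : c.map s = c.map t) : s = t :=
      (hu _ (h.map t)).unique e rfl
    let m (j) (x : W.obj (op j)) : c.leg j x ≫ u ⟶ c.leg j x ≫ v := (μ j).app x
    have hm (j) (x y : W.obj (op j)) (a : x ⟶ y) :
        X.cmp (c.cell j x y a ≫ Hom.onArr u) (NatTrans.app (m j y))
            (by rw [Category.assoc, Hom.onArr_tgt, ← Category.assoc, h.tgt, NatTrans.app_src]; rfl) =
          X.cmp (NatTrans.app (m j x)) (c.cell j x y a ≫ Hom.onArr v)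
            (by rw [Category.assoc, Hom.onArr_src, ← Category.assoc, h.src, NatTrans.app_tgt]; rfl) :=
      congrArg NatTrans.app ((μ j).naturality a)
    have hn (j k : J) (f : j ⟶ k) (x : W.obj (op k)) :
        NatTrans.app (m j ((W.map f.op).toFunctor.obj x)) =
          Hom.onObj (D.map f) ≫ NatTrans.app (m k x) := by
      have := congrArg NatTrans.app (hμ f x)
      simp only [app_eqToHom_comp, app_comp_eqToHom] at this
      exact this
    let c' : CoconeData W D X.arrowCat :=
      { leg := fun j x => toArrow (m j x)
        cell := fun j x y a => X.sq _ _ _ _ _ _ (hm j x y a) }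
    have hd : c'.map X.arrowDom = c.map u := by
      refine CoconeData.ext ?_ ?_
      · funext j x
        exact toArrow_dom (m j x)
      · funext j x y a
        exact X.sq_top _ _ _ _ _ _ (hm j x y a)
    have hc : c'.map X.arrowCod = c.map v := by
      refine CoconeData.ext ?_ ?_
      · funext j x
        exact toArrow_cod (m j x)
      · funext j x y a
        exact X.sq_bot _ _ _ _ _ _ (hm j x y a)
    obtain ⟨K, hK, hKu⟩ := hu c' (isCocone_arrowCat (hd ▸ h.map u) (hc ▸ h.map v)
      (fun j x y a => X.sq_left _ _ _ _ _ _ (hm j x y a))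
      (fun j x y a => X.sq_right _ _ _ _ _ _ (hm j x y a)) hn)
    refine ⟨ofArrow K (hcancel (by rw [map_comp, hK, hd])) (hcancel (by rw [map_comp, hK, hc])),
      fun j x => hom₂_ext ?_, fun γ hγ => hom₂_ext ?_⟩
    · exact congrArg Hom.onObj (congrFun (congrFun (congrArg leg hK) j) x)
    · have hγ' (j) (x : W.obj (op j)) :
          Hom.onObj (c.leg j x) ≫ NatTrans.app γ = NatTrans.app (m j x) :=
        congrArg NatTrans.app (hγ j x)
      have e : toArrow γ = K := by
        refine hKu _ (CoconeData.ext ?_ ?_)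
        · funext j x
          refine arrowCat_hom_ext ?_ ?_ (hγ' j x)
          · refine Eq.trans ?_ (toArrow_dom (m j x)).symm
            exact (Category.assoc _ _ _).trans (by rw [toArrow_dom])
          · refine Eq.trans ?_ (toArrow_cod (m j x)).symm
            exact (Category.assoc _ _ _).trans (by rw [toArrow_cod])
        · funext j x y a
          refine arrowCat_arr_ext ?_ ?_ ?_ ?_
          · refine Eq.trans ?_ (X.sq_top _ _ _ _ _ _ (hm j x y a)).symm
            refine (Category.assoc _ _ _).trans ?_
            rw [← onArr_comp, toArrow_dom]
          · refine Eq.trans ?_ (X.sq_bot _ _ _ _ _ _ (hm j x y a)).symm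
            refine (Category.assoc _ _ _).trans ?_
            rw [← onArr_comp, toArrow_cod]
          · refine Eq.trans ?_ (X.sq_left _ _ _ _ _ _ (hm j x y a)).symm
            refine (Category.assoc _ _ _).trans ?_
            rw [Hom.onArr_src, ← Category.assoc, h.src]
            exact hγ' j x
          · refine Eq.trans ?_ (X.sq_right _ _ _ _ _ _ (hm j x y a)).symm
            refine (Category.assoc _ _ _).trans ?_
            rw [Hom.onArr_tgt, ← Category.assoc, h.tgt]
            exact hγ' j y
      rw [ofArrow_app, ← e, toArrow_onObj]

section Equational
variable [HasFiniteCoproducts E] [Finite J] [∀ j : J, FinCategory (W.obj (op j))]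

/-- The axioms of a graph cocone are finitely many equations, so they can be imposed universally. -/
lemma isEquational_isGraphCocone [∀ j k : J, FinCategory (j ⟶ k)] (c : CoconeData W D X) :
    IsEquational X fun _ H => (c.map H).IsGraphCocone := by
  have h₁ : IsEquational X fun _ H => ∀ j x y a,
      (c.cell j x y a ≫ X.src) ≫ Hom.onObj H = Hom.onObj (c.leg j x) ≫ Hom.onObj H :=
    .forall_finite fun j => .forall_finite fun x => .forall_finite fun y => .forall_finite fun a =>
      .eqObj _ _
  have h₂ : IsEquational X fun _ H => ∀ j x y a,
      (c.cell j x y a ≫ X.tgt) ≫ Hom.onObj H = Hom.onObj (c.leg j y) ≫ Hom.onObj H :=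
    .forall_finite fun j => .forall_finite fun x => .forall_finite fun y => .forall_finite fun a =>
      .eqObj _ _
  have h₃ : IsEquational X fun _ H => ∀ j x,
      c.cell j x x (𝟙 x) ≫ Hom.onArr H = (Hom.onObj (c.leg j x) ≫ X.ident) ≫ Hom.onArr H :=
    .forall_finite fun j => .forall_finite fun x => .eqArr _ _
  have h₄ : IsEquational X fun _ H => ∀ (j k : J) (f : j ⟶ k) (x : W.obj (op k)),
      c.leg j ((W.map f.op).toFunctor.obj x) ≫ H = (D.map f ≫ c.leg k x) ≫ H :=
    .forall_finite fun j => .forall_finite fun k => .forall_finite fun f => .forall_finite fun x =>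
      .eqHom _ _
  have h₅ : IsEquational X fun _ H => ∀ (j k : J) (f : j ⟶ k) (x y : W.obj (op k)) (a : x ⟶ y),
      c.cell j _ _ ((W.map f.op).toFunctor.map a) ≫ Hom.onArr H =
        (Hom.onObj (D.map f) ≫ c.cell k x y a) ≫ Hom.onArr H :=
    .forall_finite fun j => .forall_finite fun k => .forall_finite fun f => .forall_finite fun x =>
      .forall_finite fun y => .forall_finite fun a => .eqArr _ _
  have h₆ : IsEquational X fun _ H => ∀ (j k : J) (f g : j ⟶ k) (α : f ⟶ g) (x : W.obj (op k)),
      c.cell j _ _ ((W.map₂ (Bicategory.Opposite.op2 α)).toNatTrans.app x) ≫ Hom.onArr H =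
        (NatTrans.app (D.map₂ α) ≫ Hom.onArr (c.leg k x)) ≫ Hom.onArr H :=
    .forall_finite fun j => .forall_finite fun k => .forall_finite fun f => .forall_finite fun g =>
      .forall_finite fun α => .forall_finite fun x => .eqArr _ _
  refine (h₁.and (h₂.and (h₃.and (h₄.and (h₅.and h₆))))).congr fun Y H => ⟨?_, fun h => ?_⟩
  · rintro ⟨h₁, h₂, h₃, h₄, h₅, h₆⟩
    simp only [Category.assoc, Hom.ident_onArr] at h₁ h₂ h₃ h₄ h₅ h₆
    constructor
    all_goals intros; simp only [map, Category.assoc, Hom.onArr_src, Hom.onArr_tgt, onObj_comp,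
      onArr_comp, *]
  · obtain ⟨h₁, h₂, h₃, h₄, h₅, h₆⟩ := h
    simp only [map, Category.assoc, Hom.onArr_src, Hom.onArr_tgt, onObj_comp,
      onArr_comp] at h₁ h₂ h₃ h₄ h₅ h₆
    simp only [Category.assoc, Hom.ident_onArr]
    exact ⟨h₁, h₂, h₃, h₄, h₅, h₆⟩

lemma isEquational_isCocone {c : CoconeData W D X} (h : c.IsGraphCocone) :
    IsEquational X fun _ H => (c.map H).IsCocone := by
  have h₁ : IsEquational X fun _ H => ∀ j x y a,
      X.cmp (Hom.onArr (c.leg j x)) ((D.obj j).tgt ≫ c.cell j x y a)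
        (by rw [Category.assoc, h.src, Hom.onArr_tgt]) ≫ Hom.onArr H =
      X.cmp ((D.obj j).src ≫ c.cell j x y a) (Hom.onArr (c.leg j y))
        (by rw [Category.assoc, h.tgt, Hom.onArr_src]) ≫ Hom.onArr H :=
    .forall_finite fun j => .forall_finite fun x => .forall_finite fun y => .forall_finite fun a =>
      .eqArr _ _
  have h₂ : IsEquational X fun _ H => ∀ j x y z a b,
      c.cell j x z (a ≫ b) ≫ Hom.onArr H =
        X.cmp (c.cell j x y a) (c.cell j y z b) (by rw [h.src, h.tgt]) ≫ Hom.onArr H :=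
    .forall_finite fun j => .forall_finite fun x => .forall_finite fun y => .forall_finite fun z =>
      .forall_finite fun a => .forall_finite fun b => .eqArr _ _
  refine (h₁.and h₂).congr fun Y H => ⟨fun ⟨e₁, e₂⟩ => ⟨h.map H, fun j x y a => ?_,
    fun j x y z a b => (e₂ j x y z a b).trans (Hom.cmp_onArr _ _ _ _)⟩, fun e =>
    ⟨fun j x y a => ?_, fun j x y z a b => (e.map_comp j x y z a b).trans
      (Hom.cmp_onArr _ _ _ _).symm⟩⟩
  · have e := e₁ j x y a
    rw [Hom.cmp_onArr, Hom.cmp_onArr] at e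
    exact (cmp_congr _ rfl (Category.assoc _ _ _).symm _).trans
      (e.trans (cmp_congr _ (Category.assoc _ _ _) rfl _))
  · rw [Hom.cmp_onArr, Hom.cmp_onArr]
    exact (cmp_congr _ rfl (Category.assoc _ _ _) _).trans
      ((e.natural j x y a).trans (cmp_congr _ (Category.assoc _ _ _).symm rfl _))

end Equational

end CoconeData

/-- The vertex of a weighted colimit is a quotient of the universal recipient of data of a cocone.
The axioms are imposed in two steps: those on composition can only be stated once the sources and
targets are right. -/
lemma hasFiniteColimits₂ [FinitaryExtensive E] (hE : HasPullbackStableCoequalizers E)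
    (hU : (forgetToGraph E).IsRightAdjoint) : HasFiniteColimits₂ (InternalCat E) := by
  intro J _ _ _ _ W _ D
  obtain ⟨R, F, t, hR⟩ := exists_universal_family hU
    (ι := Σ j : J, W.obj (op j)) (κ := Σ (j : J) (x y : W.obj (op j)), (x ⟶ y))
    (fun i => D.obj i.1) (fun k => (D.obj k.1).obj)
  let c : CoconeData W D R :=
    { leg := fun j x => F ⟨j, x⟩
      cell := fun j x y a => t ⟨j, x, y, a⟩ }
  have hc {X : InternalCat E} (c' : CoconeData W D X) : ∃! H : R ⟶ X, c.map H = c' := by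
    obtain ⟨H, ⟨h₁, h₂⟩, hu⟩ := hR (fun i => c'.leg i.1 i.2)
      (fun k => c'.cell k.1 k.2.1 k.2.2.1 k.2.2.2)
    refine ⟨H, CoconeData.ext ?_ ?_, fun H' hH' => hu _ ⟨?_, ?_⟩⟩
    · funext j x
      exact h₁ ⟨j, x⟩
    · funext j x y a
      exact h₂ ⟨j, x, y, a⟩
    · subst hH'
      exact fun _ => rfl
    · subst hH'
      exact fun _ => rfl
  obtain ⟨R', π, hπ, hR'⟩ := c.isEquational_isGraphCocone.exists_quotient hE hU
  obtain ⟨C, ρ, hρ, hC⟩ := (CoconeData.isEquational_isCocone hπ).exists_quotient hE hU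
  refine ⟨C, hρ.cocone, CoconeData.isWeightedColimit hρ fun c' hc' => ?_⟩
  obtain ⟨H, rfl, hH⟩ := hc c'
  obtain ⟨H', rfl, hH'⟩ := hR' H hc'.toIsGraphCocone
  rw [CoconeData.map_comp] at hc'
  obtain ⟨H'', rfl, hH''⟩ := hC H' hc'
  refine ⟨H'', by simp only [CoconeData.map_comp], fun K hK => hH'' _ (hH' _ (hH _ ?_))⟩
  simp only [CoconeData.map_comp] at hK ⊢
  exact hK

end Weighted

end InternalCat

/-! ### Coequalisers and coinserters as weighted colimits -/

namespace ParallelPairWeight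
open TwoCat

section LocallyDiscrete
universe w' v' u'
variable {B : Type u} [Bicategory.{w, v} B] [IsLocallyDiscrete B]
  {C : Type u'} [Bicategory.{w', v'} C] [Bicategory.Strict C]

/-- A 2-functor out of a 2-category whose 2-cells are identities. -/
def strictPseudofunctorOfDiscrete (obj : B → C) (map : ∀ {a b : B}, (a ⟶ b) → (obj a ⟶ obj b))
    (map_id : ∀ a, map (𝟙 a) = 𝟙 (obj a))
    (map_comp : ∀ {a b c : B} (f : a ⟶ b) (g : b ⟶ c), map (f ≫ g) = map f ≫ map g) :
    StrictPseudofunctor B C :=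
  .mk''
    { obj := obj
      map := map
      map₂ := fun η => eqToHom (congrArg map (IsDiscrete.eq_of_hom η))
      map₂_id := fun _ => rfl
      map₂_comp := fun _ _ => (eqToHom_trans _ _).symm
      map_id := map_id
      map_comp := map_comp
      map₂_whisker_left := fun f g g' η => by
        obtain rfl := IsDiscrete.eq_of_hom η
        simp
      map₂_whisker_right := fun {a b c f f'} η g => by
        obtain rfl := IsDiscrete.eq_of_hom η
        simp }

instance : IsLocallyDiscrete Bᵒᵖ := fun _ _ =>
  { subsingleton := fun _ _ => ⟨fun η θ =>
      congrArg Bicategory.Opposite.Hom2.op2' (Subsingleton.elim η.unop2 θ.unop2)⟩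
    eq_of_hom := fun η => congrArg Quiver.Hom.op (IsDiscrete.eq_of_hom η.unop2) }

end LocallyDiscrete

variable {K : Type u} [Bicategory.{w, v} K] [Bicategory.Strict K] {A B : K}

/-- A parallel pair of 1-cells, as a 2-functor. -/
def diagram (f g : A ⟶ B) : StrictPseudofunctor (LocallyDiscrete WalkingParallelPair) K :=
  strictPseudofunctorOfDiscrete (fun j => (parallelPair f g).obj j.as)
    (fun f' => (parallelPair f g).map f'.as)
    (fun j => (parallelPair f g).map_id j.as) (fun f' g' => (parallelPair f g).map_comp f'.as g'.as)

/-- The weight for parallel pairs given by two objects `x`, `y` of a category `V`. A cocone consists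
of a 1-cell `r` out of the codomain of the parallel pair `f`, `g` and a functor from `V` to the
1-cells out of the domain which takes `x` to `f ≫ r` and `y` to `g ≫ r`. -/
def weight {V : Type} [Category.{0} V] (x y : V) :
    StrictPseudofunctor (LocallyDiscrete WalkingParallelPair)ᵒᵖ Cat.{0, 0} :=
  let F : WalkingParallelPairᵒᵖ ⥤ Cat.{0, 0} := walkingParallelPairOpEquiv.inverse ⋙
    parallelPair (Functor.toCatHom (Functor.fromPUnit x)) (Functor.toCatHom (Functor.fromPUnit y))
  strictPseudofunctorOfDiscrete (fun j => F.obj (op j.unop.as)) (fun f => F.map f.unop.as.op)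
    (fun _ => F.map_id _) (fun f g => F.map_comp f.unop.as.op g.unop.as.op)

noncomputable instance (C : Type) [SmallCategory C] [FinCategory C] (j k : LocallyDiscrete C) :
    FinCategory (j ⟶ k) :=
  inferInstanceAs (FinCategory (Discrete (j.as ⟶ k.as)))

section Weight
variable {V : Type} [Category.{0} V] {x y : V} {f g : A ⟶ B} {X : K}

noncomputable instance [FinCategory V] (j : LocallyDiscrete WalkingParallelPair) :
    FinCategory ((weight x y).obj (op j)) :=
  match j with
  | ⟨.zero⟩ => inferInstanceAs (FinCategory V)
  | ⟨.one⟩ => inferInstanceAs (FinCategory (Discrete PUnit))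

lemma functor_ext_punit {C : Type*} [Category* C] {F G : Discrete PUnit ⥤ C}
    (h : F.obj ⟨⟨⟩⟩ = G.obj ⟨⟨⟩⟩) : F = G := by
  refine CategoryTheory.Functor.ext (fun _ => h) fun a b e => ?_
  obtain rfl := IsDiscrete.eq_of_hom e
  obtain rfl := Subsingleton.elim e (𝟙 _)
  simp

/-- The cocone given by its components. -/
def cocone (r : B ⟶ X) (Γ : V ⥤ (A ⟶ X)) (hx : Γ.obj x = f ≫ r) (hy : Γ.obj y = g ≫ r) :
    WeightedCocone (weight x y) (diagram f g) X where
  leg j := match j with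
    | ⟨.zero⟩ => Γ
    | ⟨.one⟩ => Functor.fromPUnit r
  naturality {j k} f' z := by
    obtain ⟨f'⟩ := f'
    obtain ⟨j⟩ := j
    obtain ⟨k⟩ := k
    change WalkingParallelPairHom j k at f'
    cases f' with
    | left => exact hx
    | right => exact hy
    | id => cases j <;> exact (Strict.id_comp _).symm
  naturality_map {j k} f' z z' a := by
    obtain ⟨f'⟩ := f'
    obtain ⟨j⟩ := j
    obtain ⟨k⟩ := k
    change WalkingParallelPairHom j k at f'
    cases f' with
    | left =>
      change Discrete PUnit at z z'
      change (z : Discrete PUnit) ⟶ z' at a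
      obtain rfl := IsDiscrete.eq_of_hom a
      obtain rfl := Subsingleton.elim a (𝟙 _)
      change Γ.map (𝟙 x) = eqToHom hx ≫ f ◁ 𝟙 r ≫ eqToHom hx.symm
      simp
    | right =>
      change Discrete PUnit at z z'
      change (z : Discrete PUnit) ⟶ z' at a
      obtain rfl := IsDiscrete.eq_of_hom a
      obtain rfl := Subsingleton.elim a (𝟙 _)
      change Γ.map (𝟙 y) = eqToHom hy ≫ g ◁ 𝟙 r ≫ eqToHom hy.symm
      simp
    | id =>
      cases j with
      | zero =>
        change Γ.map a = eqToHom (Strict.id_comp _).symm ≫ 𝟙 A ◁ Γ.map a ≫ eqToHom (Strict.id_comp _)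
        simp [Strict.leftUnitor_eqToIso]
      | one =>
        change 𝟙 r = eqToHom (Strict.id_comp r).symm ≫ 𝟙 B ◁ 𝟙 r ≫ eqToHom (Strict.id_comp r)
        simp
  naturality₂ {j k f' g'} α z := by
    obtain rfl := IsDiscrete.eq_of_hom α
    obtain rfl := Subsingleton.elim α (𝟙 _)
    simp

/-- The colimit of a parallel pair weighted by `V` with its two objects `x`, `y`: the coequaliser if
`V` is the terminal category, the coinserter if `V` is the category `0 ⟶ 1`. -/
lemma exists_colimit [FinCategory V] (h : HasFiniteColimits₂ K) (f g : A ⟶ B) (x y : V) :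
    ∃ (C : K) (q : B ⟶ C) (Λ : V ⥤ (A ⟶ C)), Λ.obj x = f ≫ q ∧ Λ.obj y = g ≫ q ∧
      ∀ {X : K} (r : B ⟶ X) (Γ : V ⥤ (A ⟶ X)), Γ.obj x = f ≫ r → Γ.obj y = g ≫ r →
        ∃! u : C ⟶ X, q ≫ u = r ∧ Λ ⋙ Bicategory.postcomp A u = Γ := by
  have : Finite (LocallyDiscrete WalkingParallelPair) :=
    Finite.of_equiv _ LocallyDiscrete.locallyDiscreteEquiv.symm
  obtain ⟨C, φ, hφ⟩ := h (LocallyDiscrete WalkingParallelPair) (weight x y) (diagram f g)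
  refine ⟨C, (φ.leg ⟨.one⟩).obj ⟨⟨⟩⟩, φ.leg ⟨.zero⟩,
    φ.naturality (j := ⟨.zero⟩) (k := ⟨.one⟩) ⟨WalkingParallelPairHom.left⟩ ⟨⟨⟩⟩,
    φ.naturality (j := ⟨.zero⟩) (k := ⟨.one⟩) ⟨WalkingParallelPairHom.right⟩ ⟨⟨⟩⟩,
    fun {X} r Γ hx hy => ?_⟩
  obtain ⟨u, hu, hu'⟩ := hφ.existsUnique_desc (cocone r Γ hx hy)
  refine ⟨u, ⟨Functor.congr_obj (hu ⟨.one⟩) ⟨⟨⟩⟩, hu ⟨.zero⟩⟩, fun u' ⟨h₁, h₂⟩ => hu' _ ?_⟩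
  rintro ⟨_ | _⟩
  · exact h₂
  · exact functor_ext_punit h₁

end Weight
end ParallelPairWeight

/-! ### Discrete internal categories -/

namespace InternalCat
open TwoCat StableCoequalizer ExtensiveLemmas
variable {E : Type u} [Category.{v} E] [HasPullbacks E]

section Disc

/-- The discrete internal category on an object: all its arrows are identities. -/
@[reducible] noncomputable def disc (B : E) : InternalCat E :=
  ofCmp B B (𝟙 B) (𝟙 B) (𝟙 B) (fun f _ _ => f) (fun _ _ _ _ => rfl) (Category.comp_id _)
    (Category.comp_id _) (fun _ _ _ => rfl) (fun _ _ h => by rw [h]) (fun _ => Category.comp_id _)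
    (fun _ => rfl) (fun _ _ _ _ _ => rfl)

lemma disc_cmp {B T : E} (f g : T ⟶ (disc B).arr) (h : f ≫ (disc B).tgt = g ≫ (disc B).src) :
    (disc B).cmp f g h = f :=
  ofCmp_cmp (comp_c := fun _ _ _ _ => rfl) _ _ _

variable {A B W : E} {X Y : InternalCat E}

lemma comp_ident_src (x : B ⟶ X.obj) : (x ≫ X.ident) ≫ X.src = x := by
  rw [Category.assoc, X.ident_src, Category.comp_id]

lemma comp_ident_tgt (x : B ⟶ X.obj) : (x ≫ X.ident) ≫ X.tgt = x := by
  rw [Category.assoc, X.ident_tgt, Category.comp_id]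

/-- The functor out of a discrete category with given action on objects. -/
noncomputable def fromDisc (x : B ⟶ X.obj) : disc B ⟶ X :=
  homMk (A := disc B) x (x ≫ X.ident) (by rw [comp_ident_src, Category.id_comp])
    (by rw [comp_ident_tgt, Category.id_comp]) (Category.id_comp _)
    (fun f g h => by
      rw [disc_cmp, cmp_of_right_eq_ident X (g ≫ x) (Category.assoc _ _ _).symm])

@[simp] lemma fromDisc_onObj (x : B ⟶ X.obj) : Hom.onObj (fromDisc x) = x := rfl

lemma fromDisc_onArr (f : A ⟶ B) : Hom.onArr (fromDisc (X := disc B) f) = f := Category.comp_id _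

lemma hom_ext_disc {F G : disc B ⟶ X} (h : Hom.onObj F = Hom.onObj G) : F = G := by
  have key (F : disc B ⟶ X) : Hom.onArr F = Hom.onObj F ≫ X.ident :=
    (Category.id_comp _).symm.trans (Hom.ident_onArr F)
  exact hom_ext h (by rw [key, key, h])

/-- A natural transformation between functors out of a discrete category is a family of arrows. -/
noncomputable def cellDisc {F G : disc B ⟶ X} (a : B ⟶ X.arr) (hs : a ≫ X.src = Hom.onObj F)
    (ht : a ≫ X.tgt = Hom.onObj G) : F ⟶ G :=
  NatTrans.mk (F := F) (G := G) a hs ht (by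
    have key (F : disc B ⟶ X) : Hom.onArr F = Hom.onObj F ≫ X.ident :=
      (Category.id_comp _).symm.trans (Hom.ident_onArr F)
    rw [cmp_of_left_eq_ident X (Hom.onObj F) (key F),
      cmp_of_right_eq_ident X (Hom.onObj G) (key G)])

lemma isPullback₂_disc_iff {P X Y Z : E} {fst : P ⟶ X} {snd : P ⟶ Y} {f : X ⟶ Z} {g : Y ⟶ Z} :
    IsPullback₂ (fromDisc (X := disc X) fst) (fromDisc (X := disc Y) snd)
      (fromDisc (X := disc Z) f) (fromDisc (X := disc Z) g) ↔ IsPullback fst snd f g := by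
  rw [isPullback₂_iff]
  simp only [fromDisc_onArr, fromDisc_onObj, and_self]

lemma isCoproduct₂_disc_iff {X Y P : E} {i : X ⟶ P} {j : Y ⟶ P} :
    IsCoproduct₂ (fromDisc (X := disc P) i) (fromDisc (X := disc P) j) ↔ IsCoprod i j := by
  constructor
  · intro h
    refine .of_existsUnique fun {W} f g => ?_
    obtain ⟨k, ⟨h₁, h₂⟩, hu⟩ := h.existsUnique_desc (fromDisc (X := disc W) f) (fromDisc g)
    refine ⟨Hom.onObj k, ⟨congrArg Hom.onObj h₁, congrArg Hom.onObj h₂⟩, fun k' ⟨h₁', h₂'⟩ => ?_⟩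
    exact congrArg Hom.onObj (hu (fromDisc k') ⟨hom_ext_disc h₁', hom_ext_disc h₂'⟩)
  · intro h
    refine isCoproduct₂_of_existsUnique fun {Z} F G => ?_
    obtain ⟨k, h₁, h₂⟩ := h.exists_desc (Hom.onObj F) (Hom.onObj G)
    refine ⟨fromDisc k, ⟨hom_ext_disc h₁, hom_ext_disc h₂⟩, fun K ⟨h₁', h₂'⟩ => hom_ext_disc ?_⟩
    refine h.hom_ext ?_ ?_
    · exact (congrArg Hom.onObj h₁').trans h₁.symm
    · exact (congrArg Hom.onObj h₂').trans h₂.symm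

/-- If `X` retracts the discrete category on its objects, then every morphism out of the object of
objects of `X` extends to a functor from `X` to a discrete category. This applies when `X` is a
colimit of discrete categories. -/
lemma onObj_comp_fromDisc {s : X ⟶ disc X.obj} (hs : s ≫ fromDisc (𝟙 X.obj) = 𝟙 X) (k : X.obj ⟶ W) :
    Hom.onObj (s ≫ fromDisc (X := disc W) k) = k := by
  have : Hom.onObj s = 𝟙 X.obj := (Category.comp_id _).symm.trans (congrArg Hom.onObj hs)
  rw [onObj_comp, this, fromDisc_onObj]
  exact Category.id_comp k

end Disc

section Colimits

lemma hasFiniteCoproducts_of_isExtensive₂ (h : IsExtensive₂ (InternalCat E)) :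
    HasFiniteCoproducts E := by
  have : HasInitial E := by
    obtain ⟨I, hI⟩ := h.exists_initial
    obtain ⟨s, -, -⟩ := (hI (disc I.obj)).1
    have hs : s ≫ fromDisc (𝟙 I.obj) = 𝟙 I := (hI I).1.unique trivial trivial
    have (Y : E) : Nonempty (I.obj ⟶ Y) := ⟨Hom.onObj (hI (disc Y)).1.choose⟩
    have (Y : E) : Subsingleton (I.obj ⟶ Y) := ⟨fun a b => by
      rw [← onObj_comp_fromDisc hs a, ← onObj_comp_fromDisc hs b]
      exact congrArg Hom.onObj ((hI (disc Y)).1.unique trivial trivial)⟩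
    exact hasInitial_of_unique I.obj
  have : HasBinaryCoproducts E := by
    have (X Y : E) : HasColimit (pair X Y) := by
      obtain ⟨P, inl, inr, h⟩ := h.exists_coproduct (disc X) (disc Y)
      obtain ⟨s, ⟨hl, hr⟩, -⟩ := h.existsUnique_desc (fromDisc (X := disc P.obj) (Hom.onObj inl))
        (fromDisc (Hom.onObj inr))
      have hs : s ≫ fromDisc (𝟙 P.obj) = 𝟙 P := by
        refine (h.existsUnique_desc inl inr).unique ⟨?_, ?_⟩ ⟨Category.comp_id _, Category.comp_id _⟩
        · rw [← Category.assoc, hl]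
          exact hom_ext_disc (Category.comp_id _)
        · rw [← Category.assoc, hr]
          exact hom_ext_disc (Category.comp_id _)
      have : IsCoprod (Hom.onObj inl) (Hom.onObj inr) := by
        refine .of_existsUnique fun {W} f g => ?_
        obtain ⟨k, ⟨h₁, h₂⟩, hu⟩ := h.existsUnique_desc (fromDisc (X := disc W) f) (fromDisc g)
        refine ⟨Hom.onObj k, ⟨congrArg Hom.onObj h₁, congrArg Hom.onObj h₂⟩, fun k' ⟨h₁', h₂'⟩ => ?_⟩
        rw [← onObj_comp_fromDisc hs k', hu (s ≫ fromDisc k') ⟨hom_ext_disc ?_, hom_ext_disc ?_⟩]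
        · rw [onObj_comp, onObj_comp_fromDisc hs, h₁', fromDisc_onObj]
        · rw [onObj_comp, onObj_comp_fromDisc hs, h₂', fromDisc_onObj]
      obtain ⟨h⟩ := this
      exact ⟨⟨_, h⟩⟩
    exact hasBinaryCoproducts_of_hasColimit_pair _
  exact hasFiniteCoproducts_of_has_binary_and_initial

/-- Extensivity of `E` is that of `Cat(E)` for diagrams of discrete categories. -/
lemma finitaryExtensive_of_isExtensive₂ (h : IsExtensive₂ (InternalCat E)) :
    FinitaryExtensive E := by
  have := hasFiniteCoproducts_of_isExtensive₂ h
  refine finitaryExtensive_of ?_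
  intro X Y P i j hij A B Z a b s t z ha hb
  rw [← isCoproduct₂_disc_iff] at hij ⊢
  rw [← isPullback₂_disc_iff, ← isPullback₂_disc_iff]
  exact h.coproduct_iff _ _ hij _ _ _ _ _ (hom_ext_disc ha) (hom_ext_disc hb)

lemma exists_isCoequalizer₂ (h : HasFiniteColimits₂ (InternalCat E)) {A B : InternalCat E}
    (F G : A ⟶ B) : ∃ (C : InternalCat E) (Q : B ⟶ C), IsCoequalizer₂ F G Q := by
  obtain ⟨C, Q, Λ, h₁, h₂, hu⟩ := ParallelPairWeight.exists_colimit h F G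
    (⟨⟨⟩⟩ : Discrete PUnit) ⟨⟨⟩⟩
  refine ⟨C, Q, isCoequalizer₂_of_existsUnique (h₁.symm.trans h₂) fun R hR => ?_⟩
  obtain ⟨u, ⟨hu₁, hu₂⟩, hu₃⟩ := hu R (Functor.fromPUnit (F ≫ R)) rfl hR
  refine ⟨u, hu₁, fun u' hu' => hu₃ _ ⟨hu', ParallelPairWeight.functor_ext_punit ?_⟩⟩
  change Λ.obj _ ≫ u' = F ≫ R
  rw [h₁, Category.assoc, hu']

lemma hasCoequalizers_of_hasFiniteColimits₂ (h : HasFiniteColimits₂ (InternalCat E)) :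
    HasCoequalizers E := by
  have (X Y : E) (f g : X ⟶ Y) : HasColimit (parallelPair f g) := by
    obtain ⟨C, Q, hQ⟩ := exists_isCoequalizer₂ h (fromDisc (X := disc Y) f) (fromDisc g)
    have hw : f ≫ Hom.onObj Q = g ≫ Hom.onObj Q := congrArg Hom.onObj hQ.w
    obtain ⟨s, hs, -⟩ := hQ.existsUnique_desc (fromDisc (X := disc C.obj) (Hom.onObj Q))
      (hom_ext_disc hw)
    have hs' : s ≫ fromDisc (𝟙 C.obj) = 𝟙 C := by
      refine (hQ.existsUnique_desc Q hQ.w).unique ?_ (Category.comp_id _)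
      rw [← Category.assoc, hs]
      exact hom_ext_disc (Category.comp_id _)
    have : IsCoeq f g (Hom.onObj Q) := by
      refine .of_existsUnique hw fun {W} k hk => ?_
      obtain ⟨l, hl, hu⟩ := hQ.existsUnique_desc (fromDisc (X := disc W) k) (hom_ext_disc hk)
      refine ⟨Hom.onObj l, congrArg Hom.onObj hl, fun l' hl' => ?_⟩
      rw [← onObj_comp_fromDisc hs' l', hu (s ≫ fromDisc l') (hom_ext_disc ?_)]
      rw [onObj_comp, onObj_comp_fromDisc hs', hl', fromDisc_onObj]
    obtain ⟨w, ⟨hc⟩⟩ := this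
    exact ⟨⟨_, hc⟩⟩
  exact hasCoequalizers_of_hasColimit_parallelPair _

/-- The free internal category on a graph is the coinserter of the source and target, seen as
functors between discrete categories. -/
lemma isRightAdjoint_forgetToGraph (h : HasFiniteColimits₂ (InternalCat E)) :
    (forgetToGraph E).IsRightAdjoint := by
  have (G : InternalGraph E) : HasInitial (StructuredArrow G (forgetToGraph E)) := by
    let F₀ : disc G.arr ⟶ disc G.obj := fromDisc G.src
    let F₁ : disc G.arr ⟶ disc G.obj := fromDisc G.tgt
    -- The weight `Fin 2` makes this colimit the coinserter.
    obtain ⟨C, Q, Λ, h₀, h₁, hu⟩ := ParallelPairWeight.exists_colimit h F₀ F₁ (0 : Fin 2) 1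
    let η₁ : G.arr ⟶ C.arr := NatTrans.app (Λ.map (homOfLE (Fin.zero_le 1)))
    let η : G ⟶ (forgetToGraph E).obj C := InternalGraph.Hom.mk (Hom.onObj Q) η₁
      ((NatTrans.app_src _).trans (congrArg Hom.onObj h₀))
      ((NatTrans.app_tgt _).trans (congrArg Hom.onObj h₁))
    have key {X : InternalCat E} (φ : G ⟶ (forgetToGraph E).obj X) :
        ∃! H : C ⟶ X, η ≫ (forgetToGraph E).map H = φ := by
      let R : disc G.obj ⟶ X := fromDisc (InternalGraph.Hom.onObj φ)
      let a : F₀ ≫ R ⟶ F₁ ≫ R := cellDisc (InternalGraph.Hom.onArr φ)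
        (InternalGraph.Hom.onArr_src φ) (InternalGraph.Hom.onArr_tgt φ)
      obtain ⟨H, ⟨hH₁, hH₂⟩, hH⟩ := hu R (ComposableArrows.mk₁ a) rfl rfl
      refine ⟨H, InternalGraph.Hom.ext (congrArg Hom.onObj hH₁) ?_, fun H' hH' => hH H' ⟨?_, ?_⟩⟩
      · have e := congrArg NatTrans.app (Functor.congr_hom hH₂ (homOfLE (Fin.zero_le 1)))
        simp only [app_eqToHom_comp, app_comp_eqToHom] at e
        exact e
      · exact hom_ext_disc (congrArg InternalGraph.Hom.onObj hH')
      · have hQ : Q ≫ H' = R := hom_ext_disc (congrArg InternalGraph.Hom.onObj hH')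
        refine ComposableArrows.ext₁ ?_ ?_ (hom₂_ext ?_)
        · change Λ.obj 0 ≫ H' = F₀ ≫ R
          rw [h₀, Category.assoc, hQ]
        · change Λ.obj 1 ≫ H' = F₁ ≫ R
          rw [h₁, Category.assoc, hQ]
        · rw [app_eqToHom_comp, app_comp_eqToHom]
          exact congrArg InternalGraph.Hom.onArr hH'
    have i : IsInitial (StructuredArrow.mk η) := by
      refine IsInitial.ofUniqueHom (fun Y => StructuredArrow.homMk (key Y.hom).choose
        (key Y.hom).choose_spec.1) fun Y m => ?_
      refine StructuredArrow.ext _ _ ?_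
      exact (key Y.hom).choose_spec.2 m.right (StructuredArrow.w m)
    exact i.hasInitial
  exact isRightAdjointOfStructuredArrowInitials _

end Colimits
end InternalCat

/-! ### Suspensions and the stability of coequalisers -/

namespace InternalCat
open TwoCat StableCoequalizer ExtensiveLemmas
variable {E : Type u} [Category.{v} E] [HasPullbacks E]

/-- `S` is the suspension of `y : Y ⟶ B`, seen as a family of objects indexed by `B`: it has two
copies `u`, `v` of `B` as objects, and apart from identities an arrow for every element of `Y`,
leading from the first copy of its image in `B` to the second one. -/
structure IsSuspension (S : InternalCat E) {B Y : E} (u v : B ⟶ S.obj) (a : Y ⟶ S.arr) (y : Y ⟶ B) :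
    Prop where
  obj : IsCoprod u v
  arr : IsCoprod S.ident a
  src : a ≫ S.src = y ≫ u
  tgt : a ≫ S.tgt = y ≫ v

/-- A composable pair in a suspension contains an identity. Composition is therefore defined by
cases on the first arrow: the composite is the second arrow if the first one is an identity, and the
first arrow otherwise. -/
lemma exists_isSuspension [FinitaryExtensive E] {B Y : E} (y : Y ⟶ B) :
    ∃ (S : InternalCat E) (u v : B ⟶ S.obj) (a : Y ⟶ S.arr), IsSuspension S u v a y := by
  obtain ⟨P, u, v, hP⟩ := IsCoprod.exists_isCoprod B B
  obtain ⟨Q, i, a, hQ⟩ := IsCoprod.exists_isCoprod P Y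
  obtain ⟨src, is, as⟩ := hQ.exists_desc (𝟙 P) (y ≫ u)
  obtain ⟨tgt, it, at'⟩ := hQ.exists_desc (𝟙 P) (y ≫ v)
  have key {T : E} (f g : T ⟶ Q) : ∃ m : T ⟶ Q,
      (∀ {S : E} (s : S ⟶ T) (p : S ⟶ P), s ≫ f = p ≫ i → s ≫ m = s ≫ g) ∧
      ∀ {S : E} (s : S ⟶ T) (z : S ⟶ Y), s ≫ f = z ≫ a → s ≫ m = s ≫ f := by
    obtain ⟨T₁, T₂, t₁, t₂, _, _, hT, h₁, h₂⟩ := hQ.exists_decomposition f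
    obtain ⟨m, hm₁, hm₂⟩ := hT.exists_desc (t₁ ≫ g) (t₂ ≫ f)
    refine ⟨m, fun s p hs => ?_, fun s z hs => ?_⟩
    · obtain ⟨l, rfl, -⟩ := h₁.exists_lift s p hs
      rw [Category.assoc, hm₁, Category.assoc]
    · obtain ⟨l, rfl, -⟩ := h₂.exists_lift s z hs
      rw [Category.assoc, hm₂, Category.assoc]
  choose c hl hr using @key
  have hl' {T : E} (f g : T ⟶ Q) (p : T ⟶ P) (hf : f = p ≫ i) : c f g = g := by
    simpa using hl f g (𝟙 T) p (by simpa using hf)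
  have hr' {T : E} (f g : T ⟶ Q) (z : T ⟶ Y) (hf : f = z ≫ a) : c f g = f := by
    simpa using hr f g (𝟙 T) z (by simpa using hf)
  have comp_c {S T : E} (s : S ⟶ T) (f g : T ⟶ Q) : s ≫ c f g = c (s ≫ f) (s ≫ g) := by
    refine hQ.ext_cases (s ≫ f) (fun t p hp => ?_) fun t z hz => ?_
    · rw [hl _ _ t p hp, ← Category.assoc, hl f g (t ≫ s) p (by rw [Category.assoc, hp]),
        Category.assoc]
    · rw [hr _ _ t z hz, ← Category.assoc, hr f g (t ≫ s) z (by rw [Category.assoc, hz]),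
        Category.assoc]
  have c_src {T : E} (f g : T ⟶ Q) (h : f ≫ tgt = g ≫ src) : c f g ≫ src = f ≫ src := by
    refine hQ.ext_cases f (fun t p hp => ?_) fun t z hz => ?_
    · have h' := congrArg (t ≫ ·) h
      simp only [reassoc_of% hp, it, Category.comp_id] at h'
      rw [reassoc_of% hl f g t p hp, reassoc_of% hp, is, ← h', Category.comp_id]
    · rw [reassoc_of% hr f g t z hz]
  have c_tgt {T : E} (f g : T ⟶ Q) (h : f ≫ tgt = g ≫ src) : c f g ≫ tgt = g ≫ tgt := by
    refine hQ.ext_cases f (fun t p hp => ?_) fun t z hz => ?_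
    · rw [reassoc_of% hl f g t p hp]
    · rw [reassoc_of% hr f g t z hz]
      have h' := congrArg (t ≫ ·) h
      simp only [reassoc_of% hz, at'] at h'
      -- Only an identity can be composed after an arrow coming from `Y`.
      refine hQ.ext_cases (t ≫ g) (fun s p hp => ?_) fun s z' hz' => ?_
      · have h'' := congrArg (s ≫ ·) h'
        simp only [reassoc_of% hp, is, Category.comp_id] at h''
        rw [reassoc_of% hp, it, Category.comp_id, ← h'', reassoc_of% hz, at']
      · have h'' := congrArg (s ≫ ·) h'
        simp only [reassoc_of% hz', as] at h''
        exact hP.symm.eq_of_inl_eq_inr (x := s ≫ z ≫ y) (y := z' ≫ y) (by simpa using h'') _ _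
  refine ⟨ofCmp P Q src tgt i (fun f g _ => c f g) (fun s f g _ => comp_c s f g) is it c_src c_tgt
    (fun _ => hl' _ _ src rfl) (fun _ => ?_) (fun f g k _ _ => ?_), u, v, a, hP, hQ, as, at'⟩
  · refine hQ.ext_cases (𝟙 Q) (fun t p hp => ?_) fun t z hz => hr _ _ t z hz
    rw [hl _ _ t p hp]
    rw [Category.comp_id] at hp ⊢
    rw [hp, Category.assoc, reassoc_of% it]
  · refine hQ.ext_cases f (fun t p hp => ?_) fun t z hz => ?_
    · rw [comp_c, hl f g t p hp, comp_c, hl' (t ≫ f) _ p hp, comp_c]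
    · rw [comp_c, hr f g t z hz, hr' (t ≫ f) _ z hz, comp_c, hr' (t ≫ f) _ z hz]

namespace IsSuspension
variable {S Z : InternalCat E} {B Y : E} {u v : B ⟶ S.obj} {a : Y ⟶ S.arr} {y : Y ⟶ B}

lemma hom_ext (h : IsSuspension S u v a y) {F G : S ⟶ Z} (hu : u ≫ Hom.onObj F = u ≫ Hom.onObj G)
    (hv : v ≫ Hom.onObj F = v ≫ Hom.onObj G) (ha : a ≫ Hom.onArr F = a ≫ Hom.onArr G) : F = G := by
  have h₀ := h.obj.hom_ext hu hv
  exact InternalCat.hom_ext h₀ (h.arr.hom_ext (by rw [Hom.ident_onArr, Hom.ident_onArr, h₀]) ha)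

/-- Functors out of a suspension. -/
lemma exists_hom [FinitaryExtensive E] (h : IsSuspension S u v a y) (z₀ z₁ : B ⟶ Z.obj)
    (z : Y ⟶ Z.arr) (hs : z ≫ Z.src = y ≫ z₀) (ht : z ≫ Z.tgt = y ≫ z₁) :
    ∃ F : S ⟶ Z, u ≫ Hom.onObj F = z₀ ∧ v ≫ Hom.onObj F = z₁ ∧ a ≫ Hom.onArr F = z := by
  obtain ⟨F₀, h₀, h₁⟩ := h.obj.exists_desc z₀ z₁
  obtain ⟨F₁, hi, ha⟩ := h.arr.exists_desc (F₀ ≫ Z.ident) z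
  have is := S.ident_src
  have it := S.ident_tgt
  have hsrc : F₁ ≫ Z.src = S.src ≫ F₀ := h.arr.hom_ext
    (by rw [reassoc_of% hi, Z.ident_src, reassoc_of% is, Category.comp_id])
    (by rw [reassoc_of% ha, hs, reassoc_of% h.src, h₀])
  have htgt : F₁ ≫ Z.tgt = S.tgt ≫ F₀ := h.arr.hom_ext
    (by rw [reassoc_of% hi, Z.ident_tgt, reassoc_of% it, Category.comp_id])
    (by rw [reassoc_of% ha, ht, reassoc_of% h.tgt, h₁])
  refine ⟨homMk F₀ F₁ hsrc htgt hi fun {T} f g hfg => ?_, h₀, h₁, ha⟩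
  have hc {T' : E} (t : T' ⟶ T) : (t ≫ f ≫ F₁) ≫ Z.tgt = (t ≫ g ≫ F₁) ≫ Z.src := by
    simp only [Category.assoc, hsrc, htgt, reassoc_of% hfg]
  have right {T' : E} (t : T' ⟶ T) (p : T' ⟶ S.obj) (hp : t ≫ g = p ≫ S.ident) :
      t ≫ S.cmp f g hfg ≫ F₁ = t ≫ Z.cmp (f ≫ F₁) (g ≫ F₁) (by simpa using hc (𝟙 T)) := by
    rw [← Category.assoc, precomp_cmp, precomp_cmp, cmp_of_right_eq_ident S p hp,
      cmp_of_right_eq_ident Z (p ≫ F₀) (by rw [reassoc_of% hp, hi, Category.assoc]), Category.assoc]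
  refine h.arr.ext_cases f (fun t p hp => ?_) fun t w hw => ?_
  · rw [← Category.assoc, precomp_cmp, precomp_cmp, cmp_of_left_eq_ident S p hp,
      cmp_of_left_eq_ident Z (p ≫ F₀) (by rw [reassoc_of% hp, hi, Category.assoc]), Category.assoc]
  · refine h.arr.ext_cases (t ≫ g) (fun s p hp => ?_) fun s w' hw' => ?_
    · simpa using right (s ≫ t) p (by simpa using hp)
    · -- two non-identity arrows are never composable
      have e := congrArg (fun z => s ≫ t ≫ z) hfg
      simp only [reassoc_of% hw, reassoc_of% hw', h.src, h.tgt] at e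
      exact h.obj.symm.eq_of_inl_eq_inr (x := s ≫ w ≫ y) (y := w' ≫ y) (by simpa using e) _ _

/-- The suspension is functorial in the base and in the family. -/
lemma exists_map [FinitaryExtensive E] {B' Y' : E} {u' v' : B' ⟶ Z.obj} {a' : Y' ⟶ Z.arr}
    {y' : Y' ⟶ B'} (h : IsSuspension S u v a y) (h' : IsSuspension Z u' v' a' y') (i : B ⟶ B')
    (m : Y ⟶ Y') (hm : m ≫ y' = y ≫ i) :
    ∃ F : S ⟶ Z, u ≫ Hom.onObj F = i ≫ u' ∧ v ≫ Hom.onObj F = i ≫ v' ∧ a ≫ Hom.onArr F = m ≫ a' :=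
  h.exists_hom _ _ _ (by rw [Category.assoc, h'.src, reassoc_of% hm])
    (by rw [Category.assoc, h'.tgt, reassoc_of% hm])

lemma exists_mapOver [FinitaryExtensive E] {Y' : E} {u' v' : B ⟶ Z.obj} {a' : Y' ⟶ Z.arr}
    {y' : Y' ⟶ B} (h : IsSuspension S u v a y) (h' : IsSuspension Z u' v' a' y') (m : Y ⟶ Y')
    (hm : m ≫ y' = y) :
    ∃ F : S ⟶ Z, u ≫ Hom.onObj F = u' ∧ v ≫ Hom.onObj F = v' ∧ a ≫ Hom.onArr F = m ≫ a' := by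
  simpa using h.exists_map h' (𝟙 B) m (by simpa using hm)

/-- The functor from a suspension to the discrete category on the base. -/
lemma exists_collapse [FinitaryExtensive E] (h : IsSuspension S u v a y) :
    ∃ κ : S ⟶ disc B, u ≫ Hom.onObj κ = 𝟙 B ∧ v ≫ Hom.onObj κ = 𝟙 B ∧ a ≫ Hom.onArr κ = y :=
  h.exists_hom (Z := disc B) _ _ _ rfl rfl

end IsSuspension

section Stability

/-- Composition of a discrete category is invertible, so the square in question is a pullback. -/
lemma isDiscreteConduche_fromDisc {A B : E} (i : A ⟶ B) :
    IsDiscreteConduche (fromDisc (X := disc B) i) := by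
  have key (B : E) : IsIso (disc B).comp := by
    rw [← cmp_fst_snd, disc_cmp]
    infer_instance
  have := key A
  have := key B
  exact IsPullback.of_vert_isIso ⟨(Hom.comp_onArr (fromDisc (X := disc B) i)).symm⟩

variable [FinitaryExtensive E]

/-- Suspensions preserve coequalisers. -/
lemma IsSuspension.isCoequalizer₂ {B X Y C : E} {f g : X ⟶ Y} {q : Y ⟶ C} {x : X ⟶ B} {y : Y ⟶ B}
    {c : C ⟶ B} (hq : IsCoeq f g q) {SX SY SC : InternalCat E} {uX vX : B ⟶ SX.obj}
    {aX : X ⟶ SX.arr} {uY vY : B ⟶ SY.obj} {aY : Y ⟶ SY.arr} {uC vC : B ⟶ SC.obj} {aC : C ⟶ SC.arr}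
    (hX : IsSuspension SX uX vX aX x) (hY : IsSuspension SY uY vY aY y)
    (hC : IsSuspension SC uC vC aC c) (hy : q ≫ c = y) {F G : SX ⟶ SY} {Q : SY ⟶ SC}
    (Fu : uX ≫ Hom.onObj F = uY) (Fv : vX ≫ Hom.onObj F = vY) (Fa : aX ≫ Hom.onArr F = f ≫ aY)
    (Gu : uX ≫ Hom.onObj G = uY) (Gv : vX ≫ Hom.onObj G = vY) (Ga : aX ≫ Hom.onArr G = g ≫ aY)
    (Qu : uY ≫ Hom.onObj Q = uC) (Qv : vY ≫ Hom.onObj Q = vC) (Qa : aY ≫ Hom.onArr Q = q ≫ aC) :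
    IsCoequalizer₂ F G Q := by
  have := hq.epi
  refine isCoequalizer₂_of_existsUnique (hX.hom_ext ?_ ?_ ?_) fun {Z} R hR => ?_
  · rw [onObj_comp, onObj_comp, reassoc_of% Fu, reassoc_of% Gu]
  · rw [onObj_comp, onObj_comp, reassoc_of% Fv, reassoc_of% Gv]
  · rw [onArr_comp, onArr_comp, reassoc_of% Fa, reassoc_of% Ga, Qa, reassoc_of% hq.w]
  · obtain ⟨z, hz⟩ := hq.exists_desc (aY ≫ Hom.onArr R) (by
      have e := congrArg (fun K => aX ≫ Hom.onArr K) hR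
      simp only [onArr_comp, reassoc_of% Fa, reassoc_of% Ga] at e
      exact e)
    obtain ⟨T, Tu, Tv, Ta⟩ := hC.exists_hom (uY ≫ Hom.onObj R) (vY ≫ Hom.onObj R) z
      (by
        rw [← cancel_epi q, reassoc_of% hz, reassoc_of% hy, Hom.onArr_src, reassoc_of% hY.src])
      (by
        rw [← cancel_epi q, reassoc_of% hz, reassoc_of% hy, Hom.onArr_tgt, reassoc_of% hY.tgt])
    refine ⟨T, hY.hom_ext ?_ ?_ ?_, fun T' hT' => hC.hom_ext ?_ ?_ ?_⟩
    · rw [onObj_comp, reassoc_of% Qu, Tu]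
    · rw [onObj_comp, reassoc_of% Qv, Tv]
    · rw [onArr_comp, reassoc_of% Qa, Ta, hz]
    · rw [Tu, ← hT', onObj_comp, reassoc_of% Qu]
    · rw [Tv, ← hT', onObj_comp, reassoc_of% Qv]
    · rw [Ta, ← cancel_epi q, hz, ← hT', onArr_comp, reassoc_of% Qa]

/-- Suspensions are compatible with change of base. -/
lemma IsSuspension.isPullback₂ {A B Y Y' : E} {y : Y ⟶ B} {y' : Y' ⟶ A} {i : A ⟶ B} {p : Y' ⟶ Y}
    (h : IsPullback p y' y i) {S S' : InternalCat E} {u v : B ⟶ S.obj} {a : Y ⟶ S.arr}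
    {u' v' : A ⟶ S'.obj} {a' : Y' ⟶ S'.arr} (hS : IsSuspension S u v a y)
    (hS' : IsSuspension S' u' v' a' y') {P : S' ⟶ S} {κ : S ⟶ disc B} {κ' : S' ⟶ disc A}
    (Pu : u' ≫ Hom.onObj P = i ≫ u) (Pv : v' ≫ Hom.onObj P = i ≫ v)
    (Pa : a' ≫ Hom.onArr P = p ≫ a) (κu : u ≫ Hom.onObj κ = 𝟙 B) (κv : v ≫ Hom.onObj κ = 𝟙 B)
    (κa : a ≫ Hom.onArr κ = y) (κu' : u' ≫ Hom.onObj κ' = 𝟙 A) (κv' : v' ≫ Hom.onObj κ' = 𝟙 A)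
    (κa' : a' ≫ Hom.onArr κ' = y') : IsPullback₂ P κ' κ (fromDisc i) := by
  have hi : IsPullback i (𝟙 A) (𝟙 B) i := IsPullback.of_vert_isIso ⟨by simp⟩
  have h₀ : IsPullback (Hom.onObj P) (Hom.onObj κ') (Hom.onObj κ) i :=
    hS.obj.isPullback_coprod hS'.obj (by rw [κu, κu']; exact hi) (by rw [κv, κv']; exact hi) Pu Pv
  rw [isPullback₂_iff, fromDisc_onArr]
  have e {D : E} {T : InternalCat E} (κ : T ⟶ disc D) : T.ident ≫ Hom.onArr κ = Hom.onObj κ :=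
    (Hom.ident_onArr κ).trans (Category.comp_id _)
  exact ⟨h₀, hS.arr.isPullback_coprod hS'.arr (by rw [e, e]; exact h₀)
    (by rw [κa, κa']; exact h) (Hom.ident_onArr P) Pa⟩

/-- If a morphism between two objects over `B` becomes invertible on suspensions, then it is
invertible. -/
lemma IsSuspension.isIso {B C D : E} {c : C ⟶ B} {d : D ⟶ B} {h : D ⟶ C} {SC SD : InternalCat E}
    {uC vC : B ⟶ SC.obj} {aC : C ⟶ SC.arr} {uD vD : B ⟶ SD.obj} {aD : D ⟶ SD.arr}
    (hC : IsSuspension SC uC vC aC c) (hD : IsSuspension SD uD vD aD d) (H : SD ⟶ SC)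
    (Ha : aD ≫ Hom.onArr H = h ≫ aC) [IsIso (Hom.onArr H)] : IsIso h :=
  ((hC.arr.iff_isPullback (Hom.ident_onArr H) Ha).1 hD.arr).2.isIso_snd_of_isIso

/-- A coequaliser over `B` gives rise to a coequaliser of suspensions, which can be pulled back
along the discrete Conduché fibration between discrete categories induced by `i : A ⟶ B`. The
suspensions over `A` so obtained have the universal property of the suspension of a coequaliser over
`A`. -/
lemma hasPullbackStableCoequalizers [HasCoequalizers E] (h : ConducheStableCoequalizers E) :
    HasPullbackStableCoequalizers E := by
  refine ⟨inferInstance, ?_⟩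
  intro X Y C A B f g q w hq c i X' Y' C' pX x pY y pC c' f' g' q' w' hX hY hC hf hfx hg hgx hq' hqy
  have hq : IsCoeq f g q := ⟨w, hq⟩
  have hwc : g ≫ q ≫ c = f ≫ q ≫ c := by rw [reassoc_of% w]
  obtain ⟨SX, uX, vX, aX, sX⟩ := exists_isSuspension (f ≫ q ≫ c)
  obtain ⟨SY, uY, vY, aY, sY⟩ := exists_isSuspension (q ≫ c)
  obtain ⟨SC, uC, vC, aC, sC⟩ := exists_isSuspension c
  obtain ⟨SX', uX', vX', aX', sX'⟩ := exists_isSuspension x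
  obtain ⟨SY', uY', vY', aY', sY'⟩ := exists_isSuspension y
  obtain ⟨SC', uC', vC', aC', sC'⟩ := exists_isSuspension c'
  obtain ⟨F, Fu, Fv, Fa⟩ := sX.exists_mapOver sY f rfl
  obtain ⟨G, Gu, Gv, Ga⟩ := sX.exists_mapOver sY g hwc
  obtain ⟨Q, Qu, Qv, Qa⟩ := sY.exists_mapOver sC q rfl
  obtain ⟨F', Fu', Fv', Fa'⟩ := sX'.exists_mapOver sY' f' hfx
  obtain ⟨G', Gu', Gv', Ga'⟩ := sX'.exists_mapOver sY' g' hgx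
  obtain ⟨Q', Qu', Qv', Qa'⟩ := sY'.exists_mapOver sC' q' hqy
  obtain ⟨PX, PXu, PXv, PXa⟩ := sX'.exists_map sX i pX hX.w
  obtain ⟨PY, PYu, PYv, PYa⟩ := sY'.exists_map sY i pY hY.w
  obtain ⟨PC, PCu, PCv, PCa⟩ := sC'.exists_map sC i pC hC.w
  obtain ⟨κ, κu, κv, κa⟩ := sC.exists_collapse
  obtain ⟨κX, κXu, κXv, κXa⟩ := sX'.exists_collapse
  obtain ⟨κY, κYu, κYv, κYa⟩ := sY'.exists_collapse
  obtain ⟨κC, κCu, κCv, κCa⟩ := sC'.exists_collapse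
  have hco := sX.isCoequalizer₂ hq sY sC rfl Fu Fv Fa Gu Gv Ga Qu Qv Qa
  have hFG : Hom.onObj F = Hom.onObj G :=
    sX.obj.hom_ext (by rw [Fu, Gu]) (by rw [Fv, Gv])
  have pbX : IsPullback₂ PX κX (F ≫ Q ≫ κ) (fromDisc i) :=
    sX.isPullback₂ hX sX' PXu PXv PXa
      (by rw [onObj_comp, onObj_comp, reassoc_of% Fu, reassoc_of% Qu, κu])
      (by rw [onObj_comp, onObj_comp, reassoc_of% Fv, reassoc_of% Qv, κv])
      (by rw [onArr_comp, onArr_comp, reassoc_of% Fa, reassoc_of% Qa, κa]) κXu κXv κXa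
  have pbY : IsPullback₂ PY κY (Q ≫ κ) (fromDisc i) :=
    sY.isPullback₂ hY sY' PYu PYv PYa (by rw [onObj_comp, reassoc_of% Qu, κu])
      (by rw [onObj_comp, reassoc_of% Qv, κv]) (by rw [onArr_comp, reassoc_of% Qa, κa]) κYu κYv κYa
  have pbC : IsPullback₂ PC κC κ (fromDisc i) :=
    sC.isPullback₂ hC sC' PCu PCv PCa κu κv κa κCu κCv κCa
  have hco' : IsCoequalizer₂ F' G' Q' := h F G Q hFG hco κ (fromDisc i)
    (isDiscreteConduche_fromDisc i) PX κX PY κY PC κC F' G' Q' pbX pbY pbC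
    (sX'.hom_ext (by simp only [onObj_comp, reassoc_of% Fu', reassoc_of% PXu, PYu, Fu])
      (by simp only [onObj_comp, reassoc_of% Fv', reassoc_of% PXv, PYv, Fv])
      (by simp only [onArr_comp, reassoc_of% Fa', reassoc_of% PXa, PYa, Fa, reassoc_of% hf]))
    (sX'.hom_ext (by rw [onObj_comp, reassoc_of% Fu', κYu, κXu])
      (by rw [onObj_comp, reassoc_of% Fv', κYv, κXv])
      (by rw [onArr_comp, reassoc_of% Fa', κYa, κXa, hfx]))
    (sX'.hom_ext (by simp only [onObj_comp, reassoc_of% Gu', reassoc_of% PXu, PYu, Gu])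
      (by simp only [onObj_comp, reassoc_of% Gv', reassoc_of% PXv, PYv, Gv])
      (by simp only [onArr_comp, reassoc_of% Ga', reassoc_of% PXa, PYa, Ga, reassoc_of% hg]))
    (sX'.hom_ext (by rw [onObj_comp, reassoc_of% Gu', κYu, κXu])
      (by rw [onObj_comp, reassoc_of% Gv', κYv, κXv])
      (by rw [onArr_comp, reassoc_of% Ga', κYa, κXa, hgx]))
    (sY'.hom_ext (by simp only [onObj_comp, reassoc_of% Qu', reassoc_of% PYu, PCu, Qu])
      (by simp only [onObj_comp, reassoc_of% Qv', reassoc_of% PYv, PCv, Qv])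
      (by simp only [onArr_comp, reassoc_of% Qa', reassoc_of% PYa, PCa, Qa, reassoc_of% hq']))
    (sY'.hom_ext (by rw [onObj_comp, reassoc_of% Qu', κCu, κYu])
      (by rw [onObj_comp, reassoc_of% Qv', κCv, κYv])
      (by rw [onArr_comp, reassoc_of% Qa', κCa, κYa, hqy]))
  -- The suspensions of `q'` and of the coequaliser `d` are coequalisers of the same pair.
  obtain ⟨D, d, hd⟩ := IsCoeq.exists_isCoeq f' g'
  have hdepi := hd.epi
  obtain ⟨e, he⟩ := hd.exists_desc y (by rw [hfx, hgx])
  obtain ⟨k, hk⟩ := hd.exists_desc q' w'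
  have hke : k ≫ c' = e := by rw [← cancel_epi d, reassoc_of% hk, hqy, he]
  obtain ⟨SD, uD, vD, aD, sD⟩ := exists_isSuspension e
  obtain ⟨L, Lu, Lv, La⟩ := sY'.exists_mapOver sD d he
  obtain ⟨H, Hu, Hv, Ha⟩ := sD.exists_mapOver sC' k hke
  have hL := sX'.isCoequalizer₂ hd sY' sD he Fu' Fv' Fa' Gu' Gv' Ga' Lu Lv La
  have hLH : L ≫ H = Q' := sY'.hom_ext (by rw [onObj_comp, reassoc_of% Lu, Hu, Qu'])
    (by rw [onObj_comp, reassoc_of% Lv, Hv, Qv'])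
    (by rw [onArr_comp, reassoc_of% La, Ha, Qa', reassoc_of% hk])
  obtain ⟨t, ht, -⟩ := hco'.existsUnique_desc L hL.w
  have e₁ : t ≫ H = 𝟙 SC' := (hco'.existsUnique_desc Q' hco'.w).unique
    (by rw [reassoc_of% ht, hLH]) (Category.comp_id _)
  have e₂ : H ≫ t = 𝟙 SD := (hL.existsUnique_desc L hL.w).unique
    (by rw [reassoc_of% hLH, ht]) (Category.comp_id _)
  have := (isIso_components e₂ e₁).2
  have := sC'.isIso sD H Ha
  obtain ⟨_, hk'⟩ : IsCoeq f' g' q' := hk ▸ hd.comp_isIso k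
  exact hk'

end Stability

end InternalCat

theorem mainTheorem2 (E : Type u) [Category.{v} E] [HasPullbacks E] :
    (FinitaryExtensive E ∧ HasPullbackStableCoequalizers E ∧
        (InternalCat.forgetToGraph E).IsRightAdjoint) ↔
      (TwoCat.IsExtensive₂ (InternalCat E) ∧ TwoCat.HasFiniteColimits₂ (InternalCat E) ∧
        TwoCat.HasPullbacks₂ (InternalCat E) ∧ InternalCat.ConducheStableCoequalizers E) := by
  constructor
  · rintro ⟨_, hE, hU⟩
    exact ⟨InternalCat.isExtensive₂ E, InternalCat.hasFiniteColimits₂ hE hU,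
      InternalCat.hasPullbacks₂ E, InternalCat.conducheStableCoequalizers E hE⟩
  · rintro ⟨hX, hL, -, hS⟩
    have := InternalCat.finitaryExtensive_of_isExtensive₂ hX
    have := InternalCat.hasCoequalizers_of_hasFiniteColimits₂ hL
    exact ⟨inferInstance, InternalCat.hasPullbackStableCoequalizers hS,
      InternalCat.isRightAdjoint_forgetToGraph hL⟩
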